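/- **Conventions.** Let $\mathbf K$ be a (strict) 2-category. A *tangentad* $(\mathbb X,\mathbb T)$ in $\mathbf K$ is an object $\mathbb X$ with a tangent structure $\mathbb T=(T,p,z,s,l,c)$: a 1-morphism $T\colon\mathbb X\to\mathbb X$ and 2-morphisms $p\colon T\Rightarrow\mathrm{id}$, $z\colon\mathrm{id}\Rightarrow T$, $s\colon T_2\Rightarrow T$, $l\colon T\Rightarrow T^2$, $c\colon T^2\Rightarrow T^2$ satisfying the axioms of a tangent category (in the sense of Cockett and Cruttwell), where the $n$-fold pullbacks $T_n$ of $p$ along itself are pointwise (preserved by precomposition with every 1-morphism into $\mathbb X$) and preserved by all iterates $T^k$, and the pullback expressing the universality of the vertical lift is pointwise. A *lax tangent morphism* $(F,\alpha)\colon(\mathbb X,\mathbb T)\to(\mathbb X',\mathbb T')$ is a 1-morphism $F$ with a 2-morphism $\alpha\colon F\circ T\Rightarrow T'\circ F$ compatible with $p,z,s,l,c$; it is *strict* if $\alpha$ is an identity. A *tangent 2-morphism* is a 2-morphism compatible with the distributive laws $\alpha$. Tangentads, lax tangent morphisms and tangent 2-morphisms form the 2-category $\mathrm{Tng}(\mathbf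 K)$; with strict tangent morphisms they form $\mathrm{Tng}_=(\mathbf K)$. The Hom-category $[\mathbb X',\mathbb T'\,\|\,\mathbb X,\mathbb T]$ of $\mathrm{Tng}(\mathbf K)$ is a tangent category with tangent bundle functor $\bar T(G,\beta)=(T,c)\circ(G,\beta)$ and structure whiskered from $\mathbb T$. A *vector field* on an object $G$ of it is a morphism $u\colon G\to\bar TG$ with $p_G\circ u=\mathrm{id}_G$; a morphism $(G,u)\to(G',u')$ of vector fields is a morphism $\varphi\colon G\to G'$ with $\bar T\varphi\circ u=u'\circ\varphi$; these form a category $\mathrm{VF}[\mathbb X',\mathbb T'\,\|\,\mathbb X,\mathbb T]$. The tangentad $(\mathbb X,\mathbb T)$ *admits the construction of vector fields* if there are a tangentad $\mathrm{VF}(\mathbb X,\mathbb T)$, a strict tangent morphism $U\colon\mathrm{VF}(\mathbb X,\mathbb T)\to(\mathbb X,\mathbb T)$ and a vector field $\hat v\colon U\to\bar TU$ such that for every tangentad $(\mathbb X',\mathbb T')$ the functor $$\Gamma_{\hat v}\colon[\mathbb X',\mathbb T'\,\|\,\mathrm{VF}(\mathbb X,\mathbb T)]\to\mathrm{VF}[\mathbb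 X',\mathbb T'\,\|\,\mathbb X,\mathbb T],\qquad H\mapsto(U\circ H,\hat v_H),$$ is an isomorphism. The 2-category $\mathbf K$ *admits the construction of vector fields* if every tangentad in $\mathbf K$ does. An *additive bundle* in a category consists of $q\colon E\to B$ whose $n$-fold pullbacks $E_n$ along itself exist for all $n\ge1$, a section $z\colon B\to E$ of $q$, and a morphism $s\colon E_2\to E$ over $B$ which is associative, commutative and has $z$ as unit. **Theorem.** Let $\mathbf K$ be a 2-category and let $(\mathbb X,\mathbb T)$ be a tangentad in $\mathbf K$ which admits the construction of vector fields (for instance, any tangentad of a 2-category that admits the construction of vector fields), with $U\colon\mathrm{VF}(\mathbb X,\mathbb T)\to(\mathbb X,\mathbb T)$ and $\hat v$ as above. Assume that for every $n\ge1$ the $n$-fold 2-pullback of the underlying 1-morphism of $U$ along itself exists in $\mathbf K$. Then: 1. for every $n\ge1$ there is a tangentad $\mathrm{VF}_n(\mathbb X,\mathbb T)$ with strict tangent morphisms $\pi_1,\dots,\pi_n\colon\mathrm{VF}_n(\mathbb X,\mathbb T)\to\mathrm{VF}(\mathbb X,\mathbb T)$ which is the $n$-fold 2-pullback of $U$ along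 itself both in $\mathbf K$ (on underlying 1-morphisms) and in $\mathrm{Tng}(\mathbf K)$; 2. there is a strict tangent morphism $0\colon(\mathbb X,\mathbb T)\to\mathrm{VF}(\mathbb X,\mathbb T)$ with $\Gamma_{\hat v}(0)=(\mathrm{id}_{(\mathbb X,\mathbb T)},z)$; 3. there is a strict tangent morphism $+\colon\mathrm{VF}_2(\mathbb X,\mathbb T)\to\mathrm{VF}(\mathbb X,\mathbb T)$ with $\Gamma_{\hat v}(+)=(U_2,\hat v_1+\hat v_2)$, where $(U_2,\hat v_k)=\Gamma_{\hat v}(\pi_k)$, $U_2=U\circ\pi_1=U\circ\pi_2$, and $\hat v_1+\hat v_2=s_{U_2}\circ\langle\hat v_1,\hat v_2\rangle$; 4. $U$, with zero morphism $0$, sum morphism $+$ and the $\mathrm{VF}_n(\mathbb X,\mathbb T)$ as $n$-fold pullbacks, is an additive bundle in $\mathrm{Tng}_=(\mathbf K)$. -/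

import Mathlib

open CategoryTheory Bicategory

universe w v u

namespace Tangentads

/-! ### Additive bundles in a category -/

section Category

variable {C : Type u} [Category.{v} C]

/-- `π₁, ..., πₙ : P ⟶ E` is an `n`-fold pullback of `q : E ⟶ B` along itself (for `0 < n`). -/
structure IsNFoldPullback {E B P : C} (q : E ⟶ B) {n : ℕ} (π : Fin n → (P ⟶ E)) : Prop where
  comm : ∀ i j, π i ≫ q = π j ≫ q
  existsUnique_lift : ∀ {Y : C} (f : Fin n → (Y ⟶ E)), (∀ i j, f i ≫ q = f j ≫ q) →
    ∃! h : Y ⟶ P, ∀ i, h ≫ π i = f i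

/-- The morphism `h` into the twofold pullback `E₂` is the pairing `⟨a, b⟩`. -/
def IsPair {E E₂ Y : C} (π : Fin 2 → (E₂ ⟶ E)) (h : Y ⟶ E₂) (a b : Y ⟶ E) : Prop :=
  h ≫ π 0 = a ∧ h ≫ π 1 = b

/-- `(q : E ⟶ B, z : B ⟶ E, s : E₂ ⟶ E)` is an additive bundle, where `π n` exhibits `En n` as the
`n`-fold pullback of `q` along itself for every `n > 0` (the value `En 0` is irrelevant).
All the pairings below exist and are unique by the universal property of `E₂`. -/
structure IsAdditiveBundle {E B : C} (q : E ⟶ B) {En : ℕ → C} (π : ∀ n, Fin n → (En n ⟶ E))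
    (z : B ⟶ E) (s : En 2 ⟶ E) : Prop where
  isNFoldPullback : ∀ n, 0 < n → IsNFoldPullback q (π n)
  zero_proj : z ≫ q = 𝟙 B
  sum_proj : s ≫ q = π 2 0 ≫ q
  assoc : ∃ a₁₂ a₂₃ l r : En 3 ⟶ En 2,
    IsPair (π 2) a₁₂ (π 3 0) (π 3 1) ∧ IsPair (π 2) a₂₃ (π 3 1) (π 3 2) ∧
    IsPair (π 2) l (a₁₂ ≫ s) (π 3 2) ∧ IsPair (π 2) r (π 3 0) (a₂₃ ≫ s) ∧ l ≫ s = r ≫ s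
  unit : ∃ h : E ⟶ En 2, IsPair (π 2) h (q ≫ z) (𝟙 E) ∧ h ≫ s = 𝟙 E
  symm : ∃ τ : En 2 ⟶ En 2, IsPair (π 2) τ (π 2 1) (π 2 0) ∧ τ ≫ s = s

/-- `(f, g)` is an additive bundle morphism from `(q, z, s)` to `(q', z', s')`; the morphism `g₂` is
the morphism `g ×_f g` between the twofold pullbacks. -/
structure IsAdditiveBundleHom {E B E₂ E' B' E₂' : C}
    (q : E ⟶ B) (z : B ⟶ E) (π : Fin 2 → (E₂ ⟶ E)) (s : E₂ ⟶ E)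
    (q' : E' ⟶ B') (z' : B' ⟶ E') (π' : Fin 2 → (E₂' ⟶ E')) (s' : E₂' ⟶ E')
    (f : B ⟶ B') (g : E ⟶ E') : Prop where
  proj : g ≫ q' = q ≫ f
  zero : z ≫ g = f ≫ z'
  sum : ∃ g₂ : E₂ ⟶ E₂', (∀ i, g₂ ≫ π' i = π i ≫ g) ∧ g₂ ≫ s' = s ≫ g

end Category

/-! ### Strict `n`-fold 2-pullbacks -/

/-- `π₁, ..., πₙ : P ⟶ E` is an `n`-fold 2-pullback of `q : E ⟶ B` along itself (for `0 < n`):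
it has the universal property of the `n`-fold pullback for 1-morphisms, and families of
2-morphisms `h ≫ πᵢ ⟶ h' ≫ πᵢ` with a common image under `q` lift uniquely to `h ⟶ h'`. -/
structure IsNFoldTwoPullback {K : Type u} [Bicategory.{w, v} K] {E B P : K} (q : E ⟶ B) {n : ℕ}
    (π : Fin n → (P ⟶ E)) : Prop where
  comm : ∀ i j, π i ≫ q = π j ≫ q
  existsUnique_lift : ∀ {Y : K} (f : Fin n → (Y ⟶ E)), (∀ i j, f i ≫ q = f j ≫ q) →
    ∃! h : Y ⟶ P, ∀ i, h ≫ π i = f i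
  existsUnique_lift₂ : ∀ {Y : K} (h h' : Y ⟶ P) (θ : ∀ i, h ≫ π i ⟶ h' ≫ π i),
    (∀ i j, ((α_ h (π i) q).inv ≫ θ i ▷ q ≫ (α_ h' (π i) q).hom) ≫
        eqToHom (congrArg (h' ≫ ·) (comm i j)) =
      eqToHom (congrArg (h ≫ ·) (comm i j)) ≫
        ((α_ h (π j) q).inv ≫ θ j ▷ q ≫ (α_ h' (π j) q).hom)) →
    ∃! Θ : h ⟶ h', ∀ i, Θ ▷ π i = θ i

/-! ### Tangentads

Composition is written in diagrammatic order: the composite `G ∘ F` is `F ≫ G`, the whiskering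
`Gφ` is `φ ▷ G` and the whiskering `φ_F` is `F ◁ φ`. -/

variable {K : Type u} [Bicategory.{w, v} K]

/-- The iterates `Tᵏ` of an endomorphism. -/
def iter {X : K} (T : X ⟶ X) : ℕ → (X ⟶ X)
  | 0 => 𝟙 X
  | k + 1 => iter T k ≫ T

/-- A tangent structure on an object of a 2-category. -/
structure TangentStructure (X : K) where
  /-- tangent bundle 1-morphism -/
  T : X ⟶ X
  /-- projection -/
  p : T ⟶ 𝟙 X
  /-- `Tn n` is the `n`-fold pullback of the projection for `n > 0` (`Tn 0` is irrelevant) -/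
  Tn : ℕ → (X ⟶ X)
  /-- the projections of the `n`-fold pullback -/
  proj : ∀ n, Fin n → (Tn n ⟶ T)
  /-- zero morphism -/
  z : 𝟙 X ⟶ T
  /-- sum morphism -/
  s : Tn 2 ⟶ T
  /-- vertical lift -/
  l : T ⟶ T ≫ T
  /-- canonical flip -/
  c : T ≫ T ⟶ T ≫ T
  additive : IsAdditiveBundle p proj z s
  /-- the `n`-fold pullbacks are pointwise and are preserved by all iterates of `T` -/
  isNFoldPullback : ∀ n, 0 < n → ∀ {Y : K} (F : Y ⟶ X) (k : ℕ),
    IsNFoldPullback (F ◁ (p ▷ iter T k)) (fun i => F ◁ (proj n i ▷ iter T k))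
  /-- `(z, l) : 𝐩 ⟶ T𝐩` is an additive bundle morphism -/
  lift_additive : IsAdditiveBundleHom p z (proj 2) s
    (p ▷ T) (z ▷ T) (fun i => proj 2 i ▷ T) (s ▷ T) (z ≫ (λ_ T).inv) l
  /-- `(id, c) : T𝐩 ⟶ 𝐩_T` is an additive bundle morphism -/
  flip_additive : IsAdditiveBundleHom (p ▷ T) (z ▷ T) (fun i => proj 2 i ▷ T) (s ▷ T)
    (T ◁ p) (T ◁ z) (fun i => T ◁ proj 2 i) (T ◁ s) ((λ_ T).hom ≫ (ρ_ T).inv) c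
  lift_coassoc : l ≫ l ▷ T = l ≫ T ◁ l ≫ (α_ T T T).inv
  lift_flip : l ≫ c = l
  flip_lift : T ◁ l ≫ (α_ T T T).inv ≫ c ▷ T ≫ (α_ T T T).hom ≫ T ◁ c ≫ (α_ T T T).inv =
    c ≫ l ▷ T
  flip_flip : c ≫ c = 𝟙 (T ≫ T)
  flip_braid : c ▷ T ≫ (α_ T T T).hom ≫ T ◁ c ≫ (α_ T T T).inv ≫ c ▷ T =
    (α_ T T T).hom ≫ T ◁ c ≫ (α_ T T T).inv ≫ c ▷ T ≫ (α_ T T T).hom ≫ T ◁ c ≫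
      (α_ T T T).inv
  /-- universality of the vertical lift, where `m = ⟨l ∘ π₁, z_T ∘ π₂⟩` -/
  locally_linear : ∃ m : Tn 2 ⟶ Tn 2 ≫ T,
    m ≫ proj 2 0 ▷ T = proj 2 0 ≫ l ∧ m ≫ proj 2 1 ▷ T = proj 2 1 ≫ (ρ_ T).inv ≫ T ◁ z ∧
    ∀ {Y : K} (F : Y ⟶ X), IsPullback (F ◁ (m ≫ s ▷ T)) (F ◁ (proj 2 0 ≫ p))
      (F ◁ (p ▷ T)) (F ◁ (z ≫ (λ_ T).inv))

variable (K) in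
/-- A tangentad in `K`. -/
structure Tng where
  /-- the base object -/
  obj : K
  /-- the tangent structure -/
  str : TangentStructure obj

/-- Given `α : F ∘ T ⟶ T' ∘ F`, the composite `T'α ∘ α_T : F ∘ T² ⟶ T'² ∘ F`. -/
def double {X Y : K} {T : X ⟶ X} {T' : Y ⟶ Y} {F : X ⟶ Y} (α : T ≫ F ⟶ F ≫ T') :
    (T ≫ T) ≫ F ⟶ F ≫ T' ≫ T' :=
  (α_ T T F).hom ≫ T ◁ α ≫ (α_ T F T').inv ≫ α ▷ T' ≫ (α_ F T' T').hom

/-- Lax tangent 1-morphisms. -/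
structure LaxMor (X Y : Tng K) where
  /-- the underlying 1-morphism -/
  F : X.obj ⟶ Y.obj
  /-- the lax distributive law -/
  α : X.str.T ≫ F ⟶ F ≫ Y.str.T
  additive : IsAdditiveBundleHom
    (X.str.p ▷ F) (X.str.z ▷ F) (fun i => X.str.proj 2 i ▷ F) (X.str.s ▷ F)
    (F ◁ Y.str.p) (F ◁ Y.str.z) (fun i => F ◁ Y.str.proj 2 i) (F ◁ Y.str.s)
    ((λ_ F).hom ≫ (ρ_ F).inv) α
  lift : X.str.l ▷ F ≫ double α = α ≫ F ◁ Y.str.l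
  flip : X.str.c ▷ F ≫ double α = double α ≫ F ◁ Y.str.c

/-- A tangent 1-morphism is strict when its distributive law is an identity. -/
def LaxMor.IsStrict {X Y : Tng K} (f : LaxMor X Y) : Prop :=
  ∃ h : X.str.T ≫ f.F = f.F ≫ Y.str.T, f.α = eqToHom h

/-- Tangent 2-morphisms. -/
@[ext]
structure TwoMor {X Y : Tng K} (f g : LaxMor X Y) where
  /-- the underlying 2-morphism -/
  φ : f.F ⟶ g.F
  comm : f.α ≫ φ ▷ Y.str.T = X.str.T ◁ φ ≫ g.α

theorem double_comp {X Y Z : K} {T : X ⟶ X} {T' : Y ⟶ Y} {T'' : Z ⟶ Z} {F : X ⟶ Y} {G : Y ⟶ Z}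
    (α : T ≫ F ⟶ F ≫ T') (β : T' ≫ G ⟶ G ≫ T'') :
    double ((α_ T F G).inv ≫ α ▷ G ≫ (α_ F T' G).hom ≫ F ◁ β ≫ (α_ F G T'').inv) =
      (α_ (T ≫ T) F G).inv ≫ double α ▷ G ≫ (α_ F (T' ≫ T') G).hom ≫ F ◁ double β ≫
        (α_ F G (T'' ≫ T'')).inv := by
  have h := whisker_exchange α β
  calc
    _ = 𝟙 _ ⊗≫ T ◁ α ▷ G ⊗≫ ((T ≫ F) ◁ β ≫ α ▷ (G ≫ T'')) ⊗≫ F ◁ β ▷ T'' ⊗≫ 𝟙 _ := by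
      simp only [double]; bicategory
    _ = _ := by
      rw [h]; simp only [double]; bicategory

/-- The identity lax tangent 1-morphism. -/
def LaxMor.id (X : Tng K) : LaxMor X X where
  F := 𝟙 X.obj
  α := (ρ_ X.str.T).hom ≫ (λ_ X.str.T).inv
  additive := by
    constructor
    · simp
    · simp
    · refine ⟨(ρ_ _).hom ≫ (λ_ _).inv, ?_, ?_⟩ <;> simp
  lift := by simp [double]
  flip := by simp [double]

/-- The composite of lax tangent 1-morphisms. -/
def LaxMor.comp {X Y Z : Tng K} (f : LaxMor X Y) (g : LaxMor Y Z) : LaxMor X Z where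
  F := f.F ≫ g.F
  α := (α_ X.str.T f.F g.F).inv ≫ f.α ▷ g.F ≫ (α_ f.F Y.str.T g.F).hom ≫ f.F ◁ g.α ≫
    (α_ f.F g.F Z.str.T).inv
  additive := by
    obtain ⟨fp, fz, f₂, fπ, fs⟩ := f.additive
    obtain ⟨gp, gz, g₂, gπ, gs⟩ := g.additive
    refine ⟨?_, ?_, (α_ (X.str.Tn 2) f.F g.F).inv ≫ f₂ ▷ g.F ≫
        (α_ f.F (Y.str.Tn 2) g.F).hom ≫ f.F ◁ g₂ ≫ (α_ f.F g.F (Z.str.Tn 2)).inv, fun i => ?_, ?_⟩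
    · have h1 := congrArg (f.F ◁ ·) gp
      have h2 := congrArg (fun t => t ▷ g.F ≫ (α_ _ _ _).hom) fp
      simp at h1 h2 ⊢
      rw [reassoc_of% h1, reassoc_of% h2]
      simp
    · have h1 := congrArg (f.F ◁ ·) gz
      have h2 := congrArg (· ▷ g.F) fz
      simp at h1 h2 ⊢
      rw [reassoc_of% h2]
      simp
      rw [reassoc_of% h1]
      simp
    · have h1 := congrArg (f.F ◁ ·) (gπ i)
      have h2 := congrArg (fun t => t ▷ g.F ≫ (α_ _ _ _).hom) (fπ i)
      simp at h1 h2 ⊢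
      rw [reassoc_of% h1, reassoc_of% h2]
    · have h1 := congrArg (f.F ◁ ·) gs
      have h2 := congrArg (fun t => t ▷ g.F ≫ (α_ _ _ _).hom) fs
      simp at h1 h2 ⊢
      rw [reassoc_of% h1, reassoc_of% h2]
  lift := by
    rw [double_comp]
    have h1 := congrArg (f.F ◁ ·) g.lift
    have h2 := congrArg (· ▷ g.F) f.lift
    simp at h1 h2 ⊢
    rw [reassoc_of% h2]
    simp
    rw [reassoc_of% h1]
  flip := by
    rw [double_comp]
    have h1 := congrArg (f.F ◁ ·) g.flip
    have h2 := congrArg (· ▷ g.F) f.flip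
    simp at h1 h2 ⊢
    rw [reassoc_of% h2]
    simp
    rw [reassoc_of% h1]

namespace TwoMor
variable {X Y Z W : Tng K}

/-- The identity tangent 2-morphism. -/
def id (f : LaxMor X Y) : TwoMor f f where
  φ := 𝟙 f.F
  comm := by simp

/-- Vertical composition. -/
def comp {f g h : LaxMor X Y} (a : TwoMor f g) (b : TwoMor g h) : TwoMor f h where
  φ := a.φ ≫ b.φ
  comm := by
    simp only [comp_whiskerRight, whiskerLeft_comp, Category.assoc]
    rw [← b.comm, reassoc_of% a.comm]

instance : Category (LaxMor X Y) where
  Hom f g := TwoMor f g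
  id := id
  comp := comp
  id_comp _ := TwoMor.ext (Category.id_comp _)
  comp_id _ := TwoMor.ext (Category.comp_id _)
  assoc _ _ _ := TwoMor.ext (Category.assoc _ _ _)

/-- Left whiskering. -/
def whiskerLeft (f : LaxMor X Y) {g h : LaxMor Y Z} (a : g ⟶ h) : f.comp g ⟶ f.comp h where
  φ := f.F ◁ a.φ
  comm := by
    have h1 := congrArg (f.F ◁ ·) a.comm
    have h2 := congrArg (fun t => (α_ _ _ _).inv ≫ t ≫ (α_ _ _ _).hom) (whisker_exchange f.α a.φ)
    simp [LaxMor.comp] at h1 h2 ⊢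
    rw [reassoc_of% h1, ← reassoc_of% h2]

/-- Right whiskering. -/
def whiskerRight {f g : LaxMor X Y} (a : f ⟶ g) (h : LaxMor Y Z) : f.comp h ⟶ g.comp h where
  φ := a.φ ▷ h.F
  comm := by
    have h1 := congrArg (fun t => (α_ _ _ _).inv ≫ t ▷ h.F) a.comm
    have h2 := congrArg (fun t => t ≫ (α_ _ _ _).inv) (whisker_exchange a.φ h.α)
    simp [LaxMor.comp] at h1 h2 ⊢
    rw [h2, Iso.hom_inv_id_assoc, reassoc_of% h1]

/-- An invertible tangent 2-morphism from an invertible 2-morphism. -/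
def isoMk {f g : LaxMor X Y} (e : f.F ≅ g.F)
    (h : f.α ≫ e.hom ▷ Y.str.T = X.str.T ◁ e.hom ≫ g.α) : f ≅ g where
  hom := ⟨e.hom, h⟩
  inv := ⟨e.inv, by
    have := congrArg (fun t => X.str.T ◁ e.inv ≫ t ≫ e.inv ▷ Y.str.T) h
    simpa using this.symm⟩
  hom_inv_id := TwoMor.ext e.hom_inv_id
  inv_hom_id := TwoMor.ext e.inv_hom_id

end TwoMor

/-- The 2-category of tangentads, lax tangent 1-morphisms and tangent 2-morphisms. -/
instance : Bicategory (Tng K) where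
  Hom X Y := LaxMor X Y
  id := LaxMor.id
  comp := LaxMor.comp
  whiskerLeft f _ _ a := TwoMor.whiskerLeft f a
  whiskerRight a h := TwoMor.whiskerRight a h
  associator f g h := TwoMor.isoMk (f := (f.comp g).comp h) (g := f.comp (g.comp h))
    (α_ f.F g.F h.F) (by simp [LaxMor.comp])
  leftUnitor {X _} f := TwoMor.isoMk (f := (LaxMor.id X).comp f) (g := f) (λ_ f.F)
    (by simp [LaxMor.comp, LaxMor.id])
  rightUnitor {_ Y} f := TwoMor.isoMk (f := f.comp (LaxMor.id Y)) (g := f) (ρ_ f.F)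
    (by simp [LaxMor.comp, LaxMor.id])
  whiskerLeft_id _ _ := TwoMor.ext (Bicategory.whiskerLeft_id _ _)
  whiskerLeft_comp _ _ _ _ _ _ := TwoMor.ext (Bicategory.whiskerLeft_comp _ _ _)
  id_whiskerLeft _ := TwoMor.ext (Bicategory.id_whiskerLeft _)
  comp_whiskerLeft _ _ _ _ _ := TwoMor.ext (Bicategory.comp_whiskerLeft _ _ _)
  id_whiskerRight _ _ := TwoMor.ext (Bicategory.id_whiskerRight _ _)
  comp_whiskerRight _ _ _ := TwoMor.ext (Bicategory.comp_whiskerRight _ _ _)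
  whiskerRight_id _ := TwoMor.ext (Bicategory.whiskerRight_id _)
  whiskerRight_comp _ _ _ := TwoMor.ext (Bicategory.whiskerRight_comp _ _ _)
  whisker_assoc _ _ _ _ _ := TwoMor.ext (Bicategory.whisker_assoc _ _ _)
  whisker_exchange _ _ := TwoMor.ext (Bicategory.whisker_exchange _ _)
  pentagon _ _ _ _ := TwoMor.ext (Bicategory.pentagon _ _ _ _)
  triangle _ _ := TwoMor.ext (Bicategory.triangle _ _)

theorem eq_of_iso {X Y : Tng K} {f g : LaxMor X Y} (e : f ≅ g) (h : f.F = g.F)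
    (he : e.hom.φ = eqToHom h) : f = g := by
  obtain ⟨F, α, _, _, _⟩ := f
  obtain ⟨G, β, _, _, _⟩ := g
  obtain rfl : F = G := h
  have := e.hom.comm
  rw [he] at this
  simp at this
  subst this
  rfl

theorem eqToHom_φ {X Y : Tng K} {f g : X ⟶ Y} (h : f = g) :
    (eqToHom h : f ⟶ g).φ = eqToHom (congrArg LaxMor.F h) := by
  subst h
  rfl

/-- Tangentads, lax tangent 1-morphisms and tangent 2-morphisms form a (strict) 2-category. -/
instance [Bicategory.Strict K] : Bicategory.Strict (Tng K) where
  id_comp f := eq_of_iso (λ_ f) (Strict.id_comp f.F)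
    (congrArg Iso.hom (Strict.leftUnitor_eqToIso f.F))
  comp_id f := eq_of_iso (ρ_ f) (Strict.comp_id f.F)
    (congrArg Iso.hom (Strict.rightUnitor_eqToIso f.F))
  assoc f g h := eq_of_iso (α_ f g h) (Strict.assoc f.F g.F h.F)
    (congrArg Iso.hom (Strict.associator_eqToIso f.F g.F h.F))
  leftUnitor_eqToIso f := Iso.ext <| TwoMor.ext <| by
    rw [eqToIso.hom, eqToHom_φ]
    exact congrArg Iso.hom (Strict.leftUnitor_eqToIso f.F)
  rightUnitor_eqToIso f := Iso.ext <| TwoMor.ext <| by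
    rw [eqToIso.hom, eqToHom_φ]
    exact congrArg Iso.hom (Strict.rightUnitor_eqToIso f.F)
  associator_eqToIso f g h := Iso.ext <| TwoMor.ext <| by
    rw [eqToIso.hom, eqToHom_φ]
    exact congrArg Iso.hom (Strict.associator_eqToIso f.F g.F h.F)

theorem isStrict_id [Bicategory.Strict K] (X : Tng K) : LaxMor.IsStrict (𝟙 X) := by
  refine ⟨(Strict.comp_id _).trans (Strict.id_comp _).symm, ?_⟩
  change (ρ_ X.str.T).hom ≫ (λ_ X.str.T).inv = _
  simp only [Strict.leftUnitor_eqToIso, Strict.rightUnitor_eqToIso, eqToIso.hom, eqToIso.inv,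
    eqToHom_trans]
  rfl

theorem isStrict_comp [Bicategory.Strict K] {X Y Z : Tng K} {f : X ⟶ Y} {g : Y ⟶ Z}
    (hf : LaxMor.IsStrict f) (hg : LaxMor.IsStrict g) : LaxMor.IsStrict (f ≫ g) := by
  obtain ⟨hf, ef⟩ := hf
  obtain ⟨hg, eg⟩ := hg
  refine ⟨?_, ?_⟩
  · change X.str.T ≫ f.F ≫ g.F = (f.F ≫ g.F) ≫ Z.str.T
    rw [← Strict.assoc, hf, Strict.assoc, hg, Strict.assoc]
  change (α_ X.str.T f.F g.F).inv ≫ f.α ▷ g.F ≫ (α_ f.F Y.str.T g.F).hom ≫ f.F ◁ g.α ≫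
    (α_ f.F g.F Z.str.T).inv = _
  simp only [ef, eg, Strict.associator_eqToIso, eqToIso.hom, eqToIso.inv, eqToHom_whiskerRight,
    whiskerLeft_eqToHom, eqToHom_trans]
  rfl

variable (K) in
/-- The tangentads of `K`, as objects of the (underlying category of the) 2-category of tangentads
and strict tangent 1-morphisms. -/
structure StrictTng where
  /-- a tangentad, regarded as an object of `StrictTng K` -/
  of ::
  /-- the underlying tangentad -/
  toTng : Tng K

instance [Bicategory.Strict K] : Category (StrictTng K) where
  Hom X Y := { f : X.toTng ⟶ Y.toTng // LaxMor.IsStrict f }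
  id X := ⟨𝟙 X.toTng, isStrict_id _⟩
  comp f g := ⟨f.1 ≫ g.1, isStrict_comp f.2 g.2⟩
  id_comp _ := Subtype.ext (Strict.id_comp _)
  comp_id _ := Subtype.ext (Strict.comp_id _)
  assoc _ _ _ := Subtype.ext (Strict.assoc _ _ _)

namespace Tng

/-- The tangent bundle 1-morphism as the lax tangent 1-morphism `(T, c)`. Postcomposition with it is
the tangent bundle functor of the Hom-tangent categories. -/
def tangent (X : Tng K) : X ⟶ X where
  F := X.str.T
  α := X.str.c
  additive := X.str.flip_additive
  lift := by
    have h := X.str.flip_lift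
    have h2 := congrArg (X.str.c ≫ ·) h
    simp only [← Category.assoc, X.str.flip_flip, Category.id_comp] at h2
    rw [← h2]
    have h3 := congrArg (fun t => (α_ X.str.T X.str.T X.str.T).hom ≫ X.str.T ◁ t) X.str.flip_flip
    have h4 := congrArg (fun t => t ▷ X.str.T) X.str.flip_flip
    simp [double] at h3 h4 ⊢
    rw [reassoc_of% h3, Iso.hom_inv_id_assoc, reassoc_of% h4]
    simp
  flip := by
    simpa [double] using X.str.flip_braid =≫ (α_ X.str.T X.str.T X.str.T).hom

/-- The projection `p` as a tangent 2-morphism. -/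
def proj (X : Tng K) : X.tangent ⟶ 𝟙 X where
  φ := X.str.p
  comm := by
    have h := X.str.flip_additive.proj
    have h2 := congrArg (X.str.c ≫ ·) h
    simp only [← Category.assoc, X.str.flip_flip, Category.id_comp] at h2
    change X.str.c ≫ X.str.p ▷ X.str.T = X.str.T ◁ X.str.p ≫ (ρ_ X.str.T).hom ≫ (λ_ X.str.T).inv
    rw [h2]
    simp

/-- The zero morphism `z` as a tangent 2-morphism. -/
def zero (X : Tng K) : 𝟙 X ⟶ X.tangent where
  φ := X.str.z
  comm := by
    have h := congrArg (· ≫ X.str.c) X.str.flip_additive.zero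
    simp only [Category.assoc, X.str.flip_flip, Category.comp_id] at h
    change ((ρ_ X.str.T).hom ≫ (λ_ X.str.T).inv) ≫ X.str.z ▷ X.str.T =  X.str.T ◁ X.str.z ≫ X.str.c
    rw [h]
    simp

end Tng

/-! ### Vector fields in the Hom-tangent categories

The Hom-tangent category `[Y | X]` is the category `Y ⟶ X` of lax tangent 1-morphisms and tangent
2-morphisms; its tangent bundle functor is `G ↦ G ≫ X.tangent` and its structural morphisms at `G`
are obtained from those of `X` by whiskering with `G`. -/

/-- Vector fields on the object `G` of the Hom-tangent category `[Y | X]`. -/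
structure VectorFieldOn {Y X : Tng K} (G : Y ⟶ X) where
  /-- the underlying morphism from `G` to its tangent bundle -/
  vec : G ⟶ G ≫ X.tangent
  section_proj : vec ≫ G ◁ X.proj ≫ (ρ_ G).hom = 𝟙 G

/-- The vector field `w` is the sum of `u` and `v`, that is, `w = s_G ∘ ⟨u, v⟩`. -/
def VectorFieldOn.IsSum {Y X : Tng K} {G : Y ⟶ X} (u v w : VectorFieldOn G) : Prop :=
  ∃ h : G.F ⟶ G.F ≫ X.str.Tn 2,
    IsPair (fun i => G.F ◁ X.str.proj 2 i) h u.vec.φ v.vec.φ ∧ h ≫ G.F ◁ X.str.s = w.vec.φ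

/-- The objects of the tangent category of vector fields of the Hom-tangent category `[Y | X]`. -/
structure VectorField (Y X : Tng K) where
  /-- the base object -/
  base : Y ⟶ X
  /-- the vector field on it -/
  field : VectorFieldOn base

/-- The morphisms of vector fields. -/
@[ext]
structure VectorField.Hom {Y X : Tng K} (A B : VectorField Y X) where
  /-- the underlying tangent 2-morphism -/
  hom : A.base ⟶ B.base
  comm : A.field.vec ≫ hom ▷ X.tangent = hom ≫ B.field.vec

instance (Y X : Tng K) : Category (VectorField Y X) where
  Hom A B := VectorField.Hom A B
  id A := ⟨𝟙 A.base, by simp⟩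
  comp f g := ⟨f.hom ≫ g.hom, by
    rw [Bicategory.comp_whiskerRight, reassoc_of% f.comm, g.comm, Category.assoc]⟩
  id_comp _ := VectorField.Hom.ext (Category.id_comp _)
  comp_id _ := VectorField.Hom.ext (Category.comp_id _)
  assoc _ _ _ := VectorField.Hom.ext (Category.assoc _ _ _)

/-- The functor `Γ_v : [Y | Z] ⥤ VF[Y | X]` induced by a vector field `v` on `U : Z ⟶ X`: it sends
`H` to the vector field `v_H` on `U ∘ H`. -/
def inducedFunctor {Z X : Tng K} (U : Z ⟶ X) (v : VectorFieldOn U) (Y : Tng K) :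
    (Y ⟶ Z) ⥤ VectorField Y X where
  obj H :=
    { base := H ≫ U
      field :=
        { vec := H ◁ v.vec ≫ (α_ H U X.tangent).inv
          section_proj := by
            have h := congrArg (H ◁ ·) v.section_proj
            simp at h ⊢
            exact h } }
  map {H H'} φ := ⟨φ ▷ U, by
    have h := congrArg (fun t => t ≫ (α_ _ _ _).inv) (whisker_exchange φ v.vec)
    simp at h ⊢
    exact h⟩
  map_id H := VectorField.Hom.ext (Bicategory.id_whiskerRight _ _)
  map_comp φ ψ := VectorField.Hom.ext (Bicategory.comp_whiskerRight _ _ _)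

/-- The zero vector field `z` on the identity of `X`. -/
def zeroVectorField (X : Tng K) : VectorField X X where
  base := 𝟙 X
  field :=
    { vec := X.zero ≫ (λ_ X.tangent).inv
      section_proj := by
        have h : X.zero ≫ X.proj = 𝟙 (𝟙 X) := TwoMor.ext X.str.additive.zero_proj
        simpa using h }

/-- The construction of vector fields for a tangentad `X`: a tangentad `VF` with a strict tangent
1-morphism `U : VF ⟶ X` and a universal vector field on `U`, i.e. one for which every induced
functor `Γ : [Y | VF] ⥤ VF[Y | X]` is an isomorphism of categories. (As `U` is strict, `Γ` commutes
strictly with the tangent structures, and so does its inverse functor.) -/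
structure VectorFieldsConstruction (X : Tng K) where
  /-- the tangentad of vector fields -/
  VF : Tng K
  /-- the forgetful 1-morphism -/
  U : VF ⟶ X
  isStrict : LaxMor.IsStrict U
  /-- the universal vector field -/
  univ : VectorFieldOn U
  invertible : ∀ Y : Tng K, ∃ Λ : VectorField Y X ⥤ (Y ⟶ VF),
    inducedFunctor U univ Y ⋙ Λ = 𝟭 (Y ⟶ VF) ∧ Λ ⋙ inducedFunctor U univ Y = 𝟭 (VectorField Y X)

namespace VectorFieldsConstruction

variable {X : Tng K} (V : VectorFieldsConstruction X)

/-- The vector field classified by a lax tangent 1-morphism `H : Y ⟶ VF`. -/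
def classified {Y : Tng K} (H : Y ⟶ V.VF) : VectorField Y X :=
  (inducedFunctor V.U V.univ Y).obj H

/-- The forgetful 1-morphism `U` as a morphism of `StrictTng K`. -/
def strictU [Bicategory.Strict K] : StrictTng.of V.VF ⟶ StrictTng.of X :=
  ⟨V.U, V.isStrict⟩

end VectorFieldsConstruction

end Tangentads

open Tangentads

/-! Since every `Γ` is an isomorphism of categories, a 1-morphism into the tangentad of vector
fields is the same as a vector field, and a 2-morphism is the same as a morphism of vector fields.
So `0` and `+` exist as lax morphisms once the zero field and the sum of the two tautological fields
on `VFn 2` are known to be vector fields. The additive bundle equations between morphisms into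
`V.VF` reduce to equations between vector fields, which are the additive bundle axioms of `p`
whiskered with the base (`isAdditiveBundle`). Strictness is automatic: if `H ≫ U` is strict, then `T
≫ H` and `H ≫ T` classify the same vector field, and faithfulness of `Γ` makes the distributive law
of `H` an identity (`isStrict_of_comp`).

The tangent structure on a 2-pullback `P` of `U` is created by the projections: each 1- and
2-morphism lifts because its components agree after `U`, equations are tested on components, and the
required pullbacks glue (`IsNFoldTwoPullback.exists_strictMap`). This needs `U` to preserve the
structure on the nose, including the chosen fibre powers `Tₙ`, whereas strictness of `U` only
concerns `T`. The gap is closed by universality again: `Tₙ ∘ U` carries a vector field assembled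
from the fields `v̂_T` on its factors, and its classifying 1-morphism is isomorphic to the fibre
power of `V.VF` and lies strictly over `Tₙ` (`exists_fibrePower`, `exists_iso_fibrePower`).
Replacing the chosen fibre powers by these makes `U` a `StrictMap`. Finally `Tng.isNFoldTwoPullback`
lifts the universal property from `K` to tangentads.

Computations take place in the type `Cell`, where coherence isomorphisms of a strict 2-category
become identities. -/

namespace Tangentads

/-! ### Two-cells of a strict 2-category as a single type -/

/-- A 2-morphism of `K` between 1-morphisms `A ⟶ B`, together with its source and target. -/
structure Cell {K : Type u} [Bicategory.{w, v} K] (A B : K) where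
  /-- the source -/
  src : A ⟶ B
  /-- the target -/
  tgt : A ⟶ B
  /-- the 2-morphism -/
  hom : src ⟶ tgt

section Cell

variable {K : Type u} [Bicategory.{w, v} K] {A B C D : K}

/-- A 2-morphism as a cell. -/
def cell {f g : A ⟶ B} (φ : f ⟶ g) : Cell A B := ⟨f, g, φ⟩

namespace Cell

/-- The identity cell. -/
def one (f : A ⟶ B) : Cell A B := ⟨f, f, 𝟙 f⟩

/-- Vertical composition of cells. -/
def comp (a b : Cell A B) (h : a.tgt = b.src) : Cell A B := ⟨a.src, b.tgt, a.hom ≫ eqToHom h ≫ b.hom⟩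

/-- Left whiskering of cells. -/
def wl (f : A ⟶ B) (a : Cell B C) : Cell A C := ⟨f ≫ a.src, f ≫ a.tgt, f ◁ a.hom⟩

/-- Right whiskering of cells. -/
def wr (a : Cell A B) (f : B ⟶ C) : Cell A C := ⟨a.src ≫ f, a.tgt ≫ f, a.hom ▷ f⟩

end Cell

open Cell

@[simp] theorem cell_src {f g : A ⟶ B} (φ : f ⟶ g) : (cell φ).src = f := rfl
@[simp] theorem cell_tgt {f g : A ⟶ B} (φ : f ⟶ g) : (cell φ).tgt = g := rfl
@[simp] theorem one_src (f : A ⟶ B) : (one f).src = f := rfl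
@[simp] theorem one_tgt (f : A ⟶ B) : (one f).tgt = f := rfl
@[simp] theorem comp_src (a b : Cell A B) (h) : (a.comp b h).src = a.src := rfl
@[simp] theorem comp_tgt (a b : Cell A B) (h) : (a.comp b h).tgt = b.tgt := rfl
@[simp] theorem wl_src (f : A ⟶ B) (a : Cell B C) : (wl f a).src = f ≫ a.src := rfl
@[simp] theorem wl_tgt (f : A ⟶ B) (a : Cell B C) : (wl f a).tgt = f ≫ a.tgt := rfl
@[simp] theorem wr_src (a : Cell A B) (f : B ⟶ C) : (wr a f).src = a.src ≫ f := rfl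
@[simp] theorem wr_tgt (a : Cell A B) (f : B ⟶ C) : (wr a f).tgt = a.tgt ≫ f := rfl

theorem cell_hom (a : Cell A B) : cell a.hom = a := rfl

theorem cell_inj {f g : A ⟶ B} {φ ψ : f ⟶ g} (h : cell φ = cell ψ) : φ = ψ := by
  simpa [cell] using h

theorem cell_congr {f g : A ⟶ B} {φ ψ : f ⟶ g} (h : φ = ψ) : cell φ = cell ψ := h ▸ rfl

theorem cell_tgt_eq_src {f g h : A ⟶ B} (φ : f ⟶ g) (ψ : g ⟶ h) : (cell φ).tgt = (cell ψ).src :=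
  rfl

@[simp] theorem cell_comp {f g h : A ⟶ B} (φ : f ⟶ g) (ψ : g ⟶ h) :
    cell (φ ≫ ψ) = (cell φ).comp (cell ψ) (cell_tgt_eq_src φ ψ) :=
  congrArg (fun t => cell (φ ≫ t)) (Category.id_comp ψ).symm

@[simp] theorem cell_id (f : A ⟶ B) : cell (𝟙 f) = one f := rfl

-- The reason for bundling source and target: transports along equalities of 1-morphisms, hence all
-- associators and unitors of a strict 2-category, disappear, and whiskering becomes strictly
-- associative and unital.
@[simp] theorem cell_eqToHom {f g : A ⟶ B} (h : f = g) : cell (eqToHom h) = one f := by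
  subst h; rfl

@[simp] theorem cell_whiskerLeft (f : A ⟶ B) {g h : B ⟶ C} (φ : g ⟶ h) :
    cell (f ◁ φ) = wl f (cell φ) := rfl

@[simp] theorem cell_whiskerRight {g h : A ⟶ B} (φ : g ⟶ h) (f : B ⟶ C) :
    cell (φ ▷ f) = wr (cell φ) f := rfl

namespace Cell

theorem exists_hom (a : Cell A B) {f g : A ⟶ B} (hf : a.src = f) (hg : a.tgt = g) :
    ∃ φ : f ⟶ g, cell φ = a := by
  subst hf hg; exact ⟨a.hom, rfl⟩

@[simp] theorem one_comp (f : A ⟶ B) (a : Cell A B) (h : (one f).tgt = a.src) :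
    (one f).comp a h = a := by
  obtain ⟨_, _, a⟩ := a
  cases h
  exact congrArg cell ((Category.id_comp _).trans (Category.id_comp _))

@[simp] theorem comp_one (f : A ⟶ B) (a : Cell A B) (h : a.tgt = (one f).src) :
    a.comp (one f) h = a := by
  obtain ⟨_, _, a⟩ := a
  cases h
  exact congrArg cell ((congrArg _ (Category.id_comp _)).trans (Category.comp_id _))

@[simp] theorem comp_assoc (a b c : Cell A B) (h : a.tgt = b.src) (h' : (a.comp b h).tgt = c.src) :
    (a.comp b h).comp c h' = a.comp (b.comp c ((comp_tgt a b h).symm.trans h')) (h.trans (comp_src b c _).symm) := by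
  simp [comp]

@[simp] theorem wl_one (f : A ⟶ B) (g : B ⟶ C) : wl f (one g) = one (f ≫ g) := by
  simp [wl, one]

@[simp] theorem wr_one (f : A ⟶ B) (g : B ⟶ C) : wr (one f) g = one (f ≫ g) := by
  simp [wr, one]

theorem wl_tgt_eq_src (f : A ⟶ B) {a b : Cell B C} (h : a.tgt = b.src) :
    (wl f a).tgt = (wl f b).src :=
  congrArg (f ≫ ·) h

theorem wr_tgt_eq_src {a b : Cell A B} (h : a.tgt = b.src) (f : B ⟶ C) :
    (wr a f).tgt = (wr b f).src :=
  congrArg (· ≫ f) h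

@[simp] theorem wl_comp (f : A ⟶ B) (a b : Cell B C) (h : a.tgt = b.src) :
    wl f (a.comp b h) = (wl f a).comp (wl f b) (wl_tgt_eq_src f h) := by
  obtain ⟨_, _, a⟩ := a
  obtain ⟨_, _, b⟩ := b
  cases h
  simp [wl, comp]

@[simp] theorem wr_comp (a b : Cell A B) (h : a.tgt = b.src) (f : B ⟶ C) :
    wr (a.comp b h) f = (wr a f).comp (wr b f) (wr_tgt_eq_src h f) := by
  obtain ⟨_, _, a⟩ := a
  obtain ⟨_, _, b⟩ := b
  cases h
  simp [wr, comp]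

theorem exchange (a : Cell A B) (b : Cell B C) :
    (wl a.src b).comp (wr a b.tgt) ((wl_tgt _ _).trans (wr_src _ _).symm) =
      (wr a b.src).comp (wl a.tgt b) ((wr_tgt _ _).trans (wl_src _ _).symm) := by
  simpa only [cell_comp, cell_whiskerLeft, cell_whiskerRight, cell_hom] using
    cell_congr (whisker_exchange a.hom b.hom)

/-- The analogue of `reassoc_of%` for cells: it applies an equation to the first two factors of a
right-nested composite. -/
theorem reassoc {a b c : Cell A B} {h : a.tgt = b.src} (e : a.comp b h = c) (d : Cell A B)
    (hd : b.tgt = d.src) :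
    a.comp (b.comp d hd) (h.trans (comp_src b d _).symm) = c.comp d (by rw [← e]; simpa using hd) := by
  subst e; simp

theorem comp_congr {a a' b b' : Cell A B} {h : a.tgt = b.src} (ha : a = a') (hb : b = b') :
    a.comp b h = a'.comp b' (by rw [← ha, ← hb, h]) := by
  subst ha hb; rfl

end Cell

variable [Strict K]

@[simp] theorem cell_associator_hom (f : A ⟶ B) (g : B ⟶ C) (h : C ⟶ D) :
    cell (α_ f g h).hom = one (f ≫ g ≫ h) := by
  rw [Strict.associator_eqToIso, eqToIso.hom, cell_eqToHom, Strict.assoc]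

@[simp] theorem cell_associator_inv (f : A ⟶ B) (g : B ⟶ C) (h : C ⟶ D) :
    cell (α_ f g h).inv = one (f ≫ g ≫ h) := by
  rw [Strict.associator_eqToIso, eqToIso.inv, cell_eqToHom]

@[simp] theorem cell_leftUnitor_hom (f : A ⟶ B) : cell (λ_ f).hom = one f := by
  rw [Strict.leftUnitor_eqToIso, eqToIso.hom, cell_eqToHom, Strict.id_comp]

@[simp] theorem cell_leftUnitor_inv (f : A ⟶ B) : cell (λ_ f).inv = one f := by
  rw [Strict.leftUnitor_eqToIso, eqToIso.inv, cell_eqToHom]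

@[simp] theorem cell_rightUnitor_hom (f : A ⟶ B) : cell (ρ_ f).hom = one f := by
  rw [Strict.rightUnitor_eqToIso, eqToIso.hom, cell_eqToHom, Strict.comp_id]

@[simp] theorem cell_rightUnitor_inv (f : A ⟶ B) : cell (ρ_ f).inv = one f := by
  rw [Strict.rightUnitor_eqToIso, eqToIso.inv, cell_eqToHom]

namespace Cell

@[simp] theorem wl_wl (f : A ⟶ B) (g : B ⟶ C) (a : Cell C D) :
    wl f (wl g a) = wl (f ≫ g) a := by
  have := cell_congr (comp_whiskerLeft f g a.hom)
  simp only [cell_comp, cell_associator_hom, cell_associator_inv, cell_whiskerLeft, cell_hom] at this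
  rw [this]
  rw [one_comp, comp_one]

@[simp] theorem wr_wr (a : Cell A B) (f : B ⟶ C) (g : C ⟶ D) :
    wr (wr a f) g = wr a (f ≫ g) := by
  have := cell_congr (whiskerRight_comp a.hom f g)
  simp only [cell_comp, cell_associator_hom, cell_associator_inv, cell_whiskerRight,
    cell_hom] at this
  rw [this]
  rw [one_comp, comp_one]

@[simp] theorem wr_wl (f : A ⟶ B) (a : Cell B C) (g : C ⟶ D) :
    wr (wl f a) g = wl f (wr a g) := by
  have := cell_congr (whisker_assoc f a.hom g)
  simp only [cell_comp, cell_associator_hom, cell_associator_inv, cell_whiskerRight,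
    cell_whiskerLeft, cell_hom] at this
  rw [this]
  rw [one_comp, comp_one]

@[simp] theorem wl_id (a : Cell A B) : wl (𝟙 A) a = a := by
  have := cell_congr (id_whiskerLeft a.hom)
  simp only [cell_comp, cell_leftUnitor_hom, cell_leftUnitor_inv, cell_whiskerLeft, cell_hom] at this
  rw [this]
  rw [one_comp, comp_one]

@[simp] theorem wr_id (a : Cell A B) : wr a (𝟙 B) = a := by
  have := cell_congr (whiskerRight_id a.hom)
  simp only [cell_comp, cell_rightUnitor_hom, cell_rightUnitor_inv, cell_whiskerRight,
    cell_hom] at this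
  rw [this]
  rw [one_comp, comp_one]

end Cell

end Cell

end Tangentads

namespace Tangentads

/-! ### Additive bundles, elementwise -/

section Category

variable {C : Type u} [Category.{v} C]

/-- The generalised element `c` of `E` is the sum of `a` and `b`. -/
def IsAdd {E E₂ Y : C} (π : Fin 2 → (E₂ ⟶ E)) (s : E₂ ⟶ E) (a b c : Y ⟶ E) : Prop :=
  ∃ h : Y ⟶ E₂, IsPair π h a b ∧ h ≫ s = c

/-- Additivity of `g` is a statement about the generic pair of elements of `E`, the two projections.
This rephrases the last field of `IsAdditiveBundleHom` in terms of sums. -/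
theorem isAdd_iff_exists {E E₂ E' E₂' : C} {π : Fin 2 → (E₂ ⟶ E)} {s : E₂ ⟶ E}
    {π' : Fin 2 → (E₂' ⟶ E')} {s' : E₂' ⟶ E'} {g : E ⟶ E'} :
    IsAdd π' s' (π 0 ≫ g) (π 1 ≫ g) (s ≫ g) ↔
      ∃ g₂ : E₂ ⟶ E₂', (∀ i, g₂ ≫ π' i = π i ≫ g) ∧ g₂ ≫ s' = s ≫ g := by
  simp only [IsAdd, IsPair, Fin.forall_fin_two]

namespace IsNFoldPullback

variable {E B P Y : C} {q : E ⟶ B} {n : ℕ} {π : Fin n → (P ⟶ E)} (hP : IsNFoldPullback q π)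
include hP

theorem hom_ext {a b : Y ⟶ P} (h : ∀ i, a ≫ π i = b ≫ π i) : a = b :=
  (hP.existsUnique_lift (fun i => b ≫ π i)
    (fun i j => by simp only [Category.assoc, hP.comm i j])).unique h fun _ => rfl

theorem exists_lift (f : Fin n → (Y ⟶ E)) (h : ∀ i j, f i ≫ q = f j ≫ q) :
    ∃ a : Y ⟶ P, ∀ i, a ≫ π i = f i :=
  (hP.existsUnique_lift f h).exists

end IsNFoldPullback

namespace IsNFoldPullback

variable {E B P Y : C} {q : E ⟶ B} {π : Fin 2 → (P ⟶ E)} (hP : IsNFoldPullback q π)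
include hP

theorem isPair_unique {h h' : Y ⟶ P} {a b : Y ⟶ E} (e : IsPair π h a b) (e' : IsPair π h' a b) :
    h = h' := by
  apply hP.hom_ext
  intro i
  fin_cases i
  · exact e.1.trans e'.1.symm
  · exact e.2.trans e'.2.symm

theorem exists_isPair {a b : Y ⟶ E} (h : a ≫ q = b ≫ q) : ∃ t : Y ⟶ P, IsPair π t a b := by
  obtain ⟨t, ht⟩ := hP.exists_lift ![a, b] (by
    intro i j; fin_cases i <;> fin_cases j <;> simp [h])
  exact ⟨t, ht 0, ht 1⟩

theorem isPair_proj {t : Y ⟶ P} {a b : Y ⟶ E} (h : IsPair π t a b) : a ≫ q = b ≫ q := by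
  rw [← h.1, ← h.2, Category.assoc, Category.assoc, hP.comm 0 1]

theorem isAdd_unique {s : P ⟶ E} {a b c d : Y ⟶ E} (h : IsAdd π s a b c) (h' : IsAdd π s a b d) :
    c = d := by
  obtain ⟨t, ht, rfl⟩ := h
  obtain ⟨t', ht', rfl⟩ := h'
  rw [hP.isPair_unique ht ht']

end IsNFoldPullback

section

variable {E B : C} {q : E ⟶ B} {En : ℕ → C} {π : ∀ n, Fin n → (En n ⟶ E)} {z : B ⟶ E}
  {s : En 2 ⟶ E}

/-- The triple `(a, b, c)` factors through the threefold pullback, and uniqueness of pairings makes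
the given sums the restrictions of the universal ones. -/
theorem IsAdditiveBundle.isAdd_assoc (H : IsAdditiveBundle q π z s) {Y : C}
    {a b c ab bc x y : Y ⟶ E} (hab : IsAdd (π 2) s a b ab) (hbc : IsAdd (π 2) s b c bc)
    (hx : IsAdd (π 2) s ab c x) (hy : IsAdd (π 2) s a bc y) : x = y := by
  have h2 := H.isNFoldPullback 2 two_pos
  obtain ⟨a₁₂, a₂₃, l, r, p₁₂, p₂₃, pl, pr, e⟩ := H.assoc
  obtain ⟨tab, pab, rfl⟩ := hab
  obtain ⟨tbc, pbc, rfl⟩ := hbc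
  obtain ⟨tx, px, rfl⟩ := hx
  obtain ⟨ty, py, rfl⟩ := hy
  have eab := h2.isPair_proj pab
  have ebc := h2.isPair_proj pbc
  obtain ⟨t, ht⟩ := (H.isNFoldPullback 3 three_pos).exists_lift ![a, b, c] (by
    intro i j; fin_cases i <;> fin_cases j <;> simp [eab, ebc])
  have h0 : t ≫ π 3 0 = a := ht 0
  have h1 : t ≫ π 3 1 = b := ht 1
  have h3 : t ≫ π 3 2 = c := ht 2
  obtain rfl : t ≫ a₁₂ = tab := h2.isPair_unique ⟨by simp [p₁₂.1, h0], by simp [p₁₂.2, h1]⟩ pab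
  obtain rfl : t ≫ a₂₃ = tbc := h2.isPair_unique ⟨by simp [p₂₃.1, h1], by simp [p₂₃.2, h3]⟩ pbc
  obtain rfl : t ≫ l = tx := h2.isPair_unique ⟨by simp [pl.1], by simp [pl.2, h3]⟩ px
  obtain rfl : t ≫ r = ty := h2.isPair_unique ⟨by simp [pr.1, h0], by simp [pr.2]⟩ py
  simp [e]

theorem IsAdditiveBundle.isAdd_unit (H : IsAdditiveBundle q π z s) {Y : C} {a c : Y ⟶ E}
    (h : IsAdd (π 2) s (a ≫ q ≫ z) a c) : c = a := by
  obtain ⟨t, p, e⟩ := H.unit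
  refine (H.isNFoldPullback 2 two_pos).isAdd_unique h ⟨a ≫ t, ⟨?_, ?_⟩, ?_⟩
  · simp [p.1]
  · simp [p.2]
  · simp [e]

theorem IsAdditiveBundle.isAdd_comm (H : IsAdditiveBundle q π z s) {Y : C} {a b c : Y ⟶ E}
    (h : IsAdd (π 2) s a b c) : IsAdd (π 2) s b a c := by
  obtain ⟨t, p, e⟩ := H.symm
  obtain ⟨u, p', rfl⟩ := h
  refine ⟨u ≫ t, ⟨?_, ?_⟩, ?_⟩
  · simp [p.1, p'.2]
  · simp [p.2, p'.1]
  · simp [e]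

/-- By Yoneda it is enough to know the laws for generalised elements; the universal elements then
give the axioms. Additive bundles are transferred along this criterion, without naming the pairing
morphisms. -/
theorem IsAdditiveBundle.of_isAdd (h : ∀ n, 0 < n → IsNFoldPullback q (π n)) (hz : z ≫ q = 𝟙 B)
    (hs : s ≫ q = π 2 0 ≫ q)
    (hassoc : ∀ {Y : C} {a b c ab bc x y : Y ⟶ E}, IsAdd (π 2) s a b ab → IsAdd (π 2) s b c bc →
      IsAdd (π 2) s ab c x → IsAdd (π 2) s a bc y → x = y)
    (hunit : ∀ {Y : C} {a c : Y ⟶ E}, IsAdd (π 2) s (a ≫ q ≫ z) a c → c = a)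
    (hcomm : ∀ {Y : C} {a b c d : Y ⟶ E}, IsAdd (π 2) s a b c → IsAdd (π 2) s b a d → c = d) :
    IsAdditiveBundle q π z s where
  isNFoldPullback := h
  zero_proj := hz
  sum_proj := hs
  assoc := by
    have h2 := h 2 two_pos
    have h3 := h 3 three_pos
    obtain ⟨a₁₂, p₁₂⟩ := h2.exists_isPair (h3.comm 0 1)
    obtain ⟨a₂₃, p₂₃⟩ := h2.exists_isPair (h3.comm 1 2)
    obtain ⟨l, pl⟩ := h2.exists_isPair (a := a₁₂ ≫ s) (b := π 3 2)
      (by rw [Category.assoc, hs, ← Category.assoc, p₁₂.1, h3.comm])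
    obtain ⟨r, pr⟩ := h2.exists_isPair (a := π 3 0) (b := a₂₃ ≫ s)
      (by rw [Category.assoc, hs, ← Category.assoc, p₂₃.1, h3.comm])
    exact ⟨a₁₂, a₂₃, l, r, p₁₂, p₂₃, pl, pr,
      hassoc ⟨_, p₁₂, rfl⟩ ⟨_, p₂₃, rfl⟩ ⟨_, pl, rfl⟩ ⟨_, pr, rfl⟩⟩
  unit := by
    obtain ⟨t, p⟩ := (h 2 two_pos).exists_isPair (a := q ≫ z) (b := 𝟙 E) (by simp [hz])
    exact ⟨t, p, hunit ⟨_, by simpa using p, rfl⟩⟩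
  symm := by
    have h2 := h 2 two_pos
    obtain ⟨t, p⟩ := h2.exists_isPair (h2.comm 1 0)
    exact ⟨t, p, hcomm ⟨_, p, rfl⟩ ⟨𝟙 _, ⟨by simp, by simp⟩, by simp⟩⟩

theorem IsPair.map {D : Type*} [Category D] (Φ : C ⥤ D) {E E₂ Y : C} {π : Fin 2 → (E₂ ⟶ E)}
    {h : Y ⟶ E₂} {a b : Y ⟶ E} (H : IsPair π h a b) :
    IsPair (fun i => Φ.map (π i)) (Φ.map h) (Φ.map a) (Φ.map b) := by
  obtain ⟨rfl, rfl⟩ := H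
  exact ⟨(Φ.map_comp _ _).symm, (Φ.map_comp _ _).symm⟩

theorem IsAdditiveBundle.map {D : Type*} [Category D] (Φ : C ⥤ D) (H : IsAdditiveBundle q π z s)
    (h : ∀ n, 0 < n → IsNFoldPullback (Φ.map q) (fun i => Φ.map (π n i))) :
    IsAdditiveBundle (Φ.map q) (En := fun n => Φ.obj (En n)) (fun n i => Φ.map (π n i)) (Φ.map z)
      (Φ.map s) where
  isNFoldPullback := h
  zero_proj := by rw [← Φ.map_comp, H.zero_proj, Φ.map_id]
  sum_proj := by rw [← Φ.map_comp, H.sum_proj, Φ.map_comp]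
  assoc := by
    obtain ⟨a₁₂, a₂₃, l, r, p₁₂, p₂₃, pl, pr, e⟩ := H.assoc
    exact ⟨Φ.map a₁₂, Φ.map a₂₃, Φ.map l, Φ.map r, p₁₂.map Φ, p₂₃.map Φ,
      by simpa using pl.map Φ, by simpa using pr.map Φ, by rw [← Φ.map_comp, e, Φ.map_comp]⟩
  unit := by
    obtain ⟨t, p, e⟩ := H.unit
    exact ⟨Φ.map t, by simpa using p.map Φ, by rw [← Φ.map_comp, e, Φ.map_id]⟩
  symm := by
    obtain ⟨t, p, e⟩ := H.symm
    exact ⟨Φ.map t, p.map Φ, by rw [← Φ.map_comp, e]⟩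

end

end Category

/-! ### Pullbacks in Hom-categories in terms of cells -/

namespace Cell

variable {K : Type u} [Bicategory.{w, v} K] {X Y : K}

/-- The cells `π i` have a common source and are jointly monic. -/
def JointMono {n : ℕ} (π : Fin n → Cell Y X) : Prop :=
  ∀ (h h' : Cell Y X) (e : ∀ i, h.tgt = (π i).src) (e' : ∀ i, h'.tgt = (π i).src),
    (∀ i, h.comp (π i) (e i) = h'.comp (π i) (e' i)) → h = h'

/-- The cells `π i` form an `n`-fold pullback of `q` along itself in a Hom-category. -/
structure IsPb {n : ℕ} (q : Cell Y X) (π : Fin n → Cell Y X) : Prop where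
  src_eq : ∀ i j, (π i).src = (π j).src
  tgt_eq : ∀ i, (π i).tgt = q.src
  comm : ∀ i j, (π i).comp q (tgt_eq i) = (π j).comp q (tgt_eq j)
  jointMono : JointMono π
  exists_lift : ∀ (c : Fin n → Cell Y X) (hc : ∀ i, (c i).tgt = q.src),
    (∀ i j, (c i).comp q (hc i) = (c j).comp q (hc j)) →
    ∃ (h : Cell Y X) (e : ∀ i, h.tgt = (π i).src), ∀ i, h.comp (π i) (e i) = c i

/-- A pullback square in a Hom-category. -/
structure IsPull (fst snd f g : Cell Y X) : Prop where
  src_eq : fst.src = snd.src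
  fst_tgt : fst.tgt = f.src
  snd_tgt : snd.tgt = g.src
  comm : fst.comp f fst_tgt = snd.comp g snd_tgt
  hom_ext : ∀ (h h' : Cell Y X) (e : h.tgt = fst.src) (e' : h'.tgt = fst.src),
    h.comp fst e = h'.comp fst e' → h.comp snd (e.trans src_eq) = h'.comp snd (e'.trans src_eq) →
    h = h'
  exists_lift : ∀ (a b : Cell Y X) (ha : a.tgt = f.src) (hb : b.tgt = g.src),
    a.comp f ha = b.comp g hb →
    ∃ (h : Cell Y X) (e : h.tgt = fst.src),
      h.comp fst e = a ∧ h.comp snd (e.trans src_eq) = b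

theorem src_eq_of_eq {a b : Cell Y X} (h : a = b) : a.src = b.src := h ▸ rfl

theorem tgt_eq_of_eq {a b : Cell Y X} (h : a = b) : a.tgt = b.tgt := h ▸ rfl

/-- Cells do not fix their endpoints in advance. Positivity of `n` supplies a leg from which the
source and target of a lift can be read off. -/
theorem isPb_iff {n : ℕ} (hn : 0 < n) {E B P : Y ⟶ X} (q : E ⟶ B) (π : Fin n → (P ⟶ E)) :
    IsPb (cell q) (fun i => cell (π i)) ↔ IsNFoldPullback q π := by
  constructor
  · intro H
    refine ⟨fun i j => cell_inj (by simpa using H.comm i j), fun {A} f hf => ?_⟩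
    obtain ⟨h, e, he⟩ := H.exists_lift (fun i => cell (f i)) (fun i => rfl)
      (fun i j => by simpa using cell_congr (hf i j))
    obtain ⟨h, rfl⟩ := h.exists_hom (f := A) (g := P)
      (by simpa using src_eq_of_eq (he ⟨0, hn⟩)) (e ⟨0, hn⟩)
    refine ⟨h, fun i => cell_inj (by simpa using he i), fun h' hh' => cell_inj ?_⟩
    refine H.jointMono _ _ (fun i => rfl) (fun i => rfl) fun i => ?_
    rw [he i, ← hh' i, cell_comp]
  · intro H
    refine ⟨fun i j => rfl, fun i => rfl, fun i j => ?_, ?_, ?_⟩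
    · simpa using cell_congr (H.comm i j)
    · intro h h' e e' hh
      have hs := src_eq_of_eq (hh ⟨0, hn⟩)
      obtain ⟨A, _, h⟩ := h
      obtain ⟨A', _, h'⟩ := h'
      cases e ⟨0, hn⟩
      cases e' ⟨0, hn⟩
      obtain rfl : A = A' := hs
      refine cell_congr (H.hom_ext fun i => cell_inj ?_)
      rw [cell_comp, cell_comp]
      exact hh i
    · intro c hc hcc
      have hA : ∀ i, (c i).src = (c ⟨0, hn⟩).src := fun i => by
        simpa using src_eq_of_eq (hcc i ⟨0, hn⟩)
      have : ∀ i, ∃ f : (c ⟨0, hn⟩).src ⟶ E, cell f = c i := fun i =>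
        (c i).exists_hom (hA i) (hc i)
      choose f hf using this
      obtain ⟨h, hh⟩ := H.exists_lift f fun i j => cell_inj (by simpa [hf] using hcc i j)
      exact ⟨cell h, fun i => rfl, fun i => by simpa [hf] using cell_congr (hh i)⟩

theorem isPull_iff {A B C D : Y ⟶ X} (fst : A ⟶ B) (snd : A ⟶ C) (f : B ⟶ D) (g : C ⟶ D) :
    IsPull (cell fst) (cell snd) (cell f) (cell g) ↔ IsPullback fst snd f g := by
  constructor
  · intro H
    refine ⟨⟨cell_inj (by simpa using H.comm)⟩, ⟨Limits.PullbackCone.IsLimit.mk _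
      (fun c => (H.exists_lift (cell c.fst) (cell c.snd) rfl rfl
        (by simpa using cell_congr c.condition)).choose.exists_hom (f := c.pt) (g := A)
        ?_ ?_ |>.choose) ?_ ?_ ?_⟩⟩
    · have h := (H.exists_lift (cell c.fst) (cell c.snd) rfl rfl
        (by simpa using cell_congr c.condition)).choose_spec
      simpa using src_eq_of_eq h.choose_spec.1
    · exact (H.exists_lift (cell c.fst) (cell c.snd) rfl rfl
        (by simpa using cell_congr c.condition)).choose_spec.choose
    · intro c
      have h := (H.exists_lift (cell c.fst) (cell c.snd) rfl rfl
        (by simpa using cell_congr c.condition)).choose_spec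
      generalize_proofs p1 p2 p3
      have h3 := p3.choose_spec
      apply cell_inj
      rw [cell_comp]
      exact (comp_congr h3 rfl).trans h.choose_spec.1
    · intro c
      have h := (H.exists_lift (cell c.fst) (cell c.snd) rfl rfl
        (by simpa using cell_congr c.condition)).choose_spec
      generalize_proofs p1 p2 p3
      have h3 := p3.choose_spec
      apply cell_inj
      rw [cell_comp]
      exact (comp_congr h3 rfl).trans h.choose_spec.2
    · intro c m h1 h2
      apply cell_inj
      have h := (H.exists_lift (cell c.fst) (cell c.snd) rfl rfl
        (by simpa using cell_congr c.condition)).choose_spec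
      generalize_proofs p1 p2 p3
      have h3 := p3.choose_spec
      refine H.hom_ext _ _ rfl rfl ?_ ?_
      · rw [← cell_comp, h1]
        exact ((comp_congr h3 rfl).trans h.choose_spec.1).symm
      · rw [← cell_comp, h2]
        exact ((comp_congr h3 rfl).trans h.choose_spec.2).symm
  · intro H
    refine ⟨rfl, rfl, rfl, by simpa using cell_congr H.w, ?_, ?_⟩
    · intro h h' e e' h1 h2
      have hs := src_eq_of_eq h1
      obtain ⟨A, _, h⟩ := h
      obtain ⟨A', _, h'⟩ := h'
      cases e
      cases e'
      obtain rfl : A = A' := hs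
      refine cell_congr (H.hom_ext (cell_inj ?_) (cell_inj ?_))
      · rw [cell_comp, cell_comp]
        exact h1
      · rw [cell_comp, cell_comp]
        exact h2
    · intro a b ha hb hab
      have hs : a.src = b.src := by simpa using src_eq_of_eq hab
      obtain ⟨A, _, a⟩ := a
      obtain ⟨A', _, b⟩ := b
      cases ha
      cases hb
      obtain rfl : A = A' := hs
      have hab' : a ≫ f = b ≫ g := cell_inj (by rw [cell_comp, cell_comp]; exact hab)
      refine ⟨cell (H.lift a b hab'), rfl, ?_, ?_⟩
      · rw [← cell_comp, H.lift_fst]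
        rfl
      · rw [← cell_comp, H.lift_snd]
        rfl

end Cell

end Tangentads

namespace Tangentads

variable {K : Type u} [Bicategory.{w, v} K] [Strict K] {X Y Z W : K}

open Cell

/-! ### Strict 2-pullbacks in terms of cells -/

namespace IsNFoldTwoPullback

variable {E B P : K} {q : E ⟶ B} {n : ℕ} {π : Fin n → (P ⟶ E)} (hP : IsNFoldTwoPullback q π)
include hP

theorem ext {a b : Y ⟶ P} (h : ∀ i, a ≫ π i = b ≫ π i) : a = b :=
  (hP.existsUnique_lift (fun i => b ≫ π i)
    (fun i j => by simp only [Strict.assoc, hP.comm i j])).unique h fun _ => rfl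

theorem exists_lift (f : Fin n → (Y ⟶ E)) (h : ∀ i j, f i ≫ q = f j ≫ q) :
    ∃ a : Y ⟶ P, ∀ i, a ≫ π i = f i :=
  (hP.existsUnique_lift f h).exists

/-- Both dimensions of the universal property at once: the first identifies the endpoints, the
second the 2-morphisms between them. -/
theorem cell_ext {a b : Cell Y P} (h : ∀ i, a.wr (π i) = b.wr (π i)) : a = b := by
  have hs : a.src = b.src := hP.ext fun i => src_eq_of_eq (h i)
  have ht : a.tgt = b.tgt := hP.ext fun i => tgt_eq_of_eq (h i)
  obtain ⟨f, g, a⟩ := a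
  obtain ⟨f', g', b⟩ := b
  obtain rfl : f = f' := hs
  obtain rfl : g = g' := ht
  refine cell_congr ((hP.existsUnique_lift₂ f g (fun i => b ▷ π i) fun i j => cell_inj ?_).unique
    (fun i => cell_inj (h i)) fun i => rfl)
  simp [hP.comm i j]

theorem exists_cell_lift (c : Fin n → Cell Y E) (h : ∀ i j, (c i).wr q = (c j).wr q) :
    ∃ C : Cell Y P, ∀ i, C.wr (π i) = c i := by
  obtain ⟨f, hf⟩ := hP.exists_lift (fun i => (c i).src) fun i j => src_eq_of_eq (h i j)
  obtain ⟨g, hg⟩ := hP.exists_lift (fun i => (c i).tgt) fun i j => tgt_eq_of_eq (h i j)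
  have : ∀ i, ∃ θ : f ≫ π i ⟶ g ≫ π i, cell θ = c i := fun i =>
    (c i).exists_hom (hf i).symm (hg i).symm
  choose θ hθ using this
  obtain ⟨Θ, hΘ, -⟩ := hP.existsUnique_lift₂ f g θ fun i j => cell_inj (by
    simp [hθ, h i j])
  exact ⟨cell Θ, fun i => by rw [← cell_whiskerRight, hΘ, hθ]⟩

/-- Pullbacks in Hom-categories of a 2-pullback are created by the projections. -/
theorem isPb {m : ℕ} {c : Cell Y P} {ρ : Fin m → Cell Y P}
    (h : ∀ j, IsPb (c.wr (π j)) (fun i => (ρ i).wr (π j)))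
    (hm : ∀ j, JointMono (fun i => (ρ i).wr (π j ≫ q))) : IsPb c ρ where
  src_eq i i' := hP.ext fun j => (h j).src_eq i i'
  tgt_eq i := hP.ext fun j => (h j).tgt_eq i
  comm i i' := hP.cell_ext fun j => by simpa using (h j).comm i i'
  jointMono a b e e' hab := hP.cell_ext fun j =>
    (h j).jointMono _ _ (fun i => congrArg (· ≫ π j) (e i)) (fun i => congrArg (· ≫ π j) (e' i))
      fun i => by simpa using congrArg (wr · (π j)) (hab i)
  exists_lift a ha haa := by
    have := fun j => (h j).exists_lift (fun i => (a i).wr (π j))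
      (fun i => congrArg (· ≫ π j) (ha i)) (fun i i' => by
        simpa using congrArg (wr · (π j)) (haa i i'))
    choose t e ht using this
    -- The lifts found on the separate components glue only if they agree after `q`; there they have
    -- the same composites with a jointly monic family.
    obtain ⟨T, hT⟩ := hP.exists_cell_lift t fun j j' => by
      refine hm j _ _ (fun i => ?_) (fun i => ?_) fun i => ?_
      · simp [e j i]
      · simp [e j' i, hP.comm j j']
      · have h1 := congrArg (wr · q) (ht j i)
        have h2 := congrArg (wr · q) (ht j' i)
        simp [hP.comm j' j] at h1 h2
        rw [h1, h2]
    refine ⟨T, fun i => hP.ext fun j => ?_, fun i => hP.cell_ext fun j => ?_⟩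
    · exact (congrArg tgt (hT j)).trans (e j i)
    · rw [← ht j i]
      simp [hT]

/-- Pullback squares in Hom-categories of a 2-pullback are created by the projections. -/
theorem isPull {fst snd f g : Cell Y P}
    (h : ∀ j, IsPull (fst.wr (π j)) (snd.wr (π j)) (f.wr (π j)) (g.wr (π j)))
    (hm : ∀ j, IsPull (fst.wr (π j ≫ q)) (snd.wr (π j ≫ q)) (f.wr (π j ≫ q)) (g.wr (π j ≫ q))) :
    IsPull fst snd f g where
  src_eq := hP.ext fun j => (h j).src_eq
  fst_tgt := hP.ext fun j => (h j).fst_tgt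
  snd_tgt := hP.ext fun j => (h j).snd_tgt
  comm := hP.cell_ext fun j => by simpa using (h j).comm
  hom_ext a b e e' h1 h2 := hP.cell_ext fun j =>
    (h j).hom_ext _ _ (congrArg (· ≫ π j) e) (congrArg (· ≫ π j) e')
      (by simpa using congrArg (wr · (π j)) h1) (by simpa using congrArg (wr · (π j)) h2)
  exists_lift a b ha hb hab := by
    have := fun j => (h j).exists_lift (a.wr (π j)) (b.wr (π j))
      (congrArg (· ≫ π j) ha) (congrArg (· ≫ π j) hb)
      (by simpa using congrArg (wr · (π j)) hab)
    choose t e h1 h2 using this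
    obtain ⟨T, hT⟩ := hP.exists_cell_lift t fun j j' => by
      refine (hm j).hom_ext _ _ ?_ ?_ ?_ ?_
      · simp [e j]
      · simp [e j', hP.comm j j']
      · have e1 := congrArg (wr · q) (h1 j)
        have e2 := congrArg (wr · q) (h1 j')
        simp [hP.comm j' j] at e1 e2
        rw [e1, e2]
      · have e1 := congrArg (wr · q) (h2 j)
        have e2 := congrArg (wr · q) (h2 j')
        simp [hP.comm j' j] at e1 e2
        rw [e1, e2]
    refine ⟨T, hP.ext fun j => (congrArg tgt (hT j)).trans (e j), hP.cell_ext fun j => ?_,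
      hP.cell_ext fun j => ?_⟩
    · rw [← h1 j]
      simp [hT]
    · rw [← h2 j]
      simp [hT]

end IsNFoldTwoPullback

/-! ### Tangent structures in terms of cells -/

/-- Left whiskering as a functor. -/
def whiskerFunctor (F : Y ⟶ X) (W : K) : (X ⟶ W) ⥤ (Y ⟶ W) where
  obj g := F ≫ g
  map φ := F ◁ φ

theorem iter_one (T : X ⟶ X) : iter T 1 = T := Strict.id_comp T

theorem iter_two (T : X ⟶ X) : iter T 2 = T ≫ T := congrArg (· ≫ T) (iter_one T)

theorem iter_comp {T : X ⟶ X} {T' : Y ⟶ Y} {F : X ⟶ Y} (h : T ≫ F = F ≫ T') (k : ℕ) :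
    iter T k ≫ F = F ≫ iter T' k := by
  induction k with
  | zero => exact (Strict.id_comp F).trans (Strict.comp_id F).symm
  | succ k ih =>
    change (iter T k ≫ T) ≫ F = F ≫ iter T' k ≫ T'
    rw [Strict.assoc, h, ← Strict.assoc, ih, Strict.assoc]

/-- `simp` merges successive whiskerings, so a preservation law for `F` must also be available when
`F` is the first factor of a longer 1-morphism. -/
theorem Cell.wr_comp_of_eq {P Q : K} {F : P ⟶ Q} {c : Cell P P} {d : Cell Q Q}
    (h : c.wr F = d.wl F) (k : Q ⟶ W) : c.wr (F ≫ k) = wl F (d.wr k) := by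
  rw [← wr_wr, h, wr_wl]

namespace TangentStructure

variable (S : TangentStructure X)

theorem isPb {n : ℕ} (hn : 0 < n) (F : Y ⟶ X) (k : ℕ) :
    IsPb (wl F (wr (cell S.p) (iter S.T k)))
      (fun i => wl F (wr (cell (S.proj n i)) (iter S.T k))) := by
  simpa using (isPb_iff hn _ _).2 (S.isNFoldPullback n hn F k)

/-- The cell `c` is the sum of the cells `a` and `b` with values in `F ≫ T ≫ g`. -/
def AddCell (F : Y ⟶ X) (g : X ⟶ W) (a b c : Cell Y W) : Prop :=
  ∃ (A : Y ⟶ W) (h : A ⟶ F ≫ S.Tn 2 ≫ g), cell (h ≫ F ◁ (S.proj 2 0 ▷ g)) = a ∧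
    cell (h ≫ F ◁ (S.proj 2 1 ▷ g)) = b ∧ cell (h ≫ F ◁ (S.s ▷ g)) = c

variable {S}

/-- The structure maps are matched only as cells, so the criterion applies to every bracketing of
the whiskered bundle, and also when `F` or `g` is an identity that has been dropped. -/
theorem addCell_iff_isAdd {F : Y ⟶ X} {g : X ⟶ W} {A E E₂ : Y ⟶ W} {π : Fin 2 → (E₂ ⟶ E)}
    {s : E₂ ⟶ E} (hπ : ∀ i, cell (π i) = wl F (wr (cell (S.proj 2 i)) g))
    (hs : cell s = wl F (wr (cell S.s) g)) (a b c : A ⟶ E) :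
    S.AddCell F g (cell a) (cell b) (cell c) ↔ IsAdd π s a b c := by
  obtain rfl : E₂ = F ≫ S.Tn 2 ≫ g := src_eq_of_eq hs
  obtain rfl : E = F ≫ S.T ≫ g := tgt_eq_of_eq hs
  have hπ' : ∀ i, π i = F ◁ (S.proj 2 i ▷ g) := fun i => cell_inj (hπ i)
  obtain rfl : s = F ◁ (S.s ▷ g) := cell_inj hs
  constructor
  · rintro ⟨A', h, h0, h1, h2⟩
    obtain rfl : A' = A := src_eq_of_eq h0
    exact ⟨h, ⟨by rw [hπ', cell_inj h0], by rw [hπ', cell_inj h1]⟩, cell_inj h2⟩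
  · rintro ⟨h, ⟨h0, h1⟩, h2⟩
    exact ⟨A, h, by rw [← hπ', h0], by rw [← hπ', h1], by rw [h2]⟩

theorem addCell_iff {F : Y ⟶ X} {g : X ⟶ W} {A : Y ⟶ W} {a b c : A ⟶ F ≫ S.T ≫ g} :
    S.AddCell F g (cell a) (cell b) (cell c) ↔
      IsAdd (fun i => F ◁ (S.proj 2 i ▷ g)) (F ◁ (S.s ▷ g)) a b c :=
  addCell_iff_isAdd (by simp) (by simp) a b c

theorem addCell_id_iff {F : Y ⟶ X} {A : Y ⟶ X} {a b c : A ⟶ F ≫ S.T} :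
    S.AddCell F (𝟙 X) (cell a) (cell b) (cell c) ↔
      IsAdd (fun i => F ◁ S.proj 2 i) (F ◁ S.s) a b c :=
  addCell_iff_isAdd (by simp) (by simp) a b c

theorem AddCell.eq_cells {F : Y ⟶ X} {g : X ⟶ W} {a b c : Cell Y W} (H : S.AddCell F g a b c) :
    ∃ (A : Y ⟶ W) (a' b' c' : A ⟶ F ≫ S.T ≫ g), cell a' = a ∧ cell b' = b ∧ cell c' = c := by
  obtain ⟨A, h, rfl, rfl, rfl⟩ := H
  exact ⟨_, _, _, _, rfl, rfl, rfl⟩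

theorem AddCell.wl {F : Y ⟶ X} {g : X ⟶ W} {a b c : Cell Y W} (H : S.AddCell F g a b c)
    (f : Z ⟶ Y) : S.AddCell (f ≫ F) g (wl f a) (wl f b) (wl f c) := by
  obtain ⟨A, h, rfl, rfl, rfl⟩ := H
  obtain ⟨h', e⟩ := (Cell.wl f (cell h)).exists_hom (f := f ≫ A) (g := (f ≫ F) ≫ S.Tn 2 ≫ g) rfl
    (by simp)
  exact ⟨_, h', by simp [e], by simp [e], by simp [e]⟩

theorem isNFoldPullback_of_iter {n : ℕ} (hn : 0 < n) (F : Y ⟶ X) {g : X ⟶ X} {k : ℕ}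
    (hg : g = iter S.T k) :
    IsNFoldPullback (F ◁ (S.p ▷ g)) (fun i => F ◁ (S.proj n i ▷ g)) :=
  hg ▸ S.isNFoldPullback n hn F k

/-- The fibre powers are only assumed to be preserved by iterates of `T`, which is why `g` is
restricted to these. -/
theorem AddCell.unique {F : Y ⟶ X} {g : X ⟶ X} {k : ℕ} (hg : g = iter S.T k) {a b c d : Cell Y X}
    (H : S.AddCell F g a b c) (H' : S.AddCell F g a b d) : c = d := by
  obtain ⟨A, a', b', c', rfl, rfl, rfl⟩ := H.eq_cells
  obtain ⟨A', _, _, d', h, -, rfl⟩ := H'.eq_cells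
  obtain rfl : A' = A := src_eq_of_eq h
  rw [addCell_iff] at H H'
  rw [(isNFoldPullback_of_iter two_pos F hg).isAdd_unique H H']

theorem exists_addCell {F : Y ⟶ X} {g : X ⟶ X} {k : ℕ} (hg : g = iter S.T k) {a b : Cell Y X}
    (ha : a.tgt = (Cell.wl F (Cell.wr (cell S.p) g)).src)
    (hb : b.tgt = (Cell.wl F (Cell.wr (cell S.p) g)).src)
    (h : a.comp (Cell.wl F (Cell.wr (cell S.p) g)) ha =
      b.comp (Cell.wl F (Cell.wr (cell S.p) g)) hb) :
    ∃ c, S.AddCell F g a b c := by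
  obtain ⟨A, hA⟩ : ∃ A, a.src = A := ⟨_, rfl⟩
  obtain ⟨b, rfl⟩ := b.exists_hom (g := F ≫ S.T ≫ g) ((src_eq_of_eq h).symm.trans hA) hb
  obtain ⟨a, rfl⟩ := a.exists_hom (g := F ≫ S.T ≫ g) hA ha
  obtain ⟨t, h0, h1⟩ := (isNFoldPullback_of_iter (S := S) two_pos F hg).exists_isPair (a := a)
    (b := b) (cell_inj (by simpa only [cell_comp, cell_whiskerLeft, cell_whiskerRight] using h))
  exact ⟨_, _, t, by rw [h0], by rw [h1], rfl⟩

theorem additive_whisker (S : TangentStructure X) (F : Y ⟶ X) :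
    IsAdditiveBundle (F ◁ S.p) (En := fun n => F ≫ S.Tn n) (fun n i => F ◁ S.proj n i) (F ◁ S.z)
      (F ◁ S.s) :=
  S.additive.map (whiskerFunctor F X) fun n hn => (isPb_iff hn _ _).1 (by
    simpa [whiskerFunctor, iter] using S.isPb hn F 0)

theorem AddCell.eq_cells_id {F : Y ⟶ X} {a b c : Cell Y X} (H : S.AddCell F (𝟙 X) a b c) :
    ∃ (A : Y ⟶ X) (a' b' c' : A ⟶ F ≫ S.T), cell a' = a ∧ cell b' = b ∧ cell c' = c := by
  have := H.eq_cells
  rw [Strict.comp_id S.T] at this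
  exact this

theorem AddCell.assoc {F : Y ⟶ X} {a b c ab bc x y : Cell Y X} (hab : S.AddCell F (𝟙 X) a b ab)
    (hbc : S.AddCell F (𝟙 X) b c bc) (hx : S.AddCell F (𝟙 X) ab c x)
    (hy : S.AddCell F (𝟙 X) a bc y) : x = y := by
  obtain ⟨A, a, b, ab, rfl, rfl, rfl⟩ := hab.eq_cells_id
  obtain ⟨A₁, b₁, c, bc, hb, rfl, rfl⟩ := hbc.eq_cells_id
  obtain rfl : A₁ = A := src_eq_of_eq hb
  obtain rfl := cell_inj hb
  obtain ⟨A₂, _, _, x, h, -, rfl⟩ := hx.eq_cells_id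
  obtain rfl : A₂ = A₁ := src_eq_of_eq h
  obtain ⟨A₃, _, _, y, h, -, rfl⟩ := hy.eq_cells_id
  obtain rfl : A₃ = A₂ := src_eq_of_eq h
  rw [addCell_id_iff] at hab hbc hx hy
  rw [(S.additive_whisker F).isAdd_assoc hab hbc hx hy]

theorem AddCell.comm {F : Y ⟶ X} {a b c : Cell Y X} (h : S.AddCell F (𝟙 X) a b c) :
    S.AddCell F (𝟙 X) b a c := by
  obtain ⟨A, a, b, c, rfl, rfl, rfl⟩ := h.eq_cells_id
  rw [addCell_id_iff] at h ⊢
  exact (S.additive_whisker F).isAdd_comm h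

theorem AddCell.unit {F : Y ⟶ X} {A : Y ⟶ X} {a : A ⟶ F ≫ S.T} {c : Cell Y X}
    (h : S.AddCell F (𝟙 X) (cell (a ≫ F ◁ S.p ≫ F ◁ S.z)) (cell a) c) : c = cell a := by
  obtain ⟨A', _, _, c, -, h', rfl⟩ := h.eq_cells_id
  obtain rfl : A' = A := src_eq_of_eq h'
  rw [addCell_id_iff] at h
  rw [(S.additive_whisker F).isAdd_unit h]

end TangentStructure

/-- The 1-morphism `F` strictly preserves the tangent structures, including the chosen pullbacks. -/
structure StrictMap (S : TangentStructure X) (R : TangentStructure Y) (F : X ⟶ Y) : Prop where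
  T : S.T ≫ F = F ≫ R.T
  Tn : ∀ n, 0 < n → S.Tn n ≫ F = F ≫ R.Tn n
  p : wr (cell S.p) F = wl F (cell R.p)
  proj : ∀ n i, wr (cell (S.proj n i)) F = wl F (cell (R.proj n i))
  z : wr (cell S.z) F = wl F (cell R.z)
  s : wr (cell S.s) F = wl F (cell R.s)
  l : wr (cell S.l) F = wl F (cell R.l)
  c : wr (cell S.c) F = wl F (cell R.c)

namespace StrictMap

variable {S : TangentStructure X} {R : TangentStructure Y} {F : X ⟶ Y} (H : StrictMap S R F)
include H

theorem Tn_assoc {n : ℕ} (hn : 0 < n) (k : Y ⟶ W) : S.Tn n ≫ F ≫ k = F ≫ R.Tn n ≫ k := by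
  rw [← Strict.assoc, H.Tn n hn, Strict.assoc]

theorem addCell {V : K} {G : Z ⟶ X} {g : X ⟶ V} {k : V ⟶ W} {g' : Y ⟶ W}
    (hg : g ≫ k = F ≫ g') {a b c : Cell Z V} (h : S.AddCell G g a b c) :
    R.AddCell (G ≫ F) g' (wr a k) (wr b k) (wr c k) := by
  obtain ⟨A, t, rfl, rfl, rfl⟩ := h
  obtain ⟨t', e⟩ := (wr (cell t) k).exists_hom (f := A ≫ k) (g := (G ≫ F) ≫ R.Tn 2 ≫ g') rfl
    (by simp [hg, H.Tn_assoc])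
  refine ⟨_, t', ?_, ?_, ?_⟩
  · simp [e, hg, wr_comp_of_eq (H.proj 2 0)]
  · simp [e, hg, wr_comp_of_eq (H.proj 2 1)]
  · simp [e, hg, wr_comp_of_eq H.s]

end StrictMap

end Tangentads

namespace Tangentads

variable {K : Type u} [Bicategory.{w, v} K] [Strict K]

open Cell

/-! ### Tangent structures on 2-pullbacks -/

namespace TangentStructure

variable {X Y : K}

theorem jointMono (S : TangentStructure X) {n : ℕ} (hn : 0 < n) (F : Y ⟶ X) {g : X ⟶ X} {k : ℕ}
    (hg : g = iter S.T k) : JointMono (fun i => Cell.wl F (Cell.wr (cell (S.proj n i)) g)) :=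
  hg ▸ (S.isPb hn F k).jointMono

end TangentStructure

namespace StrictMap

variable {X Y : K} {S : TangentStructure X} {R : TangentStructure Y} {F : X ⟶ Y}

/-- A strict map preserves the comparison morphisms of the universality of the vertical lift. -/
theorem locally_linear (H : StrictMap S R F) {m : S.Tn 2 ⟶ S.Tn 2 ≫ S.T}
    {m' : R.Tn 2 ⟶ R.Tn 2 ≫ R.T} (h0 : m ≫ S.proj 2 0 ▷ S.T = S.proj 2 0 ≫ S.l)
    (h1 : m ≫ S.proj 2 1 ▷ S.T = S.proj 2 1 ≫ (ρ_ S.T).inv ≫ S.T ◁ S.z)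
    (h0' : m' ≫ R.proj 2 0 ▷ R.T = R.proj 2 0 ≫ R.l)
    (h1' : m' ≫ R.proj 2 1 ▷ R.T = R.proj 2 1 ≫ (ρ_ R.T).inv ≫ R.T ◁ R.z) :
    wr (cell m) F = wl F (cell m') := by
  refine R.jointMono two_pos F (iter_one R.T).symm _ _ ?_ ?_ ?_
  · intro i
    simp [H.T, H.Tn_assoc]
  · intro i
    simp
  · have e0 := congrArg (fun t => wr (cell t) F) h0
    have e1 := congrArg (fun t => wr (cell t) F) h1
    have e0' := congrArg (fun t => wl F (cell t)) h0'
    have e1' := congrArg (fun t => wl F (cell t)) h1'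
    simp [H.T, wr_comp_of_eq (H.proj 2 0), wr_comp_of_eq (H.proj 2 1), H.proj, H.l, H.z] at e0 e1 e0' e1'
    intro i
    fin_cases i
    · simpa [e0] using e0'.symm
    · simpa [e1, ← wl_wl, H.T] using e1'.symm

end StrictMap

/-- Each datum of the structure on `P` is the unique lift of the data of `S` whiskered with the
projections; these agree over `B` because `U` preserves them strictly. Equations follow by testing
on the projections. For pullbacks the lifts exist componentwise in `E`, and the pullbacks of `R` in
`B` provide the uniqueness that glues them. -/
theorem IsNFoldTwoPullback.exists_strictMap {E B P : K} {U : E ⟶ B} {N : ℕ}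
    {π : Fin N → (P ⟶ E)} (hP : IsNFoldTwoPullback U π) {S : TangentStructure E}
    {R : TangentStructure B} (H : StrictMap S R U) :
    ∃ Q : TangentStructure P, ∀ i, StrictMap Q S (π i) := by
  have comm_assoc : ∀ (i j) {W : K} (k : B ⟶ W), π i ≫ U ≫ k = π j ≫ U ≫ k := fun i j W k => by
    rw [← Strict.assoc, hP.comm i j, Strict.assoc]
  have lift₁ : ∀ (f : E ⟶ E) (g : B ⟶ B), f ≫ U = U ≫ g → ∃ f' : P ⟶ P, ∀ i, f' ≫ π i = π i ≫ f :=
    fun f g h => hP.exists_lift (fun i => π i ≫ f) fun i j => by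
      simp only [Strict.assoc, h, comm_assoc i j]
  have lift₂ : ∀ {f f' : E ⟶ E} (a : f ⟶ f') {g g' : B ⟶ B} (b : g ⟶ g') (F F' : P ⟶ P),
      (∀ i, F ≫ π i = π i ≫ f) → (∀ i, F' ≫ π i = π i ≫ f') → wr (cell a) U = wl U (cell b) →
      ∃ a' : F ⟶ F', ∀ i, wr (cell a') (π i) = wl (π i) (cell a) := by
    intro f f' a g g' b F F' hF hF' h
    obtain ⟨C, hC⟩ := hP.exists_cell_lift (fun i => wl (π i) (cell a)) fun i j => by
      simp [h, hP.comm i j]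
    obtain ⟨a', rfl⟩ := C.exists_hom (f := F) (g := F')
      (hP.ext fun i => (congrArg src (hC i)).trans (hF i).symm)
      (hP.ext fun i => (congrArg tgt (hC i)).trans (hF' i).symm)
    exact ⟨a', hC⟩
  obtain ⟨T, hT⟩ := lift₁ _ _ H.T
  -- The value at `0` carries no condition, and `U` is not required to preserve it; `𝟙 P` fills the
  -- slot.
  have : ∀ n, ∃ f : P ⟶ P, 0 < n → ∀ i, f ≫ π i = π i ≫ S.Tn n := by
    intro n
    by_cases hn : 0 < n
    · obtain ⟨f, hf⟩ := lift₁ _ _ (H.Tn n hn)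
      exact ⟨f, fun _ => hf⟩
    · exact ⟨𝟙 P, fun h => absurd h hn⟩
  choose Tn hTn using this
  have hT' : ∀ i {W : K} (k : E ⟶ W), T ≫ π i ≫ k = π i ≫ S.T ≫ k := fun i W k => by
    rw [← Strict.assoc, hT, Strict.assoc]
  have hTn' : ∀ n, 0 < n → ∀ i {W : K} (k : E ⟶ W), Tn n ≫ π i ≫ k = π i ≫ S.Tn n ≫ k :=
    fun n hn i W k => by rw [← Strict.assoc, hTn n hn, Strict.assoc]
  have hid : ∀ i, 𝟙 P ≫ π i = π i ≫ 𝟙 E := fun i => by simp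
  obtain ⟨p, hp⟩ := lift₂ S.p R.p T (𝟙 P) hT hid H.p
  have : ∀ n (j : Fin n), ∃ a : Tn n ⟶ T, ∀ i, wr (cell a) (π i) = wl (π i) (cell (S.proj n j)) :=
    fun n j => lift₂ (S.proj n j) (R.proj n j) (Tn n) T (hTn n j.pos) hT (H.proj n j)
  choose proj hproj using this
  have hTT : ∀ i, (T ≫ T) ≫ π i = π i ≫ S.T ≫ S.T := fun i => by simp [hT, hT']
  obtain ⟨z, hz⟩ := lift₂ S.z R.z (𝟙 P) T hid hT H.z
  obtain ⟨s, hs⟩ := lift₂ S.s R.s (Tn 2) T (hTn 2 two_pos) hT H.s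
  obtain ⟨l, hl⟩ := lift₂ S.l R.l T (T ≫ T) hT hTT H.l
  obtain ⟨c, hc⟩ := lift₂ S.c R.c (T ≫ T) (T ≫ T) hTT hTT H.c
  have hp' : ∀ i {W : K} (k : E ⟶ W), _ := fun i W k => wr_comp_of_eq (hp i) k
  have hproj' : ∀ n j i {W : K} (k : E ⟶ W), _ := fun n j i W k => wr_comp_of_eq (hproj n j i) k
  have hz' : ∀ i {W : K} (k : E ⟶ W), _ := fun i W k => wr_comp_of_eq (hz i) k
  have hs' : ∀ i {W : K} (k : E ⟶ W), _ := fun i W k => wr_comp_of_eq (hs i) k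
  have hl' : ∀ i {W : K} (k : E ⟶ W), _ := fun i W k => wr_comp_of_eq (hl i) k
  have hc' : ∀ i {W : K} (k : E ⟶ W), _ := fun i W k => wr_comp_of_eq (hc i) k
  have hiter : ∀ k i, iter T k ≫ π i = π i ≫ iter S.T k := fun k i => iter_comp (hT i) k
  have hpb : ∀ n, 0 < n → ∀ {Y : K} (F : Y ⟶ P) (k : ℕ),
      IsNFoldPullback (F ◁ (p ▷ iter T k)) (fun i => F ◁ (proj n i ▷ iter T k)) := by
    intro n hn Y F k
    refine (isPb_iff hn _ _).1 (hP.isPb (fun j => ?_) fun j => ?_)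
    · simpa [hiter, hp', hproj'] using S.isPb hn (F ≫ π j) k
    · have hk : iter T k ≫ π j ≫ U = π j ≫ U ≫ iter R.T k := by
        rw [← Strict.assoc, hiter, Strict.assoc, iter_comp H.T]
      simpa [hk, hproj', wr_comp_of_eq (H.proj _ _)] using
        R.jointMono hn (F ≫ π j ≫ U) (k := k) rfl
  have hpb0 : ∀ n, 0 < n → IsNFoldPullback p (proj n) := fun n hn =>
    (isPb_iff hn _ _).1 (by simpa [iter] using (isPb_iff hn _ _).2 (hpb n hn (𝟙 P) 0))
  -- sums of cells are detected by the projections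
  have hadd : ∀ {Y : K} (F : Y ⟶ P) (g : P ⟶ P) (g' : E ⟶ E), (∀ i, g ≫ π i = π i ≫ g') →
      ∀ {A E₁ E₂ : Y ⟶ P} {ρ : Fin 2 → (E₂ ⟶ E₁)} {σ : E₂ ⟶ E₁},
      (∀ j, cell (ρ j) = wl F (wr (cell (proj 2 j)) g)) → cell σ = wl F (wr (cell s) g) →
      ∀ {a b d : A ⟶ E₁}, IsAdd ρ σ a b d → ∀ i, S.AddCell (F ≫ π i) g' (wr (cell a) (π i))
        (wr (cell b) (π i)) (wr (cell d) (π i)) := by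
    rintro Y F g g' hg A E₁ E₂ ρ σ hρ hσ _ _ _ ⟨t, ⟨rfl, rfl⟩, rfl⟩ i
    obtain ⟨t', ht'⟩ := (wr (cell t) (π i)).exists_hom (f := A ≫ π i)
      (g := (F ≫ π i) ≫ S.Tn 2 ≫ g') rfl (by
        have : E₂ = F ≫ Tn 2 ≫ g := src_eq_of_eq hσ
        simp [this, hg, hTn' 2 two_pos])
    refine ⟨_, t', ?_, ?_, ?_⟩
    · simp [ht', hρ, hg, hproj']
    · simp [ht', hρ, hg, hproj']
    · simp [ht', hσ, hg, hs']
  have add : IsAdditiveBundle p proj z s := by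
    refine .of_isAdd hpb0 ?_ ?_ ?_ ?_ ?_
    · refine cell_inj (hP.cell_ext fun i => ?_)
      have := congrArg (fun t => wl (π i) (cell t)) S.additive.zero_proj
      simpa [hz, hp] using this
    · refine cell_inj (hP.cell_ext fun i => ?_)
      have := congrArg (fun t => wl (π i) (cell t)) S.additive.sum_proj
      simpa [hs, hp, hproj] using this
    · intro Y a b c ab bc x y hab hbc hx hy
      refine cell_inj (hP.cell_ext fun i => ?_)
      have H : ∀ {a b c : Y ⟶ T}, _ := fun {a b c} => hadd (a := a) (b := b) (d := c)
        (ρ := proj 2) (σ := s) (𝟙 P) (𝟙 P) (𝟙 E) hid (fun j => by simp) (by simp)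
      exact (H hab i).assoc (H hbc i) (H hx i) (H hy i)
    · intro Y a c h
      refine cell_inj (hP.cell_ext fun i => ?_)
      have H := hadd (𝟙 P) (𝟙 P) (𝟙 E) hid (fun j => by simp) (by simp) h i
      obtain ⟨a', ha'⟩ := (wr (cell a) (π i)).exists_hom (f := Y ≫ π i)
        (g := (𝟙 P ≫ π i) ≫ S.T) rfl (by simp [hT])
      rw [← ha']
      refine TangentStructure.AddCell.unit ?_
      rw [← ha'] at H
      convert H using 1
      simp [ha', hp, hz]
    · intro Y a b c d h h'
      refine cell_inj (hP.cell_ext fun i => ?_)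
      have H := hadd (𝟙 P) (𝟙 P) (𝟙 E) hid (fun j => by simp) (by simp) h i
      have H' := hadd (𝟙 P) (𝟙 P) (𝟙 E) hid (fun j => by simp) (by simp) h' i
      exact H.comm.unique (k := 0) rfl H'
  -- Converse of `hadd`: once the summands can be paired over `P`, uniqueness of sums in `E`
  -- identifies their sum on every projection.
  have hadd' : ∀ {Y : K} (F : Y ⟶ P) (g : P ⟶ P) (k : ℕ), (∀ i, g ≫ π i = π i ≫ iter S.T k) →
      ∀ {A E₁ E₂ E₀ : Y ⟶ P} {ρ : Fin 2 → (E₂ ⟶ E₁)} {σ : E₂ ⟶ E₁} {q : E₁ ⟶ E₀},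
      (∀ j, cell (ρ j) = wl F (wr (cell (proj 2 j)) g)) → cell σ = wl F (wr (cell s) g) →
      IsNFoldPullback q ρ → ∀ {a b d : A ⟶ E₁}, a ≫ q = b ≫ q →
      (∀ i, S.AddCell (F ≫ π i) (iter S.T k) (wr (cell a) (π i)) (wr (cell b) (π i))
        (wr (cell d) (π i))) → IsAdd ρ σ a b d := by
    intro Y F g k hg A E₁ E₂ E₀ ρ σ q hρ hσ hq a b d hab h
    obtain ⟨t, ht⟩ := hq.exists_isPair hab
    refine ⟨t, ht, cell_inj (hP.cell_ext fun i => ?_)⟩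
    exact (hadd F g (iter S.T k) hg hρ hσ ⟨t, ht, rfl⟩ i).unique rfl (h i)
  have hpb1 : IsNFoldPullback (p ▷ T) (fun i => proj 2 i ▷ T) := (isPb_iff two_pos _ _).1 (by
    simpa [iter] using (isPb_iff two_pos _ _).2 (hpb 2 two_pos (𝟙 P) 1))
  have hpb2 : IsNFoldPullback (T ◁ p) (fun i => T ◁ proj 2 i) := (isPb_iff two_pos _ _).1 (by
    simpa [iter] using (isPb_iff two_pos _ _).2 (hpb 2 two_pos T 0))
  have lift_add : IsAdditiveBundleHom p z (proj 2) s (p ▷ T) (z ▷ T) (fun i => proj 2 i ▷ T)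
      (s ▷ T) (z ≫ (λ_ T).inv) l := by
    have h1 : l ≫ p ▷ T = p ≫ z ≫ (λ_ T).inv := by
      refine cell_inj (hP.cell_ext fun i => ?_)
      have := congrArg (fun t => wl (π i) (cell t)) S.lift_additive.proj
      simpa [hT, hl, hp', hp, hz] using this
    refine ⟨h1, ?_, ?_⟩
    · refine cell_inj (hP.cell_ext fun i => ?_)
      have := congrArg (fun t => wl (π i) (cell t)) S.lift_additive.zero
      simpa [hT, hl, hz, hz'] using this
    · refine isAdd_iff_exists.1 (hadd' (𝟙 P) T 1 (by simpa [iter] using hT) (fun j => by simp)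
        (by simp) hpb1 ?_ fun i => ?_)
      · rw [Category.assoc, Category.assoc, h1, reassoc_of% (hpb0 2 two_pos).comm 0 1]
      · have h2 := (TangentStructure.addCell_iff_isAdd (S := S) (F := 𝟙 E) (g := iter S.T 1)
          (fun j => by simp [iter]) (by simp [iter]) _ _ _).2
          (isAdd_iff_exists.2 S.lift_additive.sum)
        simpa [hproj, hl, hs] using h2.wl (π i)
  have flip_add : IsAdditiveBundleHom (p ▷ T) (z ▷ T) (fun i => proj 2 i ▷ T) (s ▷ T)
      (T ◁ p) (T ◁ z) (fun i => T ◁ proj 2 i) (T ◁ s) ((λ_ T).hom ≫ (ρ_ T).inv) c := by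
    have h1 : c ≫ T ◁ p = p ▷ T ≫ (λ_ T).hom ≫ (ρ_ T).inv := by
      refine cell_inj (hP.cell_ext fun i => ?_)
      have := congrArg (fun t => wl (π i) (cell t)) S.flip_additive.proj
      simpa [hT, hc, hp', hp] using this
    refine ⟨h1, ?_, ?_⟩
    · refine cell_inj (hP.cell_ext fun i => ?_)
      have := congrArg (fun t => wl (π i) (cell t)) S.flip_additive.zero
      simpa [hT, hc, hz, hz'] using this
    · refine isAdd_iff_exists.1 (hadd' T (𝟙 P) 0 (by simp [iter]) (fun j => by simp)
        (by simp) hpb2 ?_ fun i => ?_)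
      · rw [Category.assoc, Category.assoc, h1, reassoc_of% hpb1.comm 0 1]
      · have h2 := (TangentStructure.addCell_iff_isAdd (S := S) (F := S.T) (g := iter S.T 0)
          (fun j => by simp [iter]) (by simp [iter]) _ _ _).2
          (isAdd_iff_exists.2 S.flip_additive.sum)
        simpa [hproj', hc, hs', hT] using h2.wl (π i)
  have lin : ∃ m : Tn 2 ⟶ Tn 2 ≫ T,
      m ≫ proj 2 0 ▷ T = proj 2 0 ≫ l ∧ m ≫ proj 2 1 ▷ T = proj 2 1 ≫ (ρ_ T).inv ≫ T ◁ z ∧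
      ∀ {Y : K} (F : Y ⟶ P), IsPullback (F ◁ (m ≫ s ▷ T)) (F ◁ (proj 2 0 ≫ p))
        (F ◁ (p ▷ T)) (F ◁ (z ≫ (λ_ T).inv)) := by
    obtain ⟨m, e0, e1, hm⟩ := S.locally_linear
    -- The square over `B` is needed for gluing, and `U` carries the comparison `m` to `m'` since
    -- both are determined by their components.
    obtain ⟨m', e0', e1', hm'⟩ := R.locally_linear
    have hmU := H.locally_linear e0 e1 e0' e1'
    obtain ⟨μ, hμ⟩ := lift₂ m m' (Tn 2) (Tn 2 ≫ T) (hTn 2 two_pos)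
      (fun i => by simp [hT, hTn' 2 two_pos]) hmU
    refine ⟨μ, ?_, ?_, fun {Y} F => (isPull_iff _ _ _ _).1 (hP.isPull (fun j => ?_) fun j => ?_)⟩
    · refine cell_inj (hP.cell_ext fun i => ?_)
      have := congrArg (fun t => wl (π i) (cell t)) e0
      simpa [hT, hμ, hproj', hproj, hl] using this
    · refine cell_inj (hP.cell_ext fun i => ?_)
      have := congrArg (fun t => wl (π i) (cell t)) e1
      simpa [hT, hμ, hproj', hproj, hz] using this
    · have := (isPull_iff _ _ _ _).2 (hm (F ≫ π j))
      simpa [hT, hμ, hproj', hproj, hz, hs', hp', hp] using this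
    · have := (isPull_iff _ _ _ _).2 (hm' (F ≫ π j ≫ U))
      simpa [hT', H.T, wr_comp_of_eq (hμ j), hmU, hproj', H.proj, hz', H.z, hs', hp', H.p,
        wr_comp_of_eq H.p, wr_comp_of_eq H.s] using this
  refine ⟨
    { T := T, p := p, Tn := Tn, proj := proj, z := z, s := s, l := l, c := c
      additive := add
      isNFoldPullback := hpb
      lift_additive := lift_add
      flip_additive := flip_add
      lift_coassoc := cell_inj (hP.cell_ext fun i => ?_)
      lift_flip := cell_inj (hP.cell_ext fun i => ?_)
      flip_lift := cell_inj (hP.cell_ext fun i => ?_)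
      flip_flip := cell_inj (hP.cell_ext fun i => ?_)
      flip_braid := cell_inj (hP.cell_ext fun i => ?_)
      locally_linear := lin }, fun i =>
    { T := hT i
      Tn := fun n hn => hTn n hn i
      p := hp i
      proj := fun n j => hproj n j i
      z := hz i
      s := hs i
      l := hl i
      c := hc i }⟩
  · have := congrArg (fun t => wl (π i) (cell t)) S.lift_coassoc
    simpa [hT, hl, hl'] using this
  · have := congrArg (fun t => wl (π i) (cell t)) S.lift_flip
    simpa [hl, hc] using this
  · have := congrArg (fun t => wl (π i) (cell t)) S.flip_lift
    simpa [hT, hl, hl', hc, hc'] using this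
  · have := congrArg (fun t => wl (π i) (cell t)) S.flip_flip
    simpa [hc, hT, hT'] using this
  · have := congrArg (fun t => wl (π i) (cell t)) S.flip_braid
    simpa [hT, hT', hc, hc'] using this

end Tangentads

namespace Tangentads

variable {K : Type u} [Bicategory.{w, v} K]

open Cell

/-! ### Lax tangent morphisms in terms of cells -/

section

variable {X Y Z : Tng K}

@[simp] theorem Tng.comp_F (f : X ⟶ Y) (g : Y ⟶ Z) : LaxMor.F (f ≫ g) = f.F ≫ g.F := (rfl)

@[simp] theorem Tng.tangent_F (X : Tng K) : X.tangent.F = X.str.T := (rfl)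

theorem LaxMor.ext_cell {f g : X ⟶ Y} (h : f.F = g.F) (h' : cell f.α = cell g.α) : f = g := by
  obtain ⟨F, α, _, _, _⟩ := f
  obtain ⟨G, β, _, _, _⟩ := g
  obtain rfl : F = G := h
  obtain rfl : α = β := cell_inj h'
  rfl

/-- A 2-morphism into the vertex of a jointly monic family of tangent 2-morphisms is a tangent
2-morphism as soon as its components are. -/
theorem TwoMor.comm_of_jointMono {n : ℕ} {H A : X ⟶ Y} {B : Fin n → (X ⟶ Y)} (e : ∀ i, A ⟶ B i)
    (hm : ∀ {C : X.obj ⟶ Y.obj} {a b : C ⟶ A.F ≫ Y.str.T},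
      (∀ i, a ≫ (e i).φ ▷ Y.str.T = b ≫ (e i).φ ▷ Y.str.T) → a = b)
    (φ : H.F ⟶ A.F) (ψ : ∀ i, H ⟶ B i) (h : ∀ i, φ ≫ (e i).φ = (ψ i).φ) :
    H.α ≫ φ ▷ Y.str.T = X.str.T ◁ φ ≫ A.α := by
  refine hm fun i => ?_
  have h1 := (ψ i).comm
  rw [← h i] at h1
  simp only [comp_whiskerRight, whiskerLeft_comp, Category.assoc] at h1
  rw [Category.assoc, h1, Category.assoc, ← (e i).comm]

end

variable [Strict K]

section

variable {X Y Z : Tng K}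

theorem Tng.comp_α_aux (f : X ⟶ Y) (g : Y ⟶ Z) :
    ((cell f.α).wr g.F).tgt = (wl f.F (cell g.α)).src := by simp

@[simp] theorem Tng.cell_comp_α (f : X ⟶ Y) (g : Y ⟶ Z) :
    cell (LaxMor.α (f ≫ g)) = ((cell f.α).wr g.F).comp (wl f.F (cell g.α)) (comp_α_aux f g) := by
  change cell ((α_ X.str.T f.F g.F).inv ≫ f.α ▷ g.F ≫ (α_ f.F Y.str.T g.F).hom ≫ f.F ◁ g.α ≫
    (α_ f.F g.F Z.str.T).inv) = _
  simp

theorem LaxMor.isStrict_iff {f : X ⟶ Y} :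
    LaxMor.IsStrict f ↔ ∃ g, cell f.α = one g := by
  constructor
  · rintro ⟨h, e⟩
    exact ⟨_, by rw [e, cell_eqToHom]⟩
  · rintro ⟨g, e⟩
    have h : X.str.T ≫ f.F = f.F ≫ Y.str.T := (src_eq_of_eq e).trans (tgt_eq_of_eq e).symm
    exact ⟨h, cell_inj (by rw [e, cell_eqToHom, ← one_src g, ← e]; rfl)⟩

theorem LaxMor.IsStrict.T {f : X ⟶ Y} (h : LaxMor.IsStrict f) :
    X.str.T ≫ f.F = f.F ≫ Y.str.T := h.1

theorem LaxMor.IsStrict.cell_α {f : X ⟶ Y} (h : LaxMor.IsStrict f) :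
    cell f.α = one (f.F ≫ Y.str.T) := by
  rw [h.2, cell_eqToHom, h.1]

theorem cell_double_aux {A B : K} {T : A ⟶ A} {T' : B ⟶ B} {F : A ⟶ B} (α : T ≫ F ⟶ F ≫ T') :
    (wl T (cell α)).tgt = (wr (cell α) T').src := by simp

@[simp] theorem cell_double {A B : K} {T : A ⟶ A} {T' : B ⟶ B} {F : A ⟶ B} (α : T ≫ F ⟶ F ≫ T') :
    cell (double α) = (wl T (cell α)).comp (wr (cell α) T') (cell_double_aux α) := by
  simp [double]

end

end Tangentads

namespace Tangentads

variable {K : Type u} [Bicategory.{w, v} K] [Strict K]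

open Cell

/-! ### The fibre powers of the tangent bundle as lax tangent morphisms -/

namespace TangentStructure

variable {X Y : K} (S : TangentStructure X) {n : ℕ} (hn : 0 < n)
include hn

theorem jointMono₀ (F : Y ⟶ X) : JointMono (fun i => Cell.wl F (cell (S.proj n i))) := by
  simpa using S.jointMono hn F (g := 𝟙 X) (k := 0) rfl

theorem jointMono₁ (F : Y ⟶ X) :
    JointMono (fun i => Cell.wl F (Cell.wr (cell (S.proj n i)) S.T)) :=
  S.jointMono hn F (iter_one S.T).symm

theorem jointMono₂ (F : Y ⟶ X) :
    JointMono (fun i => Cell.wl F (Cell.wr (cell (S.proj n i)) (S.T ≫ S.T))) :=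
  S.jointMono hn F (iter_two S.T).symm

theorem hom_ext₀ (F : Y ⟶ X) {A : Y ⟶ X} {a b : A ⟶ F ≫ S.Tn n}
    (h : ∀ i, a ≫ F ◁ S.proj n i = b ≫ F ◁ S.proj n i) : a = b :=
  cell_inj (S.jointMono₀ hn F _ _ (fun _ => rfl) (fun _ => rfl) fun i => by
    simpa using cell_congr (h i))

theorem isNFoldPullback₀ (F : Y ⟶ X) : IsNFoldPullback (F ◁ S.p) (fun i => F ◁ S.proj n i) :=
  (S.additive_whisker F).isNFoldPullback n hn

theorem isNFoldPullback₁ (F : Y ⟶ X) :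
    IsNFoldPullback (F ◁ (S.p ▷ S.T)) (fun i => F ◁ (S.proj n i ▷ S.T)) :=
  isNFoldPullback_of_iter hn F (iter_one S.T).symm

/-- The flip is applied factor by factor. The factors match because `c` exchanges the two
projections of `T²`; the direction needed here comes from `flip_additive` through `c ≫ c = 𝟙`. -/
theorem exists_flipN : ∃ α : S.T ≫ S.Tn n ⟶ S.Tn n ≫ S.T,
    ∀ i, α ≫ S.proj n i ▷ S.T = S.T ◁ S.proj n i ≫ S.c := by
  have hpb : IsNFoldPullback (S.p ▷ S.T) (fun i => S.proj n i ▷ S.T) :=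
    (isPb_iff hn _ _).1 (by simpa using (isPb_iff hn _ _).2 (S.isNFoldPullback₁ hn (𝟙 X)))
  refine hpb.exists_lift _ fun i j => ?_
  have h : S.c ≫ S.p ▷ S.T = S.T ◁ S.p ≫ (ρ_ S.T).hom ≫ (λ_ S.T).inv := by
    have h := congrArg (S.c ≫ ·) S.flip_additive.proj
    simp only [← Category.assoc, S.flip_flip, Category.id_comp] at h
    rw [h]
    simp
  have e := S.additive.isNFoldPullback n hn |>.comm i j
  simp only [Category.assoc, h]
  rw [← whiskerLeft_comp_assoc, ← whiskerLeft_comp_assoc, e]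

end TangentStructure

namespace Tng

variable (X : Tng K) {n : ℕ} (hn : 0 < n)

/-- The canonical flip `T ∘ Tₙ ⟶ Tₙ ∘ T`. -/
noncomputable def flipN : X.str.T ≫ X.str.Tn n ⟶ X.str.Tn n ≫ X.str.T :=
  (X.str.exists_flipN hn).choose

theorem flipN_proj (i : Fin n) :
    X.flipN hn ≫ X.str.proj n i ▷ X.str.T = X.str.T ◁ X.str.proj n i ≫ X.str.c :=
  (X.str.exists_flipN hn).choose_spec i

theorem exchange_proj (i : Fin n) {f g : X.obj ⟶ X.obj} (φ : f ⟶ g) :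
    X.str.Tn n ◁ φ ≫ X.str.proj n i ▷ g = X.str.proj n i ▷ f ≫ X.str.T ◁ φ :=
  whisker_exchange (X.str.proj n i) φ

omit [Strict K] in
theorem exists_flip_two : ∃ γ : X.str.Tn 2 ≫ X.str.T ⟶ X.str.T ≫ X.str.Tn 2,
    (∀ i, γ ≫ X.str.T ◁ X.str.proj 2 i = X.str.proj 2 i ▷ X.str.T ≫ X.str.c) ∧
      γ ≫ X.str.T ◁ X.str.s = X.str.s ▷ X.str.T ≫ X.str.c :=
  X.str.flip_additive.sum

/-- `flip_additive` provides a map `γ` in the opposite direction that respects the sum. Since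
`flipN` followed by `γ` is the identity, the involution `c` turns that law into this one. -/
theorem flipN_two_sum :
    X.flipN two_pos ≫ X.str.s ▷ X.str.T = X.str.T ◁ X.str.s ≫ X.str.c := by
  obtain ⟨γ, h1, h2⟩ := X.exists_flip_two
  have e : X.flipN two_pos ≫ γ = 𝟙 _ := X.str.hom_ext₀ two_pos _ fun i => by
    rw [Category.assoc, h1, ← Category.assoc, flipN_proj, Category.assoc, X.str.flip_flip]
    simp
  have h3 := congrArg (fun t => X.flipN two_pos ≫ t ≫ X.str.c) h2
  simp only [Category.assoc, X.str.flip_flip, reassoc_of% e] at h3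
  simpa using h3.symm

theorem flipN_p : X.flipN hn ≫ X.str.Tn n ◁ X.str.p =
    X.str.p ▷ X.str.Tn n ≫ (λ_ (X.str.Tn n)).hom ≫ (ρ_ (X.str.Tn n)).inv := by
  refine cell_inj (X.str.jointMono₀ hn (𝟙 _) _ _ (fun i => by simp) (fun i => by simp)
    fun i => ?_)
  have e1 := cell_congr (X.exchange_proj i X.str.p)
  have e2 := cell_congr (X.flipN_proj hn i)
  have e3 := cell_congr (X.str.flip_additive.proj)
  have e4 := cell_congr (whisker_exchange X.str.p (X.str.proj n i))
  simp at e1 e2 e3 e4 ⊢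
  simp only [e1, reassoc e2, comp_assoc, e3, e4]

/-- The `n`-fold fibre power `Tₙ` of the tangent bundle as a lax tangent 1-morphism. -/
noncomputable def tangentN : X ⟶ X where
  F := X.str.Tn n
  α := X.flipN hn
  additive := by
    refine ⟨X.flipN_p hn, ?_, ?_⟩
    · refine cell_inj (X.str.jointMono₁ hn (𝟙 _) _ _ (fun i => by simp) (fun i => by simp)
        fun i => ?_)
      have e1 := cell_congr (X.exchange_proj i X.str.z)
      have e2 := cell_congr (X.flipN_proj hn i)
      have e3 := cell_congr (X.str.flip_additive.zero)
      have e4 := cell_congr (whisker_exchange X.str.z (X.str.proj n i))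
      simp at e1 e2 e3 e4 ⊢
      simp only [e1, e2, ← e3, reassoc e4.symm, comp_assoc]
    · have hpb := X.str.isNFoldPullback₀ two_pos (X.str.Tn n)
      obtain ⟨γ, h1, h2⟩ := X.exists_flip_two
      refine isAdd_iff_exists.1 ?_
      obtain ⟨t, ht⟩ := hpb.exists_isPair (a := X.str.proj 2 0 ▷ X.str.Tn n ≫ X.flipN hn)
        (b := X.str.proj 2 1 ▷ X.str.Tn n ≫ X.flipN hn) (by
          have h1 : ∀ j, (X.str.proj 2 j ▷ X.str.Tn n ≫ X.flipN hn) ≫ X.str.Tn n ◁ X.str.p =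
              (X.str.proj 2 j ≫ X.str.p) ▷ X.str.Tn n ≫ (λ_ _).hom ≫ (ρ_ _).inv := fun j => by
            rw [Category.assoc, X.flipN_p, comp_whiskerRight, Category.assoc]
          rw [h1, h1, (X.str.additive.isNFoldPullback 2 two_pos).comm 0 1])
      have ht' : ∀ j, t ≫ X.str.Tn n ◁ X.str.proj 2 j =
          X.str.proj 2 j ▷ X.str.Tn n ≫ X.flipN hn := Fin.forall_fin_two.2 ht
      refine ⟨t, ht, ?_⟩
      -- On each of the `n` factors the pairing `t` restricts to `γ`, whose compatibility with the
      -- sum is known; joint monicity of the factors then gives additivity.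
      have h3 : ∀ i, t ≫ X.str.proj n i ▷ X.str.Tn 2 = X.str.Tn 2 ◁ X.str.proj n i ≫ γ := by
        intro i
        refine X.str.hom_ext₀ two_pos _ fun j => ?_
        rw [Category.assoc, ← X.exchange_proj, reassoc_of% ht' j, flipN_proj, Category.assoc, h1,
          ← whisker_exchange_assoc]
      refine cell_inj (X.str.jointMono₁ hn (𝟙 _) _ _ (fun i => by simp) (fun i => by simp)
        fun i => ?_)
      have e1 := cell_congr (X.exchange_proj i X.str.s)
      have e2 := cell_congr (X.flipN_proj hn i)
      have e3 := cell_congr (h3 i)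
      have e4 := cell_congr (whisker_exchange X.str.s (X.str.proj n i))
      have e5 := cell_congr h2
      simp at e1 e2 e3 e4 e5 ⊢
      simp only [e1, e2, reassoc e3, e5, reassoc e4, comp_assoc]
  lift := by
    refine cell_inj (X.str.jointMono₂ hn (𝟙 _) _ _ (fun i => by simp) (fun i => by simp)
      fun i => ?_)
    have e1 := cell_congr (X.exchange_proj i X.str.l)
    have e2 := cell_congr (X.flipN_proj hn i)
    have e2r := congrArg (wr · X.str.T) e2
    have e2l := congrArg (wl X.str.T) e2
    have e3 := cell_congr (show X.str.l ▷ X.str.T ≫ double X.str.c = X.str.c ≫ X.str.T ◁ X.str.l from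
      X.tangent.lift)
    have e4 := cell_congr (whisker_exchange X.str.l (X.str.proj n i))
    simp at e1 e2 e2r e2l e3 e4 ⊢
    simp only [e1, reassoc e2, e2r, reassoc e2l, comp_assoc, reassoc e4.symm, e3]
  flip := by
    refine cell_inj (X.str.jointMono₂ hn (𝟙 _) _ _ (fun i => by simp) (fun i => by simp)
      fun i => ?_)
    have e1 := cell_congr (X.exchange_proj i X.str.c)
    have e2 := cell_congr (X.flipN_proj hn i)
    have e2r := congrArg (wr · X.str.T) e2
    have e2l := congrArg (wl X.str.T) e2
    have e3 := cell_congr (show X.str.c ▷ X.str.T ≫ double X.str.c = double X.str.c ≫ X.str.T ◁ X.str.c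
      from X.tangent.flip)
    have e4 := cell_congr (whisker_exchange X.str.c (X.str.proj n i))
    simp at e1 e2 e2r e2l e3 e4 ⊢
    simp only [e1, e2r, reassoc e2r, reassoc e2l, comp_assoc, reassoc e4.symm, e3]

end Tng

end Tangentads

/-! ### Tangent 2-morphisms into fibre powers of the tangent bundle -/

namespace Tangentads

variable {K : Type u} [Bicategory.{w, v} K] [Strict K]

open Cell

namespace Tng

variable (X : Tng K) {n : ℕ} (hn : 0 < n)

/-- The projections `Tₙ ⟶ T` as tangent 2-morphisms. -/
noncomputable def projN (i : Fin n) : X.tangentN hn ⟶ X.tangent where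
  φ := X.str.proj n i
  comm := X.flipN_proj hn i

/-- The sum `T₂ ⟶ T` as a tangent 2-morphism. -/
noncomputable def sumN : X.tangentN two_pos ⟶ X.tangent where
  φ := X.str.s
  comm := X.flipN_two_sum

@[simp] theorem tangentN_F : (X.tangentN hn).F = X.str.Tn n := (rfl)

variable {X} {Y : Tng K}

/-- A 2-morphism into `Tₙ ∘ G` with tangent components is a tangent 2-morphism. -/
theorem exists_liftN {G H : Y ⟶ X} (φ : H.F ⟶ G.F ≫ X.str.Tn n) {B : Fin n → (Y ⟶ X)}
    (e : ∀ i, G ≫ X.tangentN hn ⟶ B i) (he : ∀ i, cell (e i).φ = wl G.F (cell (X.str.proj n i)))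
    (ψ : ∀ i, H ⟶ B i) (h : ∀ i, φ ≫ (e i).φ = (ψ i).φ) :
    ∃ Φ : H ⟶ G ≫ X.tangentN hn, Φ.φ = φ :=
  ⟨⟨φ, TwoMor.comm_of_jointMono e (fun {C a b} hab => cell_inj (X.str.jointMono₁ hn G.F _ _
    (fun i => by simp) (fun i => by simp) fun i => by
      have := cell_congr (hab i)
      simp only [cell_comp, cell_whiskerRight, he] at this
      simpa using this)) φ ψ h⟩, rfl⟩

/-- A 2-morphism into `T ∘ Tₙ ∘ G` with tangent components is a tangent 2-morphism. -/
theorem exists_liftN_tangent {G H : Y ⟶ X} (φ : H.F ⟶ (G.F ≫ X.str.Tn n) ≫ X.str.T)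
    {B : Fin n → (Y ⟶ X)} (e : ∀ i, (G ≫ X.tangentN hn) ≫ X.tangent ⟶ B i)
    (he : ∀ i, cell (e i).φ = wl G.F (wr (cell (X.str.proj n i)) X.str.T))
    (ψ : ∀ i, H ⟶ B i) (h : ∀ i, φ ≫ (e i).φ = (ψ i).φ) :
    ∃ Φ : H ⟶ (G ≫ X.tangentN hn) ≫ X.tangent, Φ.φ = φ :=
  ⟨⟨φ, TwoMor.comm_of_jointMono e (fun {C a b} hab => cell_inj (X.str.jointMono₂ hn G.F _ _
    (fun i => by simp) (fun i => by simp) fun i => by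
      have := cell_congr (hab i)
      simp only [cell_comp, cell_whiskerRight, he] at this
      simpa using this)) φ ψ h⟩, rfl⟩

/-- Equal 1-morphisms may be substituted in a tangent 2-morphism. -/
theorem exists_hom_of_eq {f f' g g' : Y ⟶ X} (a : f ⟶ g) (hf : f = f') (hg : g = g') :
    ∃ a' : f' ⟶ g', cell a'.φ = cell a.φ := by
  subst hf hg
  exact ⟨a, rfl⟩

/-- Both composites have a whiskered flip as distributive law, and their equality is exactly the
compatibility of `U` with `c`. -/
theorem tangent_comp_of_isStrict {U : Y ⟶ X} (h : LaxMor.IsStrict U) :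
    Y.tangent ≫ U = U ≫ X.tangent := by
  refine LaxMor.ext_cell h.T ?_
  have := cell_congr U.flip
  simp [h.cell_α] at this ⊢
  exact this

end Tng

/-! ### The universal property of the tangentad of vector fields -/

namespace VectorFieldsConstruction

variable {X : Tng K} (V : VectorFieldsConstruction X) {Y : Tng K}

omit [Strict K] in
theorem vectorField_ext {A B : VectorField Y X} (h : A.base = B.base)
    (h' : cell A.field.vec.φ = cell B.field.vec.φ) : A = B := by
  obtain ⟨G, u, _⟩ := A
  obtain ⟨G', u', _⟩ := B
  obtain rfl : G = G' := h
  obtain rfl : u = u' := TwoMor.ext (cell_inj h')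
  rfl

theorem classified_injective {H H' : Y ⟶ V.VF} (h : V.classified H = V.classified H') : H = H' := by
  obtain ⟨Λ, h1, -⟩ := V.invertible Y
  rw [← Functor.id_obj H, ← Functor.id_obj H', ← h1]
  exact congrArg Λ.obj h

omit [Strict K] in
theorem exists_classified (A : VectorField Y X) : ∃ H, V.classified H = A := by
  obtain ⟨Λ, -, h2⟩ := V.invertible Y
  exact ⟨Λ.obj A, Functor.congr_obj h2 A⟩

@[simp] theorem cell_classified_vec (H : Y ⟶ V.VF) :
    cell (V.classified H).field.vec.φ = wl H.F (cell V.univ.vec.φ) := by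
  have h : ∀ v : V.U.F ⟶ V.U.F ≫ X.str.T,
      cell (H.F ◁ v ≫ (α_ H.F V.U.F X.str.T).inv) = wl H.F (cell v) := fun v => by simp
  exact h _

/-- Injectivity of `Γ` on objects, with the comparison of vector fields on different bases expressed
through cells. `hom₂_ext` and `exists_hom₂` are its faithfulness and fullness. -/
theorem hom_ext {H H' : Y ⟶ V.VF} (h : H ≫ V.U = H' ≫ V.U)
    (h' : wl H.F (cell V.univ.vec.φ) = wl H'.F (cell V.univ.vec.φ)) : H = H' :=
  V.classified_injective (vectorField_ext h (by rw [cell_classified_vec, cell_classified_vec, h']))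

theorem hom₂_ext {H H' : Y ⟶ V.VF} {a b : H ⟶ H'}
    (h : wr (cell a.φ) V.U.F = wr (cell b.φ) V.U.F) : a = b := by
  obtain ⟨Λ, h1, -⟩ := V.invertible Y
  have hab : (inducedFunctor V.U V.univ Y).map a = (inducedFunctor V.U V.univ Y).map b :=
    VectorField.Hom.ext (TwoMor.ext (cell_inj h))
  have ha := Functor.congr_hom h1 a
  have hb := Functor.congr_hom h1 b
  -- The equality of functors determines `a` and `b` up to the same transports on both sides, which
  -- are invertible and cancel.
  rw [Functor.comp_map] at ha hb
  rw [hab, hb, cancel_epi, cancel_mono] at ha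
  exact ha.symm

theorem exists_hom₂ {H H' : Y ⟶ V.VF} (ψ : H ≫ V.U ⟶ H' ≫ V.U)
    (h : (wl H.F (cell V.univ.vec.φ)).comp (wr (cell ψ.φ) X.str.T) (by simp) =
      (cell ψ.φ).comp (wl H'.F (cell V.univ.vec.φ)) (by simp)) :
    ∃ a : H ⟶ H', a ▷ V.U = ψ := by
  obtain ⟨Λ, h1, h2⟩ := V.invertible Y
  let Γ := inducedFunctor V.U V.univ Y
  let Ψ : Γ.obj H ⟶ Γ.obj H' := ⟨ψ, TwoMor.ext (cell_inj (by
    have e1 := V.cell_classified_vec H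
    have e2 := V.cell_classified_vec H'
    exact (cell_comp _ _).trans ((comp_congr e1 rfl).trans (h.trans
      ((comp_congr rfl e2).symm.trans (cell_comp _ _).symm)))))⟩
  let E : (Y ⟶ V.VF) ≌ VectorField Y X :=
    CategoryTheory.Equivalence.mk Γ Λ (eqToIso h1.symm) (eqToIso h2)
  have : Γ.Full := inferInstanceAs E.functor.Full
  exact ⟨Γ.preimage Ψ, congrArg VectorField.Hom.hom (Γ.map_preimage Ψ)⟩

end VectorFieldsConstruction

end Tangentads

/-! ### Strict tangent morphisms and the fibre powers on the tangentad of vector fields -/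

namespace Tangentads

variable {K : Type u} [Bicategory.{w, v} K] [Strict K]

open Cell

namespace LaxMor.IsStrict

variable {X Y : Tng K} {f : X ⟶ Y} (h : LaxMor.IsStrict f)
include h

theorem cell_p : wr (cell X.str.p) f.F = wl f.F (cell Y.str.p) := by
  have := cell_congr f.additive.proj
  simp [h.cell_α] at this
  exact this.symm

theorem cell_z : wr (cell X.str.z) f.F = wl f.F (cell Y.str.z) := by
  have := cell_congr f.additive.zero
  simpa [h.cell_α] using this

theorem cell_l : wr (cell X.str.l) f.F = wl f.F (cell Y.str.l) := by
  have := cell_congr f.lift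
  simpa [h.cell_α] using this

theorem cell_c : wr (cell X.str.c) f.F = wl f.F (cell Y.str.c) := by
  have := cell_congr f.flip
  simpa [h.cell_α] using this

/-- Strictness fixes `T` but not the chosen fibre powers, so between the latter there is only a
comparison `g` compatible with projections and sum. -/
theorem exists_pair : ∃ g : X.str.Tn 2 ≫ f.F ⟶ f.F ≫ Y.str.Tn 2,
    (∀ i, (cell g).comp (wl f.F (cell (Y.str.proj 2 i))) rfl = wr (cell (X.str.proj 2 i)) f.F) ∧
      (cell g).comp (wl f.F (cell Y.str.s)) rfl = wr (cell X.str.s) f.F := by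
  obtain ⟨g, h1, h2⟩ := f.additive.sum
  refine ⟨g, fun i => ?_, ?_⟩
  · have := cell_congr (h1 i)
    simp [h.cell_α] at this
    exact this
  · have := cell_congr h2
    simp [h.cell_α] at this
    exact this

end LaxMor.IsStrict

namespace VectorFieldsConstruction

variable {X : Tng K} (V : VectorFieldsConstruction X)

omit [Strict K] in
theorem univ_tgt : (cell V.univ.vec.φ).tgt = (wl V.U.F (cell X.str.p)).src := rfl

theorem cell_section_proj :
    (cell V.univ.vec.φ).comp (wl V.U.F (cell X.str.p)) V.univ_tgt = one V.U.F := by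
  have h : ∀ v : V.U.F ⟶ V.U.F ≫ X.str.T, v ≫ V.U.F ◁ X.str.p ≫ (ρ_ V.U.F).hom = 𝟙 V.U.F →
      (cell v).comp (wl V.U.F (cell X.str.p)) rfl = one V.U.F := fun v hv => by
    simpa using cell_congr hv
  exact h _ (congrArg TwoMor.φ V.univ.section_proj)

/-- The fibre powers of the tangent bundle lift to the tangentad of vector fields. -/
theorem exists_fibrePower {n : ℕ} (hn : 0 < n) :
    ∃ (H : V.VF ⟶ V.VF) (q : ∀ _ : Fin n, H ⟶ V.VF.tangent), H ≫ V.U = V.U ≫ X.tangentN hn ∧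
      ∀ i, wr (cell (q i).φ) V.U.F = wl V.U.F (cell (X.str.proj n i)) := by
  have hU := Tng.tangent_comp_of_isStrict V.isStrict
  have hUF : V.VF.str.T ≫ V.U.F = V.U.F ≫ X.str.T := V.isStrict.T
  have hUF' : ∀ {W : K} (k : X.obj ⟶ W), V.VF.str.T ≫ V.U.F ≫ k = V.U.F ≫ X.str.T ≫ k :=
    fun k => by rw [← Strict.assoc, hUF, Strict.assoc]
  -- The universal field evaluated at the tangent bundle of `V.VF`: a vector field on `T ∘ U`, to be
  -- used on each factor of `Tₙ ∘ U`.
  obtain ⟨v', hv'⟩ := Tng.exists_hom_of_eq (V.VF.tangent ◁ V.univ.vec) hU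
    (show _ = (V.U ≫ X.tangent) ≫ X.tangent by rw [← Strict.assoc, hU])
  replace hv' : cell v'.φ = wl V.VF.str.T (cell V.univ.vec.φ) := hv'
  have hc : ∀ i, (wl V.U.F (cell (X.str.proj n i))).tgt =
      (wl V.VF.str.T (cell V.univ.vec.φ)).src := fun i => hUF.symm
  have : ∀ i, ∃ f : V.U.F ≫ X.str.Tn n ⟶ V.U.F ≫ X.str.T ≫ X.str.T,
      cell f = (wl V.U.F (cell (X.str.proj n i))).comp (wl V.VF.str.T (cell V.univ.vec.φ))
        (hc i) := fun i => by
    obtain ⟨f, hf⟩ := ((wl V.U.F (cell (X.str.proj n i))).comp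
      (wl V.VF.str.T (cell V.univ.vec.φ)) (hc i)).exists_hom
      (f := V.U.F ≫ X.str.Tn n) (g := V.U.F ≫ X.str.T ≫ X.str.T) (by simp) (by simp [hUF'])
    exact ⟨f, hf⟩
  choose f hf using this
  -- Naturality of `p`: the field `v'` followed by `T p` is `p` followed by `v̂`. Hence the fields
  -- on the factors of `Tₙ ∘ U` agree over the base and combine into one map to `T ∘ Tₙ ∘ U`, as `T`
  -- preserves the fibre power.
  have e1 := exchange (cell V.VF.str.p) (cell V.univ.vec.φ)
  simp [wr_comp_of_eq V.isStrict.cell_p, V.isStrict.cell_p] at e1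
  obtain ⟨φ, hφ⟩ := (X.str.isNFoldPullback₁ hn V.U.F).exists_lift f fun i j => cell_inj (by
    have := congrArg (wl V.U.F)
      (cell_congr ((X.str.additive.isNFoldPullback n hn).comm i j))
    simp at this
    simp [hf, e1]
    simp only [reassoc this, comp_assoc])
  obtain ⟨φ', hφ'⟩ := (cell φ).exists_hom (f := V.U.F ≫ X.str.Tn n)
    (g := (V.U.F ≫ X.str.Tn n) ≫ X.str.T) rfl (by simp)
  have hφt : ∀ i, (cell φ').tgt = (wl V.U.F (wr (cell (X.str.proj n i)) X.str.T)).src :=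
    fun i => by simp
  have hφi : ∀ i, (cell φ').comp _ (hφt i) =
      (wl V.U.F (cell (X.str.proj n i))).comp (wl V.VF.str.T (cell V.univ.vec.φ)) (hc i) := fun i => by
    have := cell_congr (hφ i)
    rw [cell_comp, hf] at this
    simp only [hφ']
    exact this
  have e3 := congrArg (wl V.VF.str.T) V.cell_section_proj
  simp [hUF] at e3
  have hs : φ' ≫ (V.U.F ≫ X.str.Tn n) ◁ X.str.p ≫ (ρ_ (V.U.F ≫ X.str.Tn n)).hom = 𝟙 (V.U.F ≫ X.str.Tn n) := by
    refine cell_inj (X.str.jointMono₀ hn V.U.F _ _ (fun i => by simp) (fun i => rfl)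
      fun i => ?_)
    have e2 := congrArg (wl V.U.F) (cell_congr (X.exchange_proj i X.str.p))
    simp at e2 ⊢
    simp only [e2, reassoc (hφi i), comp_assoc, e3, comp_one]
  obtain ⟨Φ, rfl⟩ := Tng.exists_liftN_tangent hn (G := V.U) (H := V.U ≫ X.tangentN hn) φ'
    (fun i => (V.U ◁ X.projN hn i) ▷ X.tangent) (fun i => wr_wl V.U.F (cell (X.str.proj n i)) X.str.T)
    (fun i => (V.U ◁ X.projN hn i) ≫ v') (fun i => cell_inj ((cell_comp _ _).trans
      ((comp_congr rfl (wr_wl V.U.F (cell (X.str.proj n i)) X.str.T)).trans ((hφi i).trans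
        ((comp_congr rfl hv').symm.trans (cell_comp _ _).symm)))))
  obtain ⟨H, hH⟩ := V.exists_classified ⟨V.U ≫ X.tangentN hn, Φ, TwoMor.ext hs⟩
  have hHU : H ≫ V.U = V.U ≫ X.tangentN hn := congrArg VectorField.base hH
  have hHF : H.F ≫ V.U.F = V.U.F ≫ X.str.Tn n := congrArg LaxMor.F hHU
  have hHv : wl H.F (cell V.univ.vec.φ) = cell Φ.φ := by
    rw [← cell_classified_vec, hH]
  have hψ : ∀ i, ∃ ψ : H ≫ V.U ⟶ V.VF.tangent ≫ V.U,
      cell ψ.φ = wl V.U.F (cell (X.str.proj n i)) := fun i =>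
    Tng.exists_hom_of_eq (V.U ◁ X.projN hn i) hHU.symm hU.symm
  choose ψ hψ using hψ
  -- By the construction of the field on `Tₙ ∘ U`, its projections are morphisms of vector fields,
  -- so they lift along `U`.
  have : ∀ i, ∃ q : H ⟶ V.VF.tangent, q ▷ V.U = ψ i := fun i => V.exists_hom₂ (ψ i) (by
    simp only [hHv, hψ, wr_wl]
    exact hφi i)
  choose q hq using this
  refine ⟨H, q, hHU, fun i => ?_⟩
  rw [← hψ, ← hq]
  rfl

end VectorFieldsConstruction

end Tangentads

namespace Tangentads

variable {K : Type u} [Bicategory.{w, v} K] [Strict K]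

open Cell

namespace VectorFieldsConstruction

variable {X : Tng K} (V : VectorFieldsConstruction X)

/-- The fibre powers of the tangent bundle of the tangentad of vector fields can be chosen to be
strictly preserved by the forgetful 1-morphism. -/
theorem exists_iso_fibrePower {n : ℕ} (hn : 0 < n) :
    ∃ (Q : V.VF.obj ⟶ V.VF.obj) (e : Q ≅ V.VF.str.Tn n), Q ≫ V.U.F = V.U.F ≫ X.str.Tn n ∧
      ∀ i, wr (cell (e.hom ≫ V.VF.str.proj n i)) V.U.F = wl V.U.F (cell (X.str.proj n i)) := by
  obtain ⟨H, q, hHU, hq⟩ := V.exists_fibrePower hn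
  have hU := Tng.tangent_comp_of_isStrict V.isStrict
  have hUF : V.VF.str.T ≫ V.U.F = V.U.F ≫ X.str.T := V.isStrict.T
  have hHF : H.F ≫ V.U.F = V.U.F ≫ X.str.Tn n := congrArg LaxMor.F hHU
  have hpX := (X.str.additive.isNFoldPullback n hn).comm
  have hpZ := (V.VF.str.additive.isNFoldPullback n hn).comm
  -- the comparison to the fibre power
  have hqp : ∀ i j, q i ≫ V.VF.proj = q j ≫ V.VF.proj := fun i j => V.hom₂_ext (by
    have h : ∀ i, wr (cell (TwoMor.φ (q i ≫ V.VF.proj))) V.U.F =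
        wl V.U.F (cell (X.str.proj n i ≫ X.str.p)) := fun i => by
      rw [cell_comp, wl_comp]
      exact (congrArg (wr · V.U.F) (cell_comp _ _)).trans ((wr_comp _ _ _ _).trans
        (comp_congr (hq i) V.isStrict.cell_p))
    rw [h, h, hpX i j])
  obtain ⟨a, ha⟩ := (V.VF.str.additive.isNFoldPullback n hn).exists_lift (fun i => (q i).φ)
    fun i j => congrArg TwoMor.φ (hqp i j)
  have hmono : ∀ {C} {b b' : C ⟶ V.VF.str.Tn n ≫ V.VF.str.T},
      (∀ i, b ≫ V.VF.str.proj n i ▷ V.VF.str.T = b' ≫ V.VF.str.proj n i ▷ V.VF.str.T) →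
      b = b' := fun h =>
    cell_inj (V.VF.str.jointMono₁ hn (𝟙 _) _ _ (fun i => by simp) (fun i => by simp) fun i => by
      have := cell_congr (h i)
      simp only [cell_comp, cell_whiskerRight] at this
      simpa using this)
  obtain ⟨a, rfl⟩ : ∃ a' : H ⟶ V.VF.tangentN hn, a'.φ = a :=
    ⟨⟨a, TwoMor.comm_of_jointMono (V.VF.projN hn) (fun h => hmono h) a q ha⟩, rfl⟩
  have haq : ∀ i, a ≫ V.VF.projN hn i = q i := fun i => TwoMor.ext (ha i)
  -- its inverse
  have : ∀ i, ∃ f : V.VF.str.Tn n ≫ V.U.F ⟶ V.U.F ≫ X.str.T,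
      cell f = wr (cell (V.VF.str.proj n i)) V.U.F := fun i =>
    (wr (cell (V.VF.str.proj n i)) V.U.F).exists_hom rfl hUF
  choose f hf using this
  obtain ⟨ψ, hψ⟩ := (X.str.isNFoldPullback₀ hn V.U.F).exists_lift f fun i j => cell_inj (by
    have h := fun i => wr_comp (cell (V.VF.str.proj n i)) (cell V.VF.str.p) rfl V.U.F
    have h' := congrArg (wr · V.U.F) (cell_congr (hpZ i j))
    simp only [cell_comp, h] at h'
    simpa [hf, V.isStrict.cell_p] using h')
  have hψt : ∀ i, (cell ψ).tgt = (wl V.U.F (cell (X.str.proj n i))).src := fun i => rfl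
  have hψc : ∀ i, (cell ψ).comp _ (hψt i) = wr (cell (V.VF.str.proj n i)) V.U.F := fun i => by
    rw [← hf, ← hψ]
    simp
  have : ∀ i, ∃ g : V.VF.tangentN hn ≫ V.U ⟶ V.U ≫ X.tangent,
      cell g.φ = wr (cell (V.VF.str.proj n i)) V.U.F := fun i =>
    Tng.exists_hom_of_eq (V.VF.projN hn i ▷ V.U) rfl hU
  choose g hg using this
  -- The comparison `ψ` is a morphism of vector fields. It is tested on the factors, where both
  -- sides reduce, by interchange with the projections and with `q`, to the field `v̂_T`.
  have hcond : ∀ h1 h2, (wl (V.VF.str.Tn n) (cell V.univ.vec.φ)).comp (wr (cell ψ) X.str.T) h1 =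
      (cell ψ).comp (wl H.F (cell V.univ.vec.φ)) h2 := fun h1 h2 => by
    have t1 : ∀ i, ((wl (V.VF.str.Tn n) (cell V.univ.vec.φ)).comp (wr (cell ψ) X.str.T) h1).tgt =
        (wl V.U.F (wr (cell (X.str.proj n i)) X.str.T)).src := fun i => by simp
    have t2 : ∀ i, ((cell ψ).comp (wl H.F (cell V.univ.vec.φ)) h2).tgt =
        (wl V.U.F (wr (cell (X.str.proj n i)) X.str.T)).src := fun i => by
      have := congrArg (· ≫ X.str.T) hHF
      simpa using this
    refine X.str.jointMono₁ hn V.U.F _ _ t1 t2 fun i => ?_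
    have e1 := congrArg (wr · X.str.T) (hψc i)
    have e2 := exchange (cell (V.VF.str.proj n i)) (cell V.univ.vec.φ)
    have e3 := exchange (cell (q i).φ) (cell V.univ.vec.φ)
    have e4 := wr_comp_of_eq (hq i) X.str.T
    simp [e4, hq] at e1 e2 e3 ⊢
    simp only [e1, e2, e3]
    exact (reassoc (hψc i) _ _).symm
  obtain ⟨Ψ, hΨ⟩ := Tng.exists_liftN hn (G := V.U) (H := V.VF.tangentN hn ≫ V.U) ψ
    (fun i => V.U ◁ X.projN hn i) (fun i => rfl) g (fun i => cell_inj (by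
      rw [hg, ← hψc]
      exact cell_comp _ _))
  obtain ⟨Ψ', hΨ'⟩ := Tng.exists_hom_of_eq Ψ rfl hHU.symm
  obtain ⟨b, hb⟩ := V.exists_hom₂ Ψ' (by
    simp only [hΨ', hΨ]
    exact hcond _ _)
  replace hb : wr (cell b.φ) V.U.F = cell ψ := by
    have h : wr (cell b.φ) V.U.F = cell Ψ'.φ := by
      rw [← hb]
      rfl
    exact h.trans (hΨ'.trans (congrArg cell hΨ))
  have hbq : ∀ i, b ≫ q i = V.VF.projN hn i := fun i => V.hom₂_ext
    ((congrArg (wr · V.U.F) (cell_comp _ _)).trans ((wr_comp _ _ _ _).trans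
      ((comp_congr hb (hq i)).trans (hψc i))))
  have hba : b.φ ≫ a.φ = 𝟙 (V.VF.str.Tn n) :=
    (V.VF.str.additive.isNFoldPullback n hn).hom_ext fun i => by
      have := congrArg TwoMor.φ (hbq i)
      rw [← haq i] at this
      exact (Category.assoc _ _ _).trans (this.trans (Category.id_comp _).symm)
  have key : ∀ (a' : H.F ⟶ V.VF.str.Tn n) (b' : V.VF.str.Tn n ⟶ H.F),
      (∀ i, wr (cell (a' ≫ V.VF.str.proj n i)) V.U.F = wl V.U.F (cell (X.str.proj n i))) →
      wr (cell b') V.U.F = cell ψ → wr (cell (a' ≫ b')) V.U.F = wr (cell (𝟙 H.F)) V.U.F :=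
    fun a' b' h1 h2 => by
      refine X.str.jointMono₀ hn V.U.F _ _ (fun i => hHF) (fun i => hHF) fun i => ?_
      have h1 := h1 i
      rw [cell_comp, wr_comp] at h1
      simp only [cell_comp, cell_id, wr_comp, h2, comp_assoc, hψc, h1, wr_one, one_comp]
  have hq' : ∀ i, wr (cell (a.φ ≫ V.VF.str.proj n i)) V.U.F = wl V.U.F (cell (X.str.proj n i)) :=
    fun i => (congrArg (wr · V.U.F) (cell_congr (congrArg TwoMor.φ (haq i)))).trans (hq i)
  have hab : a ≫ b = 𝟙 H := V.hom₂_ext (key a.φ b.φ hq' hb)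
  refine ⟨H.F, ⟨a.φ, b.φ, congrArg TwoMor.φ hab, hba⟩, hHF, hq'⟩

end VectorFieldsConstruction

end Tangentads

/-! ### Independence of the chosen pullbacks -/

namespace Tangentads

section Category

variable {C : Type u} [Category.{v} C]

theorem IsNFoldPullback.of_iso {E B P D : C} {q : E ⟶ B} {n : ℕ} {π : Fin n → (P ⟶ E)}
    (H : IsNFoldPullback q π) (e : D ≅ P) {ρ : Fin n → (D ⟶ E)} (hρ : ∀ i, ρ i = e.hom ≫ π i) :
    IsNFoldPullback q ρ where
  comm i j := by simp only [hρ, Category.assoc, H.comm i j]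
  existsUnique_lift f hf := by
    obtain ⟨h, h1, h2⟩ := H.existsUnique_lift f hf
    refine ⟨h ≫ e.inv, fun i => by simp [hρ, h1], fun y hy => ?_⟩
    rw [← h2 (y ≫ e.hom) (fun i => by simpa [hρ] using hy i)]
    simp

theorem isAdd_iff_of_iso {E E₂ D Y : C} {π : Fin 2 → (E₂ ⟶ E)} {s : E₂ ⟶ E} (e : D ≅ E₂)
    {a b c : Y ⟶ E} :
    IsAdd (fun i => e.hom ≫ π i) (e.hom ≫ s) a b c ↔ IsAdd π s a b c := by
  constructor
  · rintro ⟨h, ⟨h0, h1⟩, h2⟩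
    exact ⟨h ≫ e.hom, ⟨by simpa using h0, by simpa using h1⟩, by simpa using h2⟩
  · rintro ⟨h, ⟨h0, h1⟩, h2⟩
    exact ⟨h ≫ e.inv, ⟨by simpa using h0, by simpa using h1⟩, by simpa using h2⟩

theorem IsAdditiveBundle.of_iso {E B : C} {q : E ⟶ B} {En : ℕ → C} {π : ∀ n, Fin n → (En n ⟶ E)}
    {z : B ⟶ E} {s : En 2 ⟶ E} (H : IsAdditiveBundle q π z s) {D : ℕ → C} (e : ∀ n, D n ≅ En n) :
    IsAdditiveBundle q (En := D) (fun n i => (e n).hom ≫ π n i) z ((e 2).hom ≫ s) :=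
  .of_isAdd (fun n hn => (H.isNFoldPullback n hn).of_iso (e n) fun i => rfl) H.zero_proj
    (by simp only [Category.assoc, H.sum_proj])
    (fun hab hbc hx hy => by
      rw [isAdd_iff_of_iso] at hab hbc hx hy
      exact H.isAdd_assoc hab hbc hx hy)
    (fun h => by
      rw [isAdd_iff_of_iso] at h
      exact H.isAdd_unit h)
    (fun h h' => by
      rw [isAdd_iff_of_iso] at h h'
      exact (H.isNFoldPullback 2 two_pos).isAdd_unique (H.isAdd_comm h) h')

theorem IsAdditiveBundleHom.of_iso {E B E₂ E' B' E₂' D D' : C}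
    {q : E ⟶ B} {z : B ⟶ E} {π : Fin 2 → (E₂ ⟶ E)} {s : E₂ ⟶ E}
    {q' : E' ⟶ B'} {z' : B' ⟶ E'} {π' : Fin 2 → (E₂' ⟶ E')} {s' : E₂' ⟶ E'}
    {f : B ⟶ B'} {g : E ⟶ E'} (H : IsAdditiveBundleHom q z π s q' z' π' s' f g)
    (e : D ≅ E₂) (e' : D' ≅ E₂') {ρ : Fin 2 → (D ⟶ E)} {t : D ⟶ E} {ρ' : Fin 2 → (D' ⟶ E')}
    {t' : D' ⟶ E'} (hρ : ∀ i, ρ i = e.hom ≫ π i) (ht : t = e.hom ≫ s)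
    (hρ' : ∀ i, ρ' i = e'.hom ≫ π' i) (ht' : t' = e'.hom ≫ s') :
    IsAdditiveBundleHom q z ρ t q' z' ρ' t' f g where
  proj := H.proj
  zero := H.zero
  sum := by
    obtain ⟨g₂, h1, h2⟩ := H.sum
    refine ⟨e.hom ≫ g₂ ≫ e'.inv, fun i => ?_, ?_⟩
    · simp [hρ, hρ', h1]
    · simp [ht, ht', h2]

end Category

variable {K : Type u} [Bicategory.{w, v} K]

/-- Replace the chosen pullbacks of a tangent structure by isomorphic ones. -/
def TangentStructure.replace {X : K} (S : TangentStructure X) (Q : ℕ → (X ⟶ X))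
    (e : ∀ n, Q n ≅ S.Tn n) : TangentStructure X where
  T := S.T
  p := S.p
  Tn := Q
  proj n i := (e n).hom ≫ S.proj n i
  z := S.z
  s := (e 2).hom ≫ S.s
  l := S.l
  c := S.c
  additive := S.additive.of_iso e
  isNFoldPullback n hn _ F k := (S.isNFoldPullback n hn F k).of_iso
    (whiskerLeftIso F (whiskerRightIso (e n) (iter S.T k))) fun i => by simp
  lift_additive := S.lift_additive.of_iso (e 2) (whiskerRightIso (e 2) S.T) (fun i => rfl) rfl
    (fun i => by simp) (by simp)
  flip_additive := S.flip_additive.of_iso (whiskerRightIso (e 2) S.T) (whiskerLeftIso S.T (e 2))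
    (fun i => by simp) (by simp) (fun i => by simp) (by simp)
  lift_coassoc := S.lift_coassoc
  lift_flip := S.lift_flip
  flip_lift := S.flip_lift
  flip_flip := S.flip_flip
  flip_braid := S.flip_braid
  locally_linear := by
    obtain ⟨m, h0, h1, h2⟩ := S.locally_linear
    refine ⟨(e 2).hom ≫ m ≫ (e 2).inv ▷ S.T, ?_, ?_, fun F => ?_⟩
    · simp [h0]
    · simp [h1]
    · refine (h2 F).of_iso (whiskerLeftIso F (e 2).symm) (Iso.refl _) (Iso.refl _) (Iso.refl _)
        ?_ ?_ ?_ ?_ <;> simp [← whiskerLeft_comp]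

variable [Strict K]

open Cell

namespace VectorFieldsConstruction

variable {X : Tng K} (V : VectorFieldsConstruction X)

/-- The fibre powers of the tangent bundle of the tangentad of vector fields can be chosen so that
the forgetful 1-morphism strictly preserves the tangent structure. -/
theorem exists_replace_strictMap : ∃ (Q : ℕ → (V.VF.obj ⟶ V.VF.obj))
    (e : ∀ n, Q n ≅ V.VF.str.Tn n), StrictMap (V.VF.str.replace Q e) X.str V.U.F := by
  have : ∀ n, ∃ (Q : V.VF.obj ⟶ V.VF.obj) (e : Q ≅ V.VF.str.Tn n),
      0 < n → Q ≫ V.U.F = V.U.F ≫ X.str.Tn n ∧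
      ∀ i, wr (cell (e.hom ≫ V.VF.str.proj n i)) V.U.F = wl V.U.F (cell (X.str.proj n i)) := by
    intro n
    rcases n.eq_zero_or_pos with rfl | hn
    · exact ⟨_, Iso.refl _, fun h => absurd h (lt_irrefl _)⟩
    · obtain ⟨Q, e, h⟩ := V.exists_iso_fibrePower hn
      exact ⟨Q, e, fun _ => h⟩
  choose Q e h using this
  refine ⟨Q, e, V.isStrict.T, fun n hn => (h n hn).1, V.isStrict.cell_p,
    fun n i => (h n i.pos).2 i, V.isStrict.cell_z, ?_, V.isStrict.cell_l, V.isStrict.cell_c⟩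
  obtain ⟨g, hg, hs⟩ := V.isStrict.exists_pair
  -- With the new fibre power the comparison `g` becomes an identity, as seen on the projections;
  -- this is what makes the sum strictly preserved.
  have key : (wr (cell (e 2).hom) V.U.F).comp (cell g) rfl = one (V.U.F ≫ X.str.Tn 2) := by
    refine X.str.jointMono₀ two_pos V.U.F _ _ (fun i => rfl) (fun i => rfl) fun i => ?_
    have := (h 2 two_pos).2 i
    rw [cell_comp, wr_comp] at this
    exact (comp_assoc _ _ _ _ _).trans ((comp_congr rfl (hg i)).trans
      (this.trans (one_comp _ _ _).symm))
  change wr (cell ((e 2).hom ≫ V.VF.str.s)) V.U.F = _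
  rw [cell_comp, wr_comp]
  exact (comp_congr rfl hs.symm).trans ((comp_assoc _ _ _ _ rfl).symm.trans
    ((comp_congr key rfl).trans (one_comp _ _ _)))

end VectorFieldsConstruction

end Tangentads

/-! ### Lax and strict tangent morphisms built from cells -/

namespace Tangentads

variable {K : Type u} [Bicategory.{w, v} K] [Strict K]

open Cell

theorem TangentStructure.AddCell.of_replace {X Y W : K} {S : TangentStructure X}
    {Q : ℕ → (X ⟶ X)} {e : ∀ n, Q n ≅ S.Tn n} {F : Y ⟶ X} {g : X ⟶ W} {a b c : Cell Y W}
    (H : (S.replace Q e).AddCell F g a b c) : S.AddCell F g a b c := by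
  obtain ⟨A, h, rfl, rfl, rfl⟩ := H
  have aux : ∀ (h : A ⟶ F ≫ Q 2 ≫ g) (σ : S.Tn 2 ⟶ S.T), cell ((h ≫ F ◁ ((e 2).hom ▷ g)) ≫ F ◁ (σ ▷ g)) =
      cell (h ≫ F ◁ (((e 2).hom ≫ σ) ▷ g)) := fun h σ => congrArg cell (by
    rw [comp_whiskerRight, whiskerLeft_comp, Category.assoc])
  exact ⟨A, h ≫ F ◁ ((e 2).hom ▷ g), aux h _, aux h _, aux h _⟩

theorem TangentStructure.addCell_proj {X : K} (S : TangentStructure X) :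
    S.AddCell (𝟙 X) (𝟙 X) (cell (S.proj 2 0)) (cell (S.proj 2 1)) (cell S.s) :=
  (addCell_iff_isAdd (π := S.proj 2) (by simp) (by simp) _ _ _).2
    ⟨𝟙 _, ⟨Category.id_comp _, Category.id_comp _⟩, Category.id_comp _⟩

namespace LaxMor

variable {X Y : Tng K}

section

variable {F : X.obj ⟶ Y.obj} {α : X.str.T ≫ F ⟶ F ≫ Y.str.T}

theorem sum_iff_addCell :
    (∃ g₂ : X.str.Tn 2 ≫ F ⟶ F ≫ Y.str.Tn 2,
      (∀ i, g₂ ≫ F ◁ Y.str.proj 2 i = X.str.proj 2 i ▷ F ≫ α) ∧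
        g₂ ≫ F ◁ Y.str.s = X.str.s ▷ F ≫ α) ↔
      Y.str.AddCell F (𝟙 _) (cell (X.str.proj 2 0 ▷ F ≫ α)) (cell (X.str.proj 2 1 ▷ F ≫ α))
        (cell (X.str.s ▷ F ≫ α)) := by
  rw [TangentStructure.addCell_id_iff]
  exact (isAdd_iff_exists (π := fun i => X.str.proj 2 i ▷ F) (s := X.str.s ▷ F)
    (π' := fun i => F ◁ Y.str.proj 2 i)).symm

/-- The laws are quantified over the proofs that endpoints match, so that each can be established by
testing cells on the projections of a 2-pullback. -/
theorem exists_of_cells (hp : ∀ h, (cell α).comp (wl F (cell Y.str.p)) h = wr (cell X.str.p) F)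
    (hz : ∀ h, (wr (cell X.str.z) F).comp (cell α) h = wl F (cell Y.str.z))
    (hs : ∀ h₀ h₁ h₂, Y.str.AddCell F (𝟙 _) ((wr (cell (X.str.proj 2 0)) F).comp (cell α) h₀)
      ((wr (cell (X.str.proj 2 1)) F).comp (cell α) h₁) ((wr (cell X.str.s) F).comp (cell α) h₂))
    (hl : ∀ h h', (wr (cell X.str.l) F).comp (cell (double α)) h =
      (cell α).comp (wl F (cell Y.str.l)) h')
    (hc : ∀ h h', (wr (cell X.str.c) F).comp (cell (double α)) h =
      (cell (double α)).comp (wl F (cell Y.str.c)) h') :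
    ∃ f : X ⟶ Y, f.F = F ∧ cell f.α = cell α :=
  ⟨{  F := F
      α := α
      additive :=
        { proj := cell_inj (by simpa using hp rfl)
          zero := cell_inj (by simpa using hz rfl)
          sum := sum_iff_addCell.2 (by simpa using hs rfl rfl rfl) }
      lift := cell_inj (by simpa using hl rfl rfl)
      flip := cell_inj (by simpa using hc rfl rfl) }, rfl, rfl⟩

end

variable (f : X ⟶ Y)

theorem comp_cell_p (h : (cell f.α).tgt = (wl f.F (cell Y.str.p)).src) :
    (cell f.α).comp (wl f.F (cell Y.str.p)) h = wr (cell X.str.p) f.F := by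
  simpa using cell_congr f.additive.proj

theorem cell_z_comp (h : (wr (cell X.str.z) f.F).tgt = (cell f.α).src) :
    (wr (cell X.str.z) f.F).comp (cell f.α) h = wl f.F (cell Y.str.z) := by
  simpa using cell_congr f.additive.zero

theorem addCell_α (h₀ : (wr (cell (X.str.proj 2 0)) f.F).tgt = (cell f.α).src)
    (h₁ : (wr (cell (X.str.proj 2 1)) f.F).tgt = (cell f.α).src)
    (h₂ : (wr (cell X.str.s) f.F).tgt = (cell f.α).src) :
    Y.str.AddCell f.F (𝟙 _) ((wr (cell (X.str.proj 2 0)) f.F).comp (cell f.α) h₀)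
      ((wr (cell (X.str.proj 2 1)) f.F).comp (cell f.α) h₁)
      ((wr (cell X.str.s) f.F).comp (cell f.α) h₂) := by
  simpa using sum_iff_addCell.1 f.additive.sum

theorem cell_l_comp (h : (wr (cell X.str.l) f.F).tgt = (cell (double f.α)).src)
    (h' : (cell f.α).tgt = (wl f.F (cell Y.str.l)).src) :
    (wr (cell X.str.l) f.F).comp (cell (double f.α)) h =
      (cell f.α).comp (wl f.F (cell Y.str.l)) h' := by
  simpa using cell_congr f.lift

theorem cell_c_comp (h : (wr (cell X.str.c) f.F).tgt = (cell (double f.α)).src)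
    (h' : (cell (double f.α)).tgt = (wl f.F (cell Y.str.c)).src) :
    (wr (cell X.str.c) f.F).comp (cell (double f.α)) h =
      (cell (double f.α)).comp (wl f.F (cell Y.str.c)) h' := by
  simpa using cell_congr f.flip

variable {f}

theorem IsStrict.addCell (hf : LaxMor.IsStrict f) {W : K} {G : W ⟶ X.obj} {a b c : Cell W X.obj}
    (h : X.str.AddCell G (𝟙 _) a b c) :
    Y.str.AddCell (G ≫ f.F) (𝟙 _) (wr a f.F) (wr b f.F) (wr c f.F) := by
  obtain ⟨g, h0, hs⟩ := hf.exists_pair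
  obtain ⟨A, t, rfl, rfl, rfl⟩ := h
  have ht : (wr (cell t) f.F).tgt = (wl G (cell g)).src := by simp
  obtain ⟨t', e⟩ := ((wr (cell t) f.F).comp (wl G (cell g)) ht).exists_hom (f := A ≫ f.F)
    (g := (G ≫ f.F) ≫ Y.str.Tn 2 ≫ 𝟙 _) (by simp) (by simp)
  have h0' := fun i => (wl_comp _ _ _ _).symm.trans (congrArg (wl G) (h0 i))
  have hs' := (wl_comp _ _ _ _).symm.trans (congrArg (wl G) hs)
  simp only [wl_wl] at h0' hs'
  refine ⟨_, t', ?_, ?_, ?_⟩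
  · simp [e, h0']
  · simp [e, h0']
  · simp [e, hs']

end LaxMor

/-- A strict tangent morphism from a 1-morphism preserving the tangent structure, up to the choice
of the pullbacks. -/
theorem StrictMap.exists_isStrict {X Y : Tng K} {F : X.obj ⟶ Y.obj}
    {Q : ℕ → (Y.obj ⟶ Y.obj)} {e : ∀ n, Q n ≅ Y.str.Tn n}
    (H : StrictMap X.str (Y.str.replace Q e) F) :
    ∃ f : X ⟶ Y, f.F = F ∧ LaxMor.IsStrict f := by
  have hT : X.str.T ≫ F = F ≫ Y.str.T := H.T
  have hα : cell (eqToHom hT) = one (F ≫ Y.str.T) := by rw [cell_eqToHom, hT]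
  have hd : cell (double (eqToHom hT)) = one (F ≫ Y.str.T ≫ Y.str.T) := by
    simp [hα]
    rw [← Strict.assoc, hT, Strict.assoc]
  have hp : wr (cell X.str.p) F = wl F (cell Y.str.p) := H.p
  have hz : wr (cell X.str.z) F = wl F (cell Y.str.z) := H.z
  have hl : wr (cell X.str.l) F = wl F (cell Y.str.l) := H.l
  have hc : wr (cell X.str.c) F = wl F (cell Y.str.c) := H.c
  have hs : Y.str.AddCell F (𝟙 _) (wr (cell (X.str.proj 2 0)) F) (wr (cell (X.str.proj 2 1)) F)
      (wr (cell X.str.s) F) := by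
    simpa using (H.addCell (k := F) (g' := 𝟙 _) (by simp) X.str.addCell_proj).of_replace
  obtain ⟨f, rfl, h⟩ := LaxMor.exists_of_cells (X := X) (Y := Y) (F := F) (α := eqToHom hT)
    (fun _ => by simp [hα, hp]) (fun _ => by simp [hα, hz]) (fun _ _ _ => by simpa [hα] using hs)
    (fun _ _ => by simp only [hd, hα, hl, one_comp, comp_one])
    (fun _ _ => by simp only [hd, hc, one_comp, comp_one])
  exact ⟨f, rfl, LaxMor.isStrict_iff.2 ⟨_, h.trans hα⟩⟩

end Tangentads

/-! ### 2-pullbacks in the 2-category of tangentads -/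

namespace Tangentads

variable {K : Type u} [Bicategory.{w, v} K] [Strict K]

open Cell

namespace Tng

theorem cell_comp_α_of_isStrict {X Y Z : Tng K} (f : X ⟶ Y) {g : Y ⟶ Z} (hg : LaxMor.IsStrict g) :
    cell (LaxMor.α (f ≫ g)) = wr (cell f.α) g.F := by
  rw [cell_comp_α]
  simp [hg.cell_α]

/-- An `n`-fold 2-pullback of underlying 1-morphisms of strict tangent morphisms, with strict
projections, is an `n`-fold 2-pullback of tangentads. -/
theorem isNFoldTwoPullback {E B P : Tng K} {U : E ⟶ B} (hU : LaxMor.IsStrict U) {n : ℕ}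
    {π : Fin n → (P ⟶ E)} (hπ : ∀ i, LaxMor.IsStrict (π i))
    (hP : IsNFoldTwoPullback U.F (fun i => (π i).F)) : IsNFoldTwoPullback U π where
  comm i j := LaxMor.ext_cell (hP.comm i j) (by
    have e := hP.comm i j
    rw [(isStrict_comp (hπ i) hU).cell_α, (isStrict_comp (hπ j) hU).cell_α]
    simp only [comp_F, e])
  existsUnique_lift {Y} f hf := by
    have hF : ∀ i j, (f i).F ≫ U.F = (f j).F ≫ U.F := fun i j => congrArg LaxMor.F (hf i j)
    obtain ⟨F, hFi⟩ := hP.exists_lift (fun i => (f i).F) hF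
    -- As `U` is strict, the distributive law of `f i ≫ U` is that of `f i` whiskered with `U`, so
    -- equality of these composites is the condition for lifting.
    obtain ⟨a, ha⟩ := hP.exists_cell_lift (fun i => cell (f i).α) fun i j => by
      rw [← cell_comp_α_of_isStrict _ hU, ← cell_comp_α_of_isStrict _ hU, hf i j]
    obtain ⟨α, rfl⟩ := a.exists_hom (f := Y.str.T ≫ F) (g := F ≫ P.str.T)
      (hP.ext fun i => by
        have := src_eq_of_eq (ha i)
        simpa [hFi] using this)
      (hP.ext fun i => by
        have := tgt_eq_of_eq (ha i)
        rw [Strict.assoc, (hπ i).T, ← Strict.assoc, hFi]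
        exact this)
    have hd : ∀ i, wr (cell (double α)) (π i).F = cell (double (f i).α) := fun i => by
      have e1 := congrArg (wr · E.str.T) (ha i)
      have e2 := (hπ i).T
      simp at e1 ⊢
      simp [ha, e2, e1]
    have hp : ∀ h, (cell α).comp (wl F (cell P.str.p)) h = wr (cell Y.str.p) F := fun h =>
      hP.cell_ext fun i => by
        have := (f i).comp_cell_p rfl
        simpa [ha, hFi, (hπ i).cell_p] using this
    obtain ⟨g, rfl, hg⟩ := LaxMor.exists_of_cells (X := Y) (Y := P) (F := F) (α := α) hp
      (fun h => hP.cell_ext fun i => by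
        have := (f i).cell_z_comp rfl
        simpa [ha, hFi, (hπ i).cell_z] using this)
      (fun h₀ h₁ h₂ => by
        have hY := congrArg (wr · F)
          (cell_congr ((Y.str.additive.isNFoldPullback 2 two_pos).comm 0 1))
        simp at hY
        -- The sum exists in `P` because the two summands have the same projection along `p`; it is
        -- then identified on each factor, where `f i` is additive.
        obtain ⟨c, hc⟩ := P.str.exists_addCell (F := F) (g := 𝟙 _) (k := 0) rfl
          (a := (wr (cell (Y.str.proj 2 0)) F).comp (cell α) h₀)
          (b := (wr (cell (Y.str.proj 2 1)) F).comp (cell α) h₁) (by simp) (by simp) (by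
            simpa [hp] using hY)
        have : c = (wr (cell Y.str.s) F).comp (cell α) h₂ := hP.cell_ext fun i => by
          have h1 := (hπ i).addCell hc
          have h2 := (f i).addCell_α rfl rfl rfl
          simp [ha, hFi] at h1
          have := h1.unique (k := 0) rfl h2
          simpa [ha, hFi] using this
        rwa [this] at hc)
      (fun h h' => hP.cell_ext fun i => by
        have := (f i).cell_l_comp rfl rfl
        simp only [wr_comp, hd]
        simpa [ha, hd, hFi, (hπ i).cell_l] using this)
      (fun h h' => hP.cell_ext fun i => by
        have := (f i).cell_c_comp rfl rfl
        simp only [wr_comp, hd]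
        simpa [ha, hd, hFi, (hπ i).cell_c] using this)
    refine ⟨g, fun i => LaxMor.ext_cell (hFi i) ?_, fun h hh => ?_⟩
    · rw [cell_comp_α_of_isStrict _ (hπ i), ← ha, ← hg]
    · have hhF : h.F = g.F := hP.ext fun i => (congrArg LaxMor.F (hh i)).trans (hFi i).symm
      refine LaxMor.ext_cell hhF (hP.cell_ext fun i => ?_)
      rw [← cell_comp_α_of_isStrict _ (hπ i), hh, hg, ha]
  existsUnique_lift₂ {Y} h h' θ hθ := by
    -- Transports in tangentads have transports in `K` as underlying 2-morphisms, so the hypothesis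
    -- in tangentads gives the one in `K`.
    obtain ⟨Θ, hΘ, hu⟩ := hP.existsUnique_lift₂ h.F h'.F (fun i => (θ i).φ) fun i j =>
      (congrArg (_ ≫ ·) (eqToHom_φ _)).symm.trans ((congrArg TwoMor.φ (hθ i j)).trans
        (congrArg (· ≫ _) (eqToHom_φ _)))
    refine ⟨⟨Θ, cell_inj (hP.cell_ext fun i => ?_)⟩, fun i => TwoMor.ext (hΘ i), fun a ha =>
      TwoMor.ext (hu _ fun i => congrArg TwoMor.φ (ha i))⟩
    have := cell_congr (θ i).comm
    have e := cell_congr (hΘ i)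
    rw [cell_whiskerRight] at e
    have e1 := congrArg (wr · E.str.T) e
    simp [cell_comp_α_of_isStrict _ (hπ i)] at this e1 ⊢
    simp [(hπ i).T]
    simp only [e1, e]
    exact this

end Tng

end Tangentads

/-! ### Sums of vector fields and automatic strictness -/

namespace Tangentads

variable {K : Type u} [Bicategory.{w, v} K] [Strict K]

open Cell

/-- The distributive law of a lax tangent morphism as a tangent 2-morphism. -/
theorem LaxMor.exists_twoMor_α {X Y : Tng K} (f : X ⟶ Y) :
    ∃ a : X.tangent ≫ f ⟶ f ≫ Y.tangent, a.φ = f.α := by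
  have h : ((α_ X.str.T X.str.T f.F).inv ≫ X.str.c ▷ f.F ≫ (α_ X.str.T X.str.T f.F).hom ≫
      X.str.T ◁ f.α ≫ (α_ X.str.T f.F Y.str.T).inv) ≫ f.α ▷ Y.str.T =
      X.str.T ◁ f.α ≫ (α_ X.str.T f.F Y.str.T).inv ≫ f.α ▷ Y.str.T ≫
        (α_ f.F Y.str.T Y.str.T).hom ≫ f.F ◁ Y.str.c ≫ (α_ f.F Y.str.T Y.str.T).inv := by
    have := congrArg (fun t => (α_ X.str.T X.str.T f.F).inv ≫ t ≫ (α_ f.F Y.str.T Y.str.T).inv)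
      f.flip
    simpa [double] using this
  exact ⟨⟨f.α, h⟩, rfl⟩

namespace TwoMor

/-- Compatibility with the distributive laws for 2-morphisms into the tangent bundle of a strict
tangent morphism. -/
theorem cell_comm_of_isStrict {X Y : Tng K} {G : Y ⟶ X} (hG : LaxMor.IsStrict G)
    (u : G ⟶ G ≫ X.tangent) (h : (wl Y.str.T (cell u.φ)).tgt = (wl G.F (cell X.str.c)).src) :
    wr (cell u.φ) X.str.T = (wl Y.str.T (cell u.φ)).comp (wl G.F (cell X.str.c)) h := by
  have key : ∀ (v : G.F ⟶ G.F ≫ X.str.T) (h : (wl Y.str.T (cell v)).tgt =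
      (wl G.F (cell X.str.c)).src), G.α ≫ v ▷ X.str.T = Y.str.T ◁ v ≫
      (α_ Y.str.T G.F X.str.T).inv ≫ G.α ▷ X.str.T ≫ (α_ G.F X.str.T X.str.T).hom ≫
        G.F ◁ X.str.c ≫ (α_ G.F X.str.T X.str.T).inv →
      wr (cell v) X.str.T = (wl Y.str.T (cell v)).comp (wl G.F (cell X.str.c)) h := fun v h e => by
    simpa [hG.cell_α] using cell_congr e
  exact key _ h u.comm

end TwoMor

/-- Sums of vector fields. -/
theorem VectorFieldOn.exists_isSum {X Y : Tng K} {G : Y ⟶ X} (u v : VectorFieldOn G) :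
    ∃ w, IsSum u v w := by
  have hs : ∀ u : VectorFieldOn G, ∃ a : G.F ⟶ G.F ≫ X.str.T,
      a = u.vec.φ ∧ a ≫ G.F ◁ X.str.p ≫ (ρ_ G.F).hom = 𝟙 G.F :=
    fun u => ⟨_, rfl, congrArg TwoMor.φ u.section_proj⟩
  obtain ⟨a, ha, ha'⟩ := hs u
  obtain ⟨b, hb, hb'⟩ := hs v
  obtain ⟨h, h0, h1⟩ := ((X.str.additive_whisker G.F).isNFoldPullback 2 two_pos).exists_isPair
    (a := a) (b := b) (by
      rw [← cancel_mono (ρ_ G.F).hom, Category.assoc, Category.assoc, ha', hb'])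
  -- The pairing is a tangent 2-morphism because its components are; composing with the tangent
  -- 2-morphism `sumN` keeps the sum inside the Hom-tangent category.
  obtain ⟨Φ, hΦ⟩ := Tng.exists_liftN two_pos (G := G) (H := G) h
    (fun i => G ◁ X.projN two_pos i) (fun i => cell_whiskerLeft _ _) ![u.vec, v.vec]
    (Fin.forall_fin_two.2 ⟨h0.trans ha, h1.trans hb⟩)
  refine ⟨⟨Φ ≫ G ◁ X.sumN, TwoMor.ext ?_⟩, h, ⟨h0.trans ha, h1.trans hb⟩, congrArg (· ≫ G.F ◁ X.str.s) hΦ.symm⟩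
  have h2 : (h ≫ G.F ◁ X.str.s) ≫ G.F ◁ X.str.p ≫ (ρ_ G.F).hom = 𝟙 G.F := by
    have := congrArg (G.F ◁ ·) X.str.additive.sum_proj
    simp only [whiskerLeft_comp] at this
    have h0' := congrArg (· ≫ G.F ◁ X.str.p ≫ (ρ_ G.F).hom) h0
    simp only [Category.assoc] at h0' ⊢
    rw [reassoc_of% this, h0', ha']
  exact (congrArg (fun t => (t ≫ G.F ◁ X.str.s) ≫ G.F ◁ X.str.p ≫ (ρ_ G.F).hom) hΦ).trans h2

theorem VectorFieldOn.IsSum.addCell {X Y : Tng K} {G : Y ⟶ X} {u v w : VectorFieldOn G}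
    (h : IsSum u v w) :
    X.str.AddCell G.F (𝟙 _) (cell u.vec.φ) (cell v.vec.φ) (cell w.vec.φ) :=
  TangentStructure.addCell_id_iff.2 h

namespace VectorFieldsConstruction

variable {X : Tng K} (V : VectorFieldsConstruction X)

/-- A 1-morphism into the tangentad of vector fields is strict if its underlying 1-morphism is. -/
theorem isStrict_of_comp {Y : Tng K} {H : Y ⟶ V.VF} (hG : LaxMor.IsStrict (H ≫ V.U)) :
    LaxMor.IsStrict H := by
  have hU := Tng.tangent_comp_of_isStrict V.isStrict
  have hb : (Y.tangent ≫ H) ≫ V.U = (H ≫ V.VF.tangent) ≫ V.U := by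
    rw [Strict.assoc, Tng.tangent_comp_of_isStrict hG, Strict.assoc, Strict.assoc, hU]
  -- The fields classified by `T ≫ H` and `H ≫ T` agree: composed with `c`, each becomes `v̂_H`
  -- whiskered with `T`, as fields on strict morphisms commute with the trivial distributive laws up
  -- to `c`. Then `c` is cancelled through `c ≫ c = 𝟙`.
  have key : ∀ v : V.U.F ⟶ V.U.F ≫ X.str.T,
      (∀ h, wr (cell v) X.str.T = (wl V.VF.str.T (cell v)).comp (wl V.U.F (cell X.str.c)) h) →
      (∀ h, wr (wl H.F (cell v)) X.str.T =
        (wl Y.str.T (wl H.F (cell v))).comp (wl (H.F ≫ V.U.F) (cell X.str.c)) h) →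
      wl (Y.str.T ≫ H.F) (cell v) = wl (H.F ≫ V.VF.str.T) (cell v) := fun v h1 h2 => by
    have hc := congrArg (wl (H.F ≫ V.U.F)) (cell_congr X.str.flip_flip)
    have hY : ∀ k : X.obj ⟶ X.obj, Y.str.T ≫ H.F ≫ V.U.F ≫ k = H.F ≫ V.U.F ≫ X.str.T ≫ k :=
      fun k => by
        have : Y.str.T ≫ H.F ≫ V.U.F = (H.F ≫ V.U.F) ≫ X.str.T := hG.T
        simpa using congrArg (· ≫ k) this
    have hV : V.VF.str.T ≫ V.U.F ≫ X.str.T = V.U.F ≫ X.str.T ≫ X.str.T := by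
      simpa using congrArg (· ≫ X.str.T) V.isStrict.T
    have hV' : (wl V.VF.str.T (cell v)).tgt = (wl V.U.F (cell X.str.c)).src := by simp [hV]
    have e1 := congrArg (wl H.F) (h1 hV')
    rw [wl_comp] at e1
    have e2 := h2 (by simp [hY])
    simp at hc e1 e2
    rw [← comp_one (H.F ≫ V.U.F ≫ X.str.T ≫ X.str.T) (wl (Y.str.T ≫ H.F) (cell v)) (by simp [hY]),
      ← comp_one (H.F ≫ V.U.F ≫ X.str.T ≫ X.str.T) (wl (H.F ≫ V.VF.str.T) (cell v)) (by simp [hV])]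
    simp only [← hc, reassoc (e2.symm.trans e1), comp_assoc]
  have hT : Y.tangent ≫ H = H ≫ V.VF.tangent := V.hom_ext hb (key V.univ.vec.φ
    (TwoMor.cell_comm_of_isStrict V.isStrict V.univ.vec)
    (fun h => (congrArg (wr · X.str.T) (V.cell_classified_vec H)).symm.trans
      ((TwoMor.cell_comm_of_isStrict hG (V.classified H).field.vec
        ((tgt_eq_of_eq (congrArg (wl Y.str.T) (V.cell_classified_vec H))).trans h)).trans
          (comp_congr (congrArg (wl Y.str.T) (V.cell_classified_vec H)) rfl))))
  obtain ⟨a, ha⟩ := H.exists_twoMor_α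
  have hone : one ((H.F ≫ V.U.F) ≫ X.str.T) = wr (one (Y.str.T ≫ H.F)) V.U.F := by
    have : Y.str.T ≫ H.F ≫ V.U.F = (H.F ≫ V.U.F) ≫ X.str.T := hG.T
    rw [wr_one, ← this, Strict.assoc]
  -- The distributive law of `H`, itself a tangent 2-morphism, becomes after `U` that of `H ≫ U`, an
  -- identity; faithfulness of `Γ` concludes.
  have : a = eqToHom hT := V.hom₂_ext (by
    rw [eqToHom_φ, cell_eqToHom, ha]
    exact (Tng.cell_comp_α_of_isStrict H V.isStrict).symm.trans (hG.cell_α.trans hone))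
  refine LaxMor.isStrict_iff.2 ⟨(Y.tangent ≫ H).F, ?_⟩
  rw [← cell_eqToHom (congrArg LaxMor.F hT), ← eqToHom_φ hT, ← this]
  exact cell_congr ha.symm

end VectorFieldsConstruction

end Tangentads

/-! ### The additive bundle of vector fields -/

namespace Tangentads

variable {K : Type u} [Bicategory.{w, v} K] [Strict K]

open Cell

/-- Strict tangent morphisms into a 2-pullback of strict tangent morphisms. -/
theorem StrictTng.isNFoldPullback {E B P : StrictTng K} {U : E ⟶ B} {n : ℕ} {π : Fin n → (P ⟶ E)}
    (hP : IsNFoldTwoPullback U.1.F (fun i => (π i).1.F)) : IsNFoldPullback U π where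
  comm i j := Subtype.ext ((Tng.isNFoldTwoPullback U.2 (fun i => (π i).2) hP).comm i j)
  existsUnique_lift {Y} f hf := by
    have hT := Tng.isNFoldTwoPullback U.2 (fun i => (π i).2) hP
    obtain ⟨h, hh⟩ := hT.exists_lift (fun i => (f i).1) fun i j => congrArg Subtype.val (hf i j)
    have hhF : ∀ i, h.F ≫ (π i).1.F = (f i).1.F := fun i => congrArg LaxMor.F (hh i)
    have hs : LaxMor.IsStrict h :=
      LaxMor.isStrict_iff.2 ⟨h.F ≫ P.toTng.str.T, hP.cell_ext fun i => by
        rw [← Tng.cell_comp_α_of_isStrict h (π i).2, hh i, (f i).2.cell_α, wr_one, Strict.assoc,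
          (π i).2.T, ← Strict.assoc, hhF]⟩
    exact ⟨⟨h, hs⟩, fun i => Subtype.ext (hh i), fun g hg => Subtype.ext (hT.ext fun i =>
      (congrArg Subtype.val (hg i)).trans (hh i).symm)⟩

namespace VectorFieldsConstruction

variable {X : Tng K} (V : VectorFieldsConstruction X)

theorem exists_classified_of_base {Y : Tng K} {H : Y ⟶ V.VF} {G : Y ⟶ X} (h : H ≫ V.U = G) :
    ∃ v : VectorFieldOn G, V.classified H = ⟨G, v⟩ := by
  subst h
  exact ⟨_, rfl⟩

theorem cell_vec_of_classified {Y : Tng K} {H : Y ⟶ V.VF} {G : Y ⟶ X} {v : VectorFieldOn G}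
    (h : V.classified H = ⟨G, v⟩) : cell v.vec.φ = wl H.F (cell V.univ.vec.φ) := by
  rw [← V.cell_classified_vec, h]

/-- The zero morphism and a sum morphism make the forgetful morphism an additive bundle. -/
theorem isAdditiveBundle {VFn : ℕ → StrictTng K} {π : ∀ n, Fin n → (VFn n ⟶ StrictTng.of V.VF)}
    (hπ : ∀ n, 0 < n → IsNFoldTwoPullback V.U.F (fun i => (π n i).1.F))
    {zero : StrictTng.of X ⟶ StrictTng.of V.VF} (hz : V.classified zero.1 = zeroVectorField X)
    {add : VFn 2 ⟶ StrictTng.of V.VF} {G : (VFn 2).toTng ⟶ X} {v₁ v₂ w : VectorFieldOn G}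
    (h₁ : V.classified (π 2 0).1 = ⟨G, v₁⟩) (h₂ : V.classified (π 2 1).1 = ⟨G, v₂⟩)
    (hs : VectorFieldOn.IsSum v₁ v₂ w) (hw : V.classified add.1 = ⟨G, w⟩) :
    IsAdditiveBundle V.strictU π zero add := by
  have b₁ : (π 2 0).1 ≫ V.U = G := congrArg VectorField.base h₁
  have b₂ : (π 2 1).1 ≫ V.U = G := congrArg VectorField.base h₂
  have b : add.1 ≫ V.U = G := congrArg VectorField.base hw
  have bz : zero.1 ≫ V.U = 𝟙 X := congrArg VectorField.base hz
  have hzv : wl zero.1.F (cell V.univ.vec.φ) = cell X.str.z := by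
    have h : cell (X.str.z ≫ (λ_ X.str.T).inv) = cell X.str.z := by simp
    rw [← V.cell_classified_vec, hz]
    exact h
  have hadd : X.str.AddCell G.F (𝟙 _) (wl (π 2 0).1.F (cell V.univ.vec.φ))
      (wl (π 2 1).1.F (cell V.univ.vec.φ)) (wl add.1.F (cell V.univ.vec.φ)) := by
    rw [← V.cell_vec_of_classified h₁, ← V.cell_vec_of_classified h₂,
      ← V.cell_vec_of_classified hw]
    exact hs.addCell
  -- Addition of 1-morphisms into `V.VF` is addition of the classified fields on the common base, by
  -- restricting the generic sum `hadd`. Each law below thus becomes the law for cells.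
  have key : ∀ {Y : StrictTng K} {a b c : Y ⟶ StrictTng.of V.VF}, IsAdd (π 2) add a b c →
      a.1 ≫ V.U = c.1 ≫ V.U ∧ b.1 ≫ V.U = c.1 ≫ V.U ∧
      X.str.AddCell (LaxMor.F (c.1 ≫ V.U)) (𝟙 _) (wl a.1.F (cell V.univ.vec.φ))
        (wl b.1.F (cell V.univ.vec.φ)) (wl c.1.F (cell V.univ.vec.φ)) := by
    rintro Y _ _ _ ⟨h, ⟨rfl, rfl⟩, rfl⟩
    have e₁ : (h.1 ≫ (π 2 0).1) ≫ V.U = h.1 ≫ G := by rw [Strict.assoc, b₁]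
    have e₂ : (h.1 ≫ (π 2 1).1) ≫ V.U = h.1 ≫ G := by rw [Strict.assoc, b₂]
    have e : (h.1 ≫ add.1) ≫ V.U = h.1 ≫ G := by rw [Strict.assoc, b]
    refine ⟨e₁.trans e.symm, e₂.trans e.symm, ?_⟩
    have := hadd.wl h.1.F
    simp only [wl_wl] at this
    have eF : LaxMor.F ((h.1 ≫ add.1) ≫ V.U) = h.1.F ≫ G.F := congrArg LaxMor.F e
    exact eF ▸ this
  refine .of_isAdd (fun n hn => StrictTng.isNFoldPullback (U := V.strictU) (hπ n hn))
    (Subtype.ext bz) (Subtype.ext (b.trans b₁.symm)) ?_ ?_ ?_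
  · intro Y a b c ab bc x y hab hbc hx hy
    obtain ⟨p1, p2, p3⟩ := key hab
    obtain ⟨q1, q2, q3⟩ := key hbc
    obtain ⟨r1, r2, r3⟩ := key hx
    obtain ⟨s1, s2, s3⟩ := key hy
    rw [r1] at p3
    rw [← q2, r2] at q3
    have e : x.1 ≫ V.U = y.1 ≫ V.U := by rw [← r2, q2, s2]
    rw [← e] at s3
    exact Subtype.ext (V.hom_ext e (p3.assoc q3 r3 s3))
  · intro Y a c h
    obtain ⟨p1, p2, p3⟩ := key h
    refine Subtype.ext (V.hom_ext p2.symm ?_)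
    rw [← p2] at p3
    obtain ⟨u, hu⟩ : ∃ u : a.1.F ≫ V.U.F ⟶ (a.1.F ≫ V.U.F) ≫ X.str.T,
      cell u = wl a.1.F (cell V.univ.vec.φ) := ⟨_, V.cell_classified_vec a.1⟩
    -- The field `u` is a section of `p`, so `u` followed by `p` and `z` is the zero field on the
    -- base, that is, the one classified by `a ≫ U ≫ 0`.
    have hzero : cell (u ≫ (a.1.F ≫ V.U.F) ◁ X.str.p ≫ (a.1.F ≫ V.U.F) ◁ X.str.z) =
        wl (a.1.F ≫ V.U.F ≫ zero.1.F) (cell V.univ.vec.φ) := by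
      have h1 := (wl_comp _ _ _ _).symm.trans (congrArg (wl a.1.F) V.cell_section_proj)
      have ht : (cell u).tgt = (wl (a.1.F ≫ V.U.F) (cell X.str.p)).src := by simp
      have h2 : (cell u).comp (wl (a.1.F ≫ V.U.F) (cell X.str.p)) ht = one (a.1.F ≫ V.U.F) :=
        (comp_congr hu (wl_wl _ _ _).symm).trans (h1.trans (wl_one _ _))
      have h3 := congrArg (wl (a.1.F ≫ V.U.F)) hzv
      simp only [wl_wl, Strict.assoc] at h3
      rw [h3]
      simp [reassoc h2]
    have hzero' : wl (LaxMor.F (a ≫ V.strictU ≫ zero).1) (cell V.univ.vec.φ) = _ := hzero.symm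
    rw [hzero', ← hu] at p3
    have := p3.unit
    rw [this]
    exact hu
  · intro Y a b c d h h'
    obtain ⟨p1, p2, p3⟩ := key h
    obtain ⟨q1, q2, q3⟩ := key h'
    have e : c.1 ≫ V.U = d.1 ≫ V.U := by rw [← p1, q2]
    rw [← e] at q3
    exact Subtype.ext (V.hom_ext e (p3.comm.unique (k := 0) rfl q3))

end VectorFieldsConstruction

end Tangentads

/-! ### Assembly of the theorem -/

theorem mainTheorem4 {K : Type u} [Bicategory.{w, v} K] [Bicategory.Strict K]
    (X : Tng K) (V : VectorFieldsConstruction X)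
    (hpb : ∀ n : ℕ, 0 < n → ∃ (P : K) (π : Fin n → (P ⟶ V.VF.obj)),
      IsNFoldTwoPullback V.U.F π) :
    ∃ (VFn : ℕ → StrictTng K) (π : ∀ n, Fin n → (VFn n ⟶ StrictTng.of V.VF))
      (zero : StrictTng.of X ⟶ StrictTng.of V.VF) (add : VFn 2 ⟶ StrictTng.of V.VF),
      -- `VFn n` with the strict tangent morphisms `π n` is the `n`-fold 2-pullback of `U`
      -- along itself, both in `K` and in the 2-category of tangentads of `K`
      (∀ n, 0 < n → IsNFoldTwoPullback V.U.F (fun i => (π n i).1.F)) ∧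
      (∀ n, 0 < n → IsNFoldTwoPullback V.U (fun i => (π n i).1)) ∧
      -- `zero` classifies the zero vector field
      V.classified zero.1 = zeroVectorField X ∧
      -- `add` classifies the sum of the two vector fields classified by the projections
      (∃ (G : (VFn 2).toTng ⟶ X) (v₁ v₂ w : VectorFieldOn G),
        V.classified (π 2 0).1 = ⟨G, v₁⟩ ∧ V.classified (π 2 1).1 = ⟨G, v₂⟩ ∧
        VectorFieldOn.IsSum v₁ v₂ w ∧ V.classified add.1 = ⟨G, w⟩) ∧
      -- `(U, zero, add)` is an additive bundle
      IsAdditiveBundle V.strictU π zero add := by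
  obtain ⟨Q, e, hQ⟩ := V.exists_replace_strictMap
  have : ∀ n, ∃ (P : StrictTng K) (π : Fin n → (P ⟶ StrictTng.of V.VF)),
      0 < n → IsNFoldTwoPullback V.U.F (fun i => (π i).1.F) := fun n => by
    rcases n.eq_zero_or_pos with rfl | hn
    -- The value at `0` is irrelevant; `X` fills the slot.
    · exact ⟨StrictTng.of X, fun i => i.elim0, fun h => absurd h (lt_irrefl _)⟩
    · obtain ⟨P, π, hP⟩ := hpb n hn
      obtain ⟨R, hR⟩ := hP.exists_strictMap hQ
      -- The projections preserve the replaced fibre powers, but they are strict morphisms to the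
      -- original `V.VF`, since sums do not depend on the chosen pullbacks.
      have : ∀ i, ∃ f : (⟨P, R⟩ : Tng K) ⟶ V.VF, f.F = π i ∧ LaxMor.IsStrict f := fun i =>
        StrictMap.exists_isStrict (X := ⟨P, R⟩) (hR i)
      choose f hf hs using this
      obtain rfl := funext hf
      exact ⟨StrictTng.of ⟨P, R⟩, fun i => ⟨f i, hs i⟩, fun _ => hP⟩
  choose VFn π hπ using this
  have hπT : ∀ n, 0 < n → IsNFoldTwoPullback V.U (fun i => (π n i).1) := fun n hn =>
    Tng.isNFoldTwoPullback V.isStrict (fun i => (π n i).2) (hπ n hn)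
  obtain ⟨zero, hz⟩ := V.exists_classified (zeroVectorField X)
  have hzs : LaxMor.IsStrict zero := V.isStrict_of_comp (by
    have : zero ≫ V.U = 𝟙 X := congrArg VectorField.base hz
    rw [this]
    exact isStrict_id X)
  obtain ⟨v₁, h₁⟩ := V.exists_classified_of_base (H := (π 2 0).1) rfl
  -- The commutation of the 2-pullback places the second field on the base `π 2 0 ≫ U` of the first,
  -- so that they can be added.
  obtain ⟨v₂, h₂⟩ := V.exists_classified_of_base ((hπT 2 two_pos).comm 1 0)
  obtain ⟨w, hw⟩ := v₁.exists_isSum v₂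
  obtain ⟨add, ha⟩ := V.exists_classified ⟨_, w⟩
  have has : LaxMor.IsStrict add := V.isStrict_of_comp (by
    have : add ≫ V.U = (π 2 0).1 ≫ V.U := congrArg VectorField.base ha
    rw [this]
    exact isStrict_comp (π 2 0).2 V.isStrict)
  exact ⟨VFn, π, ⟨zero, hzs⟩, ⟨add, has⟩, hπ, hπT, hz, ⟨_, v₁, v₂, w, h₁, h₂, hw, ha⟩,
    V.isAdditiveBundle hπ (zero := ⟨zero, hzs⟩) hz (add := ⟨add, has⟩) h₁ h₂ hw ha⟩
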